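/- For every integer $n\ge 0$ there exist constants $\delta>0$ and $K>0$, depending only on $n$, with the following property. Let $X$ be a compact connected complex manifold of complex dimension $n$ with $c_1(X)>0$, and let $g(t)=(g_{\bar kj}(t))$, $t\in[0,\infty)$, be a smooth solution of the normalized Kähler–Ricci flow $$\frac{\partial}{\partial t}g_{\bar kj}=-(R_{\bar kj}-g_{\bar kj}),\qquad R_{\bar kj}=-\partial_j\partial_{\bar k}\log\det g,$$ through Kähler metrics whose initial Kähler form $\omega_0=\frac{\sqrt{-1}}{2}g_{\bar kj}(0)\,dz^j\wedge d\bar z^k$ lies in the class $\pi c_1(X)$. For each $t\ge0$ let $u(t)$ be the Ricci potential of $g(t)$, that is, the smooth real function on $X$ with $$R_{\bar kj}-g_{\bar kj}=-\partial_j\partial_{\bar k}u,\qquad \frac1V\int_X e^{-u}\omega^n=1,\qquad V=\int_X\omega^n,\quad \omega=\frac{\sqrt{-1}}{2}g_{\bar kj}\,dz^j\wedge d\bar z^k .$$ Then for all $\varepsilon$ with $0<\varepsilon\le\delta$ and all $t_0\ge0$, $$\|u(t_0)\|_{C^0}\le\varepsilon\quad\Longrightarrow\quad \|\nabla u(t_0+2)\|_{C^0}+\|R(t_0+2)-n\|_{C^0}\le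 K\varepsilon ,$$ where $R=g^{j\bar k}R_{\bar kj}$ is the scalar curvature, $|\nabla u|^2=g^{j\bar k}\partial_ju\,\partial_{\bar k}u$, and both are taken with respect to the metric $g(t_0+2)$. No lower bound on the Ricci curvature is assumed. -/

import Mathlib

open Set Matrix MeasureTheory
open scoped Manifold ContDiff ComplexOrder

noncomputable section

namespace KRF

/-- The Wirtinger derivative `∂f/∂z^j` at `z`. -/
def dz {n : ℕ} (j : Fin n) (f : (Fin n → ℂ) → ℂ) (z : Fin n → ℂ) : ℂ :=
  (1 / 2 : ℂ) * (fderiv ℝ f z (Pi.single j 1) - Complex.I * fderiv ℝ f z (Pi.single j Complex.I))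

/-- The conjugate Wirtinger derivative `∂f/∂z̄^k` at `z`. -/
def dzbar {n : ℕ} (k : Fin n) (f : (Fin n → ℂ) → ℂ) (z : Fin n → ℂ) : ℂ :=
  (1 / 2 : ℂ) * (fderiv ℝ f z (Pi.single k 1) + Complex.I * fderiv ℝ f z (Pi.single k Complex.I))

/-- The Jacobian matrix `(∂τ^p/∂z^j)_{p j}` of a holomorphic map `τ` at `z`. -/
def jacobian {n : ℕ} (τ : (Fin n → ℂ) → (Fin n → ℂ)) (z : Fin n → ℂ) :
    Matrix (Fin n) (Fin n) ℂ :=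
  Matrix.of fun p j => fderiv ℂ τ z (Pi.single j 1) p

/-- A Kähler metric on a complex manifold of dimension `n`, given by its components in the charts
of the atlas: `coeff e z k j` is the component `g_{k̄j}` at the point with coordinates `z` in the
chart `e`. The values of `coeff e z` for `z` outside the target of `e` play no role. -/
structure KahlerMetric (n : ℕ) (X : Type*) [TopologicalSpace X]
    [ChartedSpace (Fin n → ℂ) X] where
  /-- The matrix `(g_{k̄j})_{k j}`. -/
  coeff : OpenPartialHomeomorph X (Fin n → ℂ) → (Fin n → ℂ) → Matrix (Fin n) (Fin n) ℂ
  /-- The metric is Hermitian and positive definite. -/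
  posDef : ∀ e ∈ atlas (Fin n → ℂ) X, ∀ z ∈ e.target, (coeff e z).PosDef
  /-- The components are smooth (in the real sense). -/
  smooth : ∀ e ∈ atlas (Fin n → ℂ) X, ∀ k j : Fin n,
    ContDiffOn ℝ ∞ (fun z => coeff e z k j) e.target
  /-- The components transform as a tensor:
  `g_{k̄j} = conj (∂w^q/∂z^k) * g'_{q̄p} * ∂w^p/∂z^j`. -/
  transform : ∀ e ∈ atlas (Fin n → ℂ) X, ∀ e' ∈ atlas (Fin n → ℂ) X,
    ∀ x ∈ e.source ∩ e'.source,
      coeff e (e x) = (jacobian (e' ∘ e.symm) (e x))ᴴ * coeff e' (e' x) *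
        jacobian (e' ∘ e.symm) (e x)
  /-- The form `(i/2) g_{k̄j} dz^j ∧ dz̄^k` is closed. -/
  closed : ∀ e ∈ atlas (Fin n → ℂ) X, ∀ z ∈ e.target, ∀ j k l : Fin n,
    dz l (fun w => coeff e w k j) z = dz j (fun w => coeff e w k l) z

variable {n : ℕ} {X : Type*} [TopologicalSpace X] [ChartedSpace (Fin n → ℂ) X]

/-- The Ricci curvature `R_{k̄j} = - ∂_j ∂_{k̄} log det g`, in the chart `e`. -/
def KahlerMetric.ricci (g : KahlerMetric n X) (e : OpenPartialHomeomorph X (Fin n → ℂ))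
    (z : Fin n → ℂ) : Matrix (Fin n) (Fin n) ℂ :=
  Matrix.of fun k j =>
    -dz j (dzbar k (fun w => ((Real.log (g.coeff e w).det.re : ℝ) : ℂ))) z

/-- The complex Hessian `∂_j ∂_{k̄} u` of a real function `u`, in the chart `e`. -/
def complexHessian (u : X → ℝ) (e : OpenPartialHomeomorph X (Fin n → ℂ))
    (z : Fin n → ℂ) : Matrix (Fin n) (Fin n) ℂ :=
  Matrix.of fun k j => dz j (dzbar k (fun w => (u (e.symm w) : ℂ))) z

/-- The scalar curvature `R = g^{jk̄} R_{k̄j}`, where `(g^{jk̄})` is the inverse matrix of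
`(g_{k̄j})`. It is real and does not depend on the chart; the preferred chart at `x` is used. -/
def KahlerMetric.scalarCurvature (g : KahlerMetric n X) (x : X) : ℝ :=
  (((g.coeff (chartAt (Fin n → ℂ) x) (chartAt (Fin n → ℂ) x x))⁻¹ *
    g.ricci (chartAt (Fin n → ℂ) x) (chartAt (Fin n → ℂ) x x)).trace).re

/-- The pointwise norm `|∇u| = (g^{jk̄} ∂_j u ∂_{k̄} u)^{1/2}` of the gradient of a real function.
The expression under the root is real, nonnegative and independent of the chart. -/
def KahlerMetric.gradNorm (g : KahlerMetric n X) (u : X → ℝ) (x : X) : ℝ :=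
  let e := chartAt (Fin n → ℂ) x
  Real.sqrt (∑ j, ∑ k, (g.coeff e (e x))⁻¹ j k *
    dz j (fun w => (u (e.symm w) : ℂ)) (e x) * dzbar k (fun w => (u (e.symm w) : ℂ)) (e x)).re

/-- The measure given by the volume form `ω^n`, where `ω = (i/2) g_{k̄j} dz^j ∧ dz̄^k`. In a chart
it is `n! det g` times Lebesgue measure. The measures on the chart domains agree on overlaps, so
that their supremum is the measure on `X` that restricts to each of them. -/
def KahlerMetric.volume [MeasurableSpace X] (g : KahlerMetric n X) : Measure X :=
  ⨆ e ∈ atlas (Fin n → ℂ) X,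
    Measure.map e.symm
      (((MeasureTheory.volume : Measure (Fin n → ℂ)).restrict e.target).withDensity
        fun z => ENNReal.ofReal (n.factorial * (g.coeff e z).det.re))

/-- `u` is the Ricci potential of `g`: a smooth real function with
`R_{k̄j} - g_{k̄j} = - ∂_j ∂_{k̄} u` and `(1/V) ∫ e^{-u} ω^n = 1`, where `V = ∫ ω^n`. -/
structure IsRicciPotential [MeasurableSpace X] (g : KahlerMetric n X) (u : X → ℝ) : Prop where
  smooth : ContMDiff 𝓘(ℝ, Fin n → ℂ) 𝓘(ℝ, ℝ) ∞ u
  ricci_sub : ∀ e ∈ atlas (Fin n → ℂ) X, ∀ z ∈ e.target,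
    g.ricci e z - g.coeff e z = -complexHessian u e z
  normalized : 1 / g.volume.real univ * ∫ x, Real.exp (-u x) ∂g.volume = 1

/-- `g` restricted to `[0, ∞)` is a smooth solution of the (normalized) Kähler-Ricci flow
`∂g_{k̄j}/∂t = -(R_{k̄j} - g_{k̄j})`. The values `g t` for `t < 0` play no role. -/
structure IsKahlerRicciFlow (g : ℝ → KahlerMetric n X) : Prop where
  smooth : ∀ e ∈ atlas (Fin n → ℂ) X, ∀ k j : Fin n,
    ContDiffOn ℝ ∞ (fun p : ℝ × (Fin n → ℂ) => (g p.1).coeff e p.2 k j) (Ici 0 ×ˢ e.target)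
  flow : ∀ e ∈ atlas (Fin n → ℂ) X, ∀ z ∈ e.target, ∀ t : ℝ, 0 ≤ t → ∀ k j : Fin n,
    HasDerivWithinAt (fun s => (g s).coeff e z k j)
      (-((g t).ricci e z k j - (g t).coeff e z k j)) (Ici 0) t

/-- The `C^0` norm of a real function, with value `∞` on unbounded functions. -/
def normC0 {Y : Type*} (f : Y → ℝ) : ENNReal := ⨆ x, ENNReal.ofReal |f x|

end KRF

end

/-!
The proof is a parabolic smoothing argument with a single test function. Fix `t₀`, put `s = t - t₀`
and let `v` solve the ordinary differential equation `∂v/∂t = v + (n - R)` with `v = u(t₀)` at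
`s = 0` (`flowPotential`). Along the flow `∂_t log det g = n - R`, so `∂∂̄v - (g - Ric)` solves
`∂P/∂t = P` and vanishes at `s = 0`; hence `∂∂̄v = g - Ric` and `Δv = n - R` at all later times
(`LocalFlow.hess_flowPotential`), and `∂v/∂t = v + Δv`. As `u(t) - v(t)` is pluriharmonic on a
compact connected manifold, it is constant (`eq_of_pluriharmonic`), so that `|∇u| = |∇v|`.

Bochner's formula (`AlgKahler.bochner`), in which the Ricci term cancels against the derivative of
the metric, gives the evolution equations
* `(∂_t - Δ) v² = 2 v² - 2 |∇v|²`,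
* `(∂_t - Δ) |∇v|² = |∇v|² - |∇∇v|² - |∇∇̄v|²`,
* `(∂_t - Δ) Δv = Δv - |∇∇̄v|²`.

For `F = 2 v² + s |∇v|² + c s² Δv` with `c = ± ε / 4`, `ε ≤ 1` and `0 ≤ s ≤ 2`, the coefficient of
`|∇v|²` in `(∂_t - Δ) F` is `s - 3 < 0`, and that of `|∇∇̄v|²` is `-(s + c s²) ≤ -s / 2`. By
`(Δv)² ≤ n |∇∇̄v|²` this good term absorbs the terms linear in `Δv`, and
`(∂_t - Δ) F ≤ 4 v² + n ε²` (`AlgFlow.evolution_test_le`). The maximum principle (`le_of_heatLE`),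
applied to `± e^{-s} v`, bounds `|v|` by `e^s ε`, and applied to `F` it gives `F ≤ C ε²` at `s = 2`.
There `F = 2 v² + 2 |∇v|² ± ε (n - R)`, and the two signs together bound `|∇v|²` by a multiple of
`ε²` and `|R - n|` by a multiple of `ε`.

The tensor calculus is done in a commutative ring with commuting derivations `∂_j`, `∂_{k̄}`, `∂_t`:
it is then pure algebra, and is applied to the ring of smooth functions of time and of the
coordinates of a chart.
-/

noncomputable section

namespace KRF

/-! ### Kähler geometry in a ring with commuting derivations -/

section Algebra

variable {k A ι : Type*} [CommRing k] [CommRing A] [Algebra k A] [Fintype ι]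

theorem map_derivation_mul (D : Derivation k A A) (M N : Matrix ι ι A) :
    (M * N).map D = M.map D * N + M * N.map D := by
  ext i j
  simp only [Matrix.map_apply, Matrix.mul_apply, Matrix.add_apply, map_sum, Derivation.leibniz,
    smul_eq_mul, ← Finset.sum_add_distrib]
  exact Finset.sum_congr rfl fun a _ => by ring

theorem derivation_comp_mulVec (D : Derivation k A A) (M : Matrix ι ι A) (v : ι → A) :
    (fun i => D ((M *ᵥ v) i)) = M.map D *ᵥ v + M *ᵥ fun i => D (v i) := by
  ext i
  simp only [Matrix.mulVec, dotProduct, Pi.add_apply, Matrix.map_apply, map_sum,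
    Derivation.leibniz, smul_eq_mul, ← Finset.sum_add_distrib]
  exact Finset.sum_congr rfl fun a _ => by ring

theorem derivation_comp_vecMul (D : Derivation k A A) (M : Matrix ι ι A) (v : ι → A) :
    (fun i => D ((v ᵥ* M) i)) = (fun i => D (v i)) ᵥ* M + v ᵥ* M.map D := by
  ext i
  simp only [Matrix.vecMul, dotProduct, Pi.add_apply, Matrix.map_apply, map_sum,
    Derivation.leibniz, smul_eq_mul, ← Finset.sum_add_distrib]
  exact Finset.sum_congr rfl fun a _ => by ring

theorem derivation_dotProduct (D : Derivation k A A) (v w : ι → A) :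
    D (v ⬝ᵥ w) = (fun i => D (v i)) ⬝ᵥ w + v ⬝ᵥ fun i => D (w i) := by
  simp only [dotProduct, map_sum, Derivation.leibniz, smul_eq_mul, ← Finset.sum_add_distrib]
  exact Finset.sum_congr rfl fun a _ => by ring

theorem derivation_trace (D : Derivation k A A) (M : Matrix ι ι A) :
    D M.trace = (M.map D).trace := by
  simp [Matrix.trace, map_sum]

omit [Fintype ι] in
theorem map_derivation_one [DecidableEq ι] (D : Derivation k A A) :
    (1 : Matrix ι ι A).map D = 0 := by
  ext i j
  by_cases h : i = j <;> simp [h]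

/-- The derivative of an inverse matrix. -/
theorem map_derivation_inv [DecidableEq ι] (D : Derivation k A A) {M G : Matrix ι ι A}
    (hGM : G * M = 1) : G.map D = -(G * M.map D * G) := by
  have hMG : M * G = 1 := mul_eq_one_comm.mp hGM
  have h := map_derivation_mul D G M
  rw [hGM, map_derivation_one] at h
  have h2 : (G.map D * M + G * M.map D) * G = 0 := by rw [← h, zero_mul]
  rw [add_mul, mul_assoc, hMG, mul_one] at h2
  exact eq_neg_of_add_eq_zero_left h2

/-- The complex Hessian `(∂_j ∂_{k̄} φ)_{k j}` in a ring with derivations `d j = ∂_j` and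
`db k = ∂_{k̄}`. -/
def algHess (d db : ι → Derivation k A A) (φ : A) : Matrix ι ι A :=
  Matrix.of fun p q => d q (db p φ)

/-- A Kähler metric in a commutative ring `A` with commuting derivations `d j = ∂_j`,
`db k = ∂_{k̄}`: a matrix `M`, its inverse `G`, and the closedness of the associated form. -/
structure AlgKahler [DecidableEq ι] (d db : ι → Derivation k A A) (M G : Matrix ι ι A) :
    Prop where
  comm_dd : ∀ i j a, d i (d j a) = d j (d i a)
  comm_bb : ∀ i j a, db i (db j a) = db j (db i a)
  comm_db : ∀ i j a, d i (db j a) = db j (d i a)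
  inv : G * M = 1
  closed : ∀ l p j, d l (M p j) = d j (M p l)
  closed_bar : ∀ l p j, db l (M p j) = db p (M l j)

variable [DecidableEq ι] {d db : ι → Derivation k A A} {M G : Matrix ι ι A}

/-- The Christoffel symbols `Γ^a_{lj}`, as a matrix in `a j` for each `l`. -/
def christoffel (d : ι → Derivation k A A) (M G : Matrix ι ι A) (l : ι) : Matrix ι ι A :=
  G * M.map (d l)

/-- The conjugate Christoffel symbols, as a matrix with the upper index second for each `m`. -/
def christoffelBar (db : ι → Derivation k A A) (M G : Matrix ι ι A) (m : ι) : Matrix ι ι A :=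
  M.map (db m) * G

theorem AlgKahler.christoffel_symm (h : AlgKahler d db M G) (l a j : ι) :
    christoffel d M G l a j = christoffel d M G j a l := by
  simp only [christoffel, Matrix.mul_apply, Matrix.map_apply]
  exact Finset.sum_congr rfl fun b _ => by rw [h.closed]

theorem AlgKahler.christoffelBar_symm (h : AlgKahler d db M G) (m k' a : ι) :
    christoffelBar db M G m k' a = christoffelBar db M G k' m a := by
  simp only [christoffelBar, Matrix.mul_apply, Matrix.map_apply]
  exact Finset.sum_congr rfl fun b _ => by rw [h.closed_bar]

theorem AlgKahler.d_inv (h : AlgKahler d db M G) (l : ι) :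
    G.map (d l) = -(christoffel d M G l * G) := map_derivation_inv _ h.inv

theorem AlgKahler.db_inv (h : AlgKahler d db M G) (m : ι) :
    G.map (db m) = -(G * christoffelBar db M G m) := by
  rw [map_derivation_inv _ h.inv, christoffelBar, mul_assoc]

/-- The `(2,0)` part `∇_l ∇_j v` of the covariant Hessian, as a vector in `j`. -/
def covHess (d : ι → Derivation k A A) (M G : Matrix ι ι A) (v : A) (l : ι) : ι → A :=
  (fun j => d l (d j v)) - (fun j => d j v) ᵥ* christoffel d M G l

/-- The `(0,2)` part of the covariant Hessian. -/
def covHessBar (db : ι → Derivation k A A) (M G : Matrix ι ι A) (v : A) (m : ι) : ι → A :=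
  (fun j => db m (db j v)) - christoffelBar db M G m *ᵥ fun j => db j v

/-- The squared length `g^{jk̄} ∂_j v ∂_{k̄} v` of the gradient. -/
def algGradSq (d db : ι → Derivation k A A) (G : Matrix ι ι A) (v : A) : A :=
  (fun j => d j v) ⬝ᵥ (G *ᵥ fun j => db j v)

/-- The Laplacian `g^{jk̄} ∂_j ∂_{k̄}`. -/
def algLap (d db : ι → Derivation k A A) (G : Matrix ι ι A) (φ : A) : A :=
  (G * algHess d db φ).trace

theorem AlgKahler.d_gradSq (h : AlgKahler d db M G) (v : A) (l : ι) :
    d l (algGradSq d db G v) = covHess d M G v l ⬝ᵥ (G *ᵥ fun j => db j v)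
      + ((fun j => d j v) ᵥ* G) ⬝ᵥ fun p => algHess d db v p l := by
  rw [algGradSq, derivation_dotProduct, derivation_comp_mulVec, h.d_inv, covHess, sub_dotProduct,
    dotProduct_add, neg_mulVec, dotProduct_neg, dotProduct_mulVec _ (_ * _), ← vecMul_vecMul,
    ← dotProduct_mulVec _ G, ← dotProduct_mulVec _ G]
  simp only [algHess, Matrix.of_apply]
  ring

/-- The second derivative `∂_{m̄} ∂_l |∇v|²`, sorted into squares of covariant Hessians, covariant
third derivatives paired with the gradient, and a curvature term. -/
theorem AlgKahler.db_d_gradSq (h : AlgKahler d db M G) (v : A) (l m : ι) :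
    db m (d l (algGradSq d db G v)) =
      covHess d M G v l ⬝ᵥ (G *ᵥ covHessBar db M G v m)
      + (G *ᵥ fun p => algHess d db v p l) ⬝ᵥ (fun j => algHess d db v m j)
      + ((fun j => db m (d l (d j v))) -
          (fun j => algHess d db v m j) ᵥ* christoffel d M G l) ⬝ᵥ (G *ᵥ fun j => db j v)
      + ((fun j => d j v) ᵥ* G) ⬝ᵥ ((fun p => db m (algHess d db v p l)) -
          christoffelBar db M G m *ᵥ fun p => algHess d db v p l)
      - ((fun j => d j v) ᵥ* (christoffel d M G l).map (db m)) ⬝ᵥ (G *ᵥ fun j => db j v) := by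
  have e1 : (fun j => db m ((G *ᵥ fun j => db j v) j)) = G *ᵥ covHessBar db M G v m := by
    rw [derivation_comp_mulVec, h.db_inv, covHessBar, mulVec_sub, neg_mulVec, ← mulVec_mulVec]
    abel
  have e2 : (fun j => db m (covHess d M G v l j)) = (fun j => db m (d l (d j v))) -
      (fun j => algHess d db v m j) ᵥ* christoffel d M G l
      - (fun j => d j v) ᵥ* (christoffel d M G l).map (db m) := by
    have : (fun j => db m (covHess d M G v l j)) = (fun j => db m (d l (d j v))) -
      fun j => db m (((fun j => d j v) ᵥ* christoffel d M G l) j) := by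
      ext j; simp [covHess]
    rw [this, derivation_comp_vecMul]
    simp only [algHess, Matrix.of_apply, h.comm_db]
    abel
  have e3 : (fun j => db m (((fun j => d j v) ᵥ* G) j)) =
      (fun j => algHess d db v m j) ᵥ* G - ((fun j => d j v) ᵥ* G) ᵥ* christoffelBar db M G m := by
    rw [derivation_comp_vecMul, h.db_inv, vecMul_neg, ← vecMul_vecMul]
    simp only [algHess, Matrix.of_apply, h.comm_db]
    abel
  rw [h.d_gradSq, map_add, derivation_dotProduct, derivation_dotProduct, e1, e2, e3]
  simp only [sub_dotProduct, dotProduct_sub, ← dotProduct_mulVec]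
  rw [dotProduct_comm (fun j => algHess d db v m j) (G *ᵥ _)]
  ring

/-! ### Bochner's formula -/

omit [DecidableEq ι] in
theorem sum_mul_dotProduct (G : Matrix ι ι A) (w : ι → ι → ι → A) (X : ι → A) :
    ∑ l, ∑ m, G l m * (w l m ⬝ᵥ X) = (fun j => ∑ l, ∑ m, G l m * w l m j) ⬝ᵥ X := by
  simp only [dotProduct, Finset.mul_sum, Finset.sum_mul]
  rw [Finset.sum_comm (s := Finset.univ (α := ι)) (t := Finset.univ (α := ι))
    (f := fun j l => ∑ m, G l m * w l m j * X j)]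
  refine Finset.sum_congr rfl fun l _ => ?_
  rw [Finset.sum_comm]
  exact Finset.sum_congr rfl fun j _ => Finset.sum_congr rfl fun m _ => by ring

omit [DecidableEq ι] in
theorem trace_mul_eq_sum (G N : Matrix ι ι A) :
    (G * N).trace = ∑ l, ∑ m, G l m * N m l := by
  simp only [Matrix.trace, Matrix.diag, Matrix.mul_apply]

/-- `∂_j Δv` as a trace of third derivatives: `∂_j` is exchanged with `∂_l` by the symmetry of the
Christoffel symbols, that is, by closedness. -/
theorem AlgKahler.d_lap (h : AlgKahler d db M G) (v : A) (j : ι) :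
    d j (algLap d db G v) = ∑ l, ∑ m, G l m * (db m (d l (d j v)) -
      ((fun j => algHess d db v m j) ᵥ* christoffel d M G l) j) := by
  have e : (christoffel d M G j * G * algHess d db v).trace =
      ∑ l, ∑ m, G l m * ((fun j => algHess d db v m j) ᵥ* christoffel d M G l) j := by
    have e1 : ∀ l, ∑ m, G l m * ((fun j => algHess d db v m j) ᵥ* christoffel d M G l) j =
        ∑ a, (G * algHess d db v) l a * christoffel d M G j a l := by
      intro l
      simp only [vecMul, dotProduct, Matrix.mul_apply, Finset.mul_sum, Finset.sum_mul]
      rw [Finset.sum_comm]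
      refine Finset.sum_congr rfl fun a _ => Finset.sum_congr rfl fun m _ => ?_
      rw [h.christoffel_symm]; ring
    rw [Finset.sum_congr rfl fun l _ => e1 l, mul_assoc, trace_mul_comm]
    rfl
  rw [algLap, derivation_trace, map_derivation_mul, trace_add, h.d_inv, neg_mul, trace_neg, e,
    trace_mul_eq_sum G]
  simp only [mul_sub, Finset.sum_sub_distrib, Matrix.map_apply, algHess, Matrix.of_apply,
    h.comm_dd j, h.comm_db]
  ring

/-- The conjugate of `AlgKahler.d_lap`. -/
theorem AlgKahler.db_lap (h : AlgKahler d db M G) (v : A) (p : ι) :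
    db p (algLap d db G v) = ∑ l, ∑ m, G l m * (db m (algHess d db v p l) -
      (christoffelBar db M G m *ᵥ fun q => algHess d db v q l) p) := by
  have e : (G * christoffelBar db M G p * algHess d db v).trace =
      ∑ l, ∑ m, G l m * (christoffelBar db M G m *ᵥ fun q => algHess d db v q l) p := by
    rw [Finset.sum_comm]
    have e1 : ∀ m, ∑ l, G l m * (christoffelBar db M G m *ᵥ fun q => algHess d db v q l) p =
        ∑ a, christoffelBar db M G p m a * (algHess d db v * G) a m := by
      intro l
      simp only [mulVec, dotProduct, Matrix.mul_apply, Finset.mul_sum]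
      rw [Finset.sum_comm]
      refine Finset.sum_congr rfl fun a _ => Finset.sum_congr rfl fun m _ => ?_
      rw [h.christoffelBar_symm]; ring
    rw [Finset.sum_congr rfl fun l _ => e1 l, mul_assoc, trace_mul_comm, mul_assoc]
    rfl
  rw [algLap, derivation_trace, map_derivation_mul, trace_add, h.db_inv, neg_mul, trace_neg, e,
    trace_mul_eq_sum G]
  simp only [mul_sub, Finset.sum_sub_distrib, Matrix.map_apply, algHess, Matrix.of_apply,
    h.comm_bb p, h.comm_db]
  ring

/-- The symmetry `R_{k̄jm̄l} = R_{m̄jk̄l}` of the curvature tensor. -/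
theorem AlgKahler.curvature_symm (h : AlgKahler d db M G) (l m p j : ι) :
    (M * (christoffel d M G l).map (db m)) p j = (M * (christoffel d M G l).map (db p)) m j := by
  have e : ∀ m p, (M * (christoffel d M G l).map (db m)) p j = d l (db m (M p j)) -
      ∑ a, db m (M p a) * christoffel d M G l a j := by
    intro m p
    have hM : M * christoffel d M G l = M.map (d l) := by
      rw [christoffel, ← mul_assoc, mul_eq_one_comm.mp h.inv, one_mul]
    have h1 := map_derivation_mul (db m) M (christoffel d M G l)
    rw [hM] at h1
    have h2 := congrFun (congrFun h1 p) j
    rw [Matrix.add_apply, Matrix.map_apply, Matrix.map_apply, ← h.comm_db, Matrix.mul_apply] at h2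
    rw [h2]
    simp
  rw [e, e, h.closed_bar]
  congr 1
  exact Finset.sum_congr rfl fun a _ => by rw [h.closed_bar]

/-- The squared length of the `(2,0)` part of the covariant Hessian. -/
def algCovHessSq (d db : ι → Derivation k A A) (M G : Matrix ι ι A) (v : A) : A :=
  ∑ l, ∑ m, G l m * (covHess d M G v l ⬝ᵥ (G *ᵥ covHessBar db M G v m))

/-- The trace of the curvature term of `AlgKahler.db_d_gradSq` is the Ricci curvature
`-∂_j ∂_{k̄} log det g`, up to sign, evaluated on the gradient. The hypothesis on `ℓ` is Jacobi's
formula for `ℓ = log det g`. -/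
theorem AlgKahler.ricci_contract (h : AlgKahler d db M G) (v : A) {ℓ : A}
    (hℓ : ∀ j, d j ℓ = (G * M.map (d j)).trace) :
    ∑ l, ∑ m, G l m * (((fun j => d j v) ᵥ* (christoffel d M G l).map (db m)) ⬝ᵥ
      (G *ᵥ fun j => db j v)) =
    ((fun j => d j v) ᵥ* G) ⬝ᵥ (algHess d db ℓ *ᵥ (G *ᵥ fun j => db j v)) := by
  set X := G *ᵥ fun j => db j v
  set Y := (fun j => d j v) ᵥ* G with hY
  have hP : (fun j => d j v) = Y ᵥ* M := by
    rw [hY, vecMul_vecMul, h.inv, vecMul_one]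
  have hR : ∀ p j, algHess d db ℓ p j = ∑ l, db p (christoffel d M G l l j) := by
    intro p j
    rw [algHess, Matrix.of_apply, h.comm_db, hℓ, derivation_trace]
    exact Finset.sum_congr rfl fun l _ => by
      rw [← h.christoffel_symm]; rfl
  have key : ∀ l p j, ∑ m, G l m * (M * (christoffel d M G l).map (db m)) p j =
      db p (christoffel d M G l l j) := by
    intro l p j
    have : ∑ m, G l m * (M * (christoffel d M G l).map (db m)) p j =
        (G * (M * (christoffel d M G l).map (db p))) l j := by
      rw [Matrix.mul_apply]
      exact Finset.sum_congr rfl fun m _ => by rw [h.curvature_symm]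
    rw [this, ← mul_assoc, h.inv, one_mul]; rfl
  rw [sum_mul_dotProduct, dotProduct_mulVec _ (algHess d db ℓ)]
  congr 1
  ext j
  have e1 : ∀ l m, G l m * ((fun j => d j v) ᵥ* (christoffel d M G l).map (db m)) j =
      Y ⬝ᵥ fun p => G l m * (M * (christoffel d M G l).map (db m)) p j := by
    intro l m
    rw [hP, vecMul_vecMul]
    simp only [vecMul, dotProduct, Finset.mul_sum]
    exact Finset.sum_congr rfl fun p _ => by ring
  simp only [e1]
  simp only [vecMul, dotProduct, hR, ← key, Finset.mul_sum]
  exact (Finset.sum_congr rfl fun l _ => Finset.sum_comm).trans Finset.sum_comm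

/-- **Bochner's formula** on a Kähler manifold. -/
theorem AlgKahler.bochner (h : AlgKahler d db M G) (v : A) {ℓ : A}
    (hℓ : ∀ j, d j ℓ = (G * M.map (d j)).trace) :
    algLap d db G (algGradSq d db G v) =
      algCovHessSq d db M G v + (G * algHess d db v * (G * algHess d db v)).trace
      + (fun j => d j (algLap d db G v)) ⬝ᵥ (G *ᵥ fun j => db j v)
      + ((fun j => d j v) ᵥ* G) ⬝ᵥ (fun j => db j (algLap d db G v))
      - ((fun j => d j v) ᵥ* G) ⬝ᵥ (algHess d db ℓ *ᵥ (G *ᵥ fun j => db j v)) := by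
  have e0 : algLap d db G (algGradSq d db G v) =
      ∑ l, ∑ m, G l m * db m (d l (algGradSq d db G v)) := by
    simp only [algLap, Matrix.trace, Matrix.diag, Matrix.mul_apply, algHess, Matrix.of_apply,
      h.comm_db]
  have e2 : ∑ l, ∑ m, G l m *
      ((G *ᵥ fun p => algHess d db v p l) ⬝ᵥ (fun j => algHess d db v m j)) =
      (G * algHess d db v * (G * algHess d db v)).trace := by
    rw [trace_mul_comm, mul_assoc, Matrix.trace]
    refine Finset.sum_congr rfl fun l _ => ?_
    rw [Matrix.diag, Matrix.mul_apply]
    refine Finset.sum_congr rfl fun m _ => ?_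
    rw [dotProduct_comm]; rfl
  have e3 : ∑ l, ∑ m, G l m * (((fun j => db m (d l (d j v))) -
          (fun j => algHess d db v m j) ᵥ* christoffel d M G l) ⬝ᵥ (G *ᵥ fun j => db j v)) =
      (fun j => d j (algLap d db G v)) ⬝ᵥ (G *ᵥ fun j => db j v) := by
    simp only [h.d_lap, sum_mul_dotProduct, Pi.sub_apply]
  have e4 : ∑ l, ∑ m, G l m * (((fun j => d j v) ᵥ* G) ⬝ᵥ
          ((fun p => db m (algHess d db v p l)) -
          christoffelBar db M G m *ᵥ fun p => algHess d db v p l)) =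
      ((fun j => d j v) ᵥ* G) ⬝ᵥ (fun j => db j (algLap d db G v)) := by
    simp only [h.db_lap, dotProduct_comm (_ ᵥ* G), sum_mul_dotProduct, Pi.sub_apply]
  rw [e0, ← h.ricci_contract v hℓ, ← e2, ← e3, ← e4, algCovHessSq]
  simp only [h.db_d_gradSq, mul_add, mul_sub, Finset.sum_add_distrib, Finset.sum_sub_distrib]

/-! ### Evolution equations along the flow -/

/-- A solution of the Kähler-Ricci flow together with a Ricci potential `v`, normalized so that
`∂v/∂t = Δv + v`, in a ring with a derivation `dt = ∂_t`; `ℓ` stands for `log det g`. -/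
structure AlgFlow (d db : ι → Derivation k A A) (dt : Derivation k A A) (M G : Matrix ι ι A)
    (v ℓ : A) : Prop extends AlgKahler d db M G where
  comm_td : ∀ i a, dt (d i a) = d i (dt a)
  comm_tb : ∀ i a, dt (db i a) = db i (dt a)
  d_logDet : ∀ j, d j ℓ = (G * M.map (d j)).trace
  hess_potential : algHess d db v = M + algHess d db ℓ
  dt_metric : M.map dt = algHess d db v
  dt_potential : dt v = v + algLap d db G v

variable {dt : Derivation k A A} {v ℓ : A}

theorem AlgFlow.dt_inv (h : AlgFlow d db dt M G v ℓ) :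
    G.map dt = -(G * algHess d db v * G) := by
  rw [map_derivation_inv _ h.inv, h.dt_metric]

/-- `(∂_t - Δ) |∇v|² = |∇v|² - |∇∇v|² - |∇∇̄v|²`. -/
theorem AlgFlow.evolution_gradSq (h : AlgFlow d db dt M G v ℓ) :
    dt (algGradSq d db G v) - algLap d db G (algGradSq d db G v) = algGradSq d db G v
      - algCovHessSq d db M G v - (G * algHess d db v * (G * algHess d db v)).trace := by
  have e1 : (fun j => dt (d j v)) = (fun j => d j v) + fun j => d j (algLap d db G v) := by
    ext j; simp [h.comm_td, h.dt_potential]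
  have e2 : (fun j => dt (db j v)) = (fun j => db j v) + fun j => db j (algLap d db G v) := by
    ext j; simp [h.comm_tb, h.dt_potential]
  have e3 : ((fun j => d j v) ᵥ* G) ⬝ᵥ (M *ᵥ (G *ᵥ fun j => db j v)) = algGradSq d db G v := by
    rw [dotProduct_mulVec, vecMul_vecMul, h.inv, vecMul_one]; rfl
  have e4 : ((fun j => d j v) ᵥ* G) ⬝ᵥ (algHess d db v *ᵥ (G *ᵥ fun j => db j v)) =
      algGradSq d db G v +
      ((fun j => d j v) ᵥ* G) ⬝ᵥ (algHess d db ℓ *ᵥ (G *ᵥ fun j => db j v)) := by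
    rw [h.hess_potential, add_mulVec, dotProduct_add, e3]
  have e5 : dt (algGradSq d db G v) = 2 * algGradSq d db G v
      + (fun j => d j (algLap d db G v)) ⬝ᵥ (G *ᵥ fun j => db j v)
      + ((fun j => d j v) ᵥ* G) ⬝ᵥ (fun j => db j (algLap d db G v))
      - ((fun j => d j v) ᵥ* G) ⬝ᵥ (algHess d db v *ᵥ (G *ᵥ fun j => db j v)) := by
    rw [algGradSq, derivation_dotProduct, derivation_comp_mulVec, e1, e2, h.dt_inv]
    simp only [add_vecMul, add_dotProduct, mulVec_add, neg_mulVec, dotProduct_add, dotProduct_neg,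
      ← mulVec_mulVec, dotProduct_mulVec _ G]
    ring
  rw [e5, h.bochner v h.d_logDet, e4]
  ring

/-- `(∂_t - Δ) Δv = Δv - |∇∇̄v|²`. -/
theorem AlgFlow.evolution_lap (h : AlgFlow d db dt M G v ℓ) :
    dt (algLap d db G v) - algLap d db G (algLap d db G v) = algLap d db G v
      - (G * algHess d db v * (G * algHess d db v)).trace := by
  have e1 : (algHess d db v).map dt = algHess d db v + algHess d db (algLap d db G v) := by
    ext p q
    simp [algHess, h.comm_td, h.comm_tb, h.dt_potential]
  rw [algLap, derivation_trace, map_derivation_mul, h.dt_inv, e1, mul_add, trace_add, trace_add,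
    neg_mul, trace_neg, mul_assoc (G * _) G]
  simp only [algLap]
  ring

/-- `(∂_t - Δ) v² = 2 v² - 2 |∇v|²`. -/
theorem AlgFlow.evolution_sq (h : AlgFlow d db dt M G v ℓ) :
    dt (v * v) - algLap d db G (v * v) = 2 * (v * v) - 2 * algGradSq d db G v := by
  have e1 : algLap d db G (v * v) = 2 * (v * algLap d db G v) + 2 * algGradSq d db G v := by
    simp only [algLap, trace_mul_eq_sum, algGradSq, dotProduct, mulVec, algHess, Matrix.of_apply,
      Derivation.leibniz, smul_eq_mul, map_add, Finset.mul_sum, ← Finset.sum_add_distrib]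
    exact Finset.sum_congr rfl fun l _ => Finset.sum_congr rfl fun m _ => by ring
  rw [e1, Derivation.leibniz, h.dt_potential, smul_eq_mul]
  ring

omit [DecidableEq ι] in
/-- Multiplication by a function `s` of time only. -/
theorem evolution_time_mul {s : A} (hs : ∀ j, d j s = 0) (hs' : ∀ j, db j s = 0) (φ : A) :
    dt (s * φ) - algLap d db G (s * φ) = dt s * φ + s * (dt φ - algLap d db G φ) := by
  have e1 : algLap d db G (s * φ) = s * algLap d db G φ := by
    simp only [algLap, trace_mul_eq_sum, algHess, Matrix.of_apply, Derivation.leibniz, smul_eq_mul,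
      hs, hs', mul_zero, add_zero, Finset.mul_sum]
    exact Finset.sum_congr rfl fun l _ => Finset.sum_congr rfl fun m _ => by ring
  rw [e1, Derivation.leibniz, smul_eq_mul, smul_eq_mul]
  ring

omit [DecidableEq ι] in
theorem algLap_add (φ ψ : A) : algLap d db G (φ + ψ) = algLap d db G φ + algLap d db G ψ := by
  simp only [algLap, trace_mul_eq_sum, algHess, Matrix.of_apply, map_add, mul_add,
    Finset.sum_add_distrib]

/-- The heat operator applied to `2 v² + s |∇v|² + c s² Δv`. -/
theorem AlgFlow.evolution_test (h : AlgFlow d db dt M G v ℓ) {s c : A}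
    (hs : ∀ j, d j s = 0) (hs' : ∀ j, db j s = 0) (hs1 : dt s = 1)
    (hc : ∀ j, d j c = 0) (hc' : ∀ j, db j c = 0) (hc1 : dt c = 0) :
    dt (2 * (v * v) + s * algGradSq d db G v + c * (s * s) * algLap d db G v)
      - algLap d db G (2 * (v * v) + s * algGradSq d db G v + c * (s * s) * algLap d db G v) =
    4 * (v * v) + (s - 3) * algGradSq d db G v - s * algCovHessSq d db M G v
      + (2 * c * s + c * (s * s)) * algLap d db G v
      - (s + c * (s * s)) * (G * algHess d db v * (G * algHess d db v)).trace := by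
  have t2 := h.evolution_sq
  have t3 := evolution_time_mul (dt := dt) (G := G) hs hs' (algGradSq d db G v)
  have t4 := evolution_time_mul (dt := dt) (G := G) (s := c * (s * s)) (d := d) (db := db)
    (by simp [hs, hc]) (by simp [hs', hc']) (algLap d db G v)
  rw [h.evolution_gradSq, hs1] at t3
  rw [h.evolution_lap] at t4
  simp only [Derivation.leibniz, hc1, hs1, smul_eq_mul] at t4
  rw [show (2 : A) * (v * v) = v * v + v * v by ring]
  simp only [algLap_add, map_add]
  simp only [Derivation.leibniz, hc1, hs1, smul_eq_mul] at t2 t3 t4 ⊢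
  linear_combination 2 * t2 + t3 + t4

end Algebra

/-! ### Positivity of traces -/

section Positivity

variable {ι : Type*} [Fintype ι] [DecidableEq ι]

open scoped MatrixOrder in
theorem exists_eq_conjTranspose_mul_self {g : Matrix ι ι ℂ} (hg : g.PosSemidef) :
    ∃ B : Matrix ι ι ℂ, g = Bᴴ * B :=
  CStarAlgebra.nonneg_iff_eq_star_mul_self.mp hg.nonneg

/-- The Hermitian form induced by `g` on tensors with two indices is positive. -/
theorem sum_mul_dotProduct_star_re_nonneg {g : Matrix ι ι ℂ} (hg : g.PosSemidef)
    (w : ι → ι → ℂ) :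
    0 ≤ (∑ l, ∑ m, g l m * (w l ⬝ᵥ (g *ᵥ star (w m)))).re := by
  have e : ∑ l, ∑ m, g l m * (w l ⬝ᵥ (g *ᵥ star (w m))) =
      (gᵀ * (Matrix.of w * g * (Matrix.of w)ᴴ)).trace := by
    rw [trace_mul_eq_sum, Finset.sum_comm]
    refine Finset.sum_congr rfl fun l _ => Finset.sum_congr rfl fun m _ => ?_
    rw [dotProduct_mulVec]
    rfl
  obtain ⟨C, hC⟩ := exists_eq_conjTranspose_mul_self hg.transpose
  rw [e, hC, mul_assoc, trace_mul_comm]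
  exact (Complex.nonneg_iff.mp ((hg.mul_mul_conjTranspose_same _).mul_mul_conjTranspose_same
    C).trace_nonneg).1

/-- With `g = Bᴴ B`, both traces are those of the Hermitian matrix `B H Bᴴ` and of its square; the
last bound is the Cauchy-Schwarz inequality for its diagonal. -/
theorem trace_sq_bounds {g H : Matrix ι ι ℂ} (hg : g.PosSemidef) (hH : H.IsHermitian) :
    (g * H).trace.im = 0 ∧ 0 ≤ (g * H * (g * H)).trace.re ∧
      (g * H).trace.re ^ 2 ≤ Fintype.card ι * (g * H * (g * H)).trace.re := by
  obtain ⟨B, hB⟩ := exists_eq_conjTranspose_mul_self hg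
  set K := B * H * Bᴴ with hK
  have hKh : K.IsHermitian := by
    rw [hK]; exact isHermitian_mul_mul_conjTranspose B hH
  have e1 : (g * H).trace = K.trace := by
    rw [hB, mul_assoc, trace_mul_comm]
  have e2 : (g * H * (g * H)).trace = (K * K).trace := by
    rw [hB, hK, mul_assoc, mul_assoc, trace_mul_comm]
    simp only [mul_assoc]
  have e3 : (K * K).trace.re = ∑ a, ∑ b, ‖K a b‖ ^ 2 := by
    rw [trace_mul_eq_sum, Complex.re_sum]
    refine Finset.sum_congr rfl fun a _ => ?_
    rw [Complex.re_sum]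
    refine Finset.sum_congr rfl fun b _ => ?_
    rw [← hKh.apply b a, Complex.star_def, Complex.mul_conj, Complex.normSq_eq_norm_sq,
      Complex.ofReal_re]
  refine ⟨?_, ?_, ?_⟩
  · rw [e1, Matrix.trace, Complex.im_sum]
    refine Finset.sum_eq_zero fun a _ => ?_
    have := congrArg Complex.im (hKh.apply a a)
    simp only [Complex.star_def, Complex.conj_im] at this
    simp only [Matrix.diag]; linarith
  · rw [e2, e3]; positivity
  · rw [e1, e2, e3, Matrix.trace, Complex.re_sum]
    refine (sq_sum_le_card_mul_sum_sq (s := Finset.univ)).trans ?_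
    rw [Finset.card_univ]
    refine mul_le_mul_of_nonneg_left (Finset.sum_le_sum fun a _ => ?_) (Nat.cast_nonneg _)
    calc (K a a).re ^ 2 ≤ ‖K a a‖ ^ 2 := by
          rw [← sq_abs]; gcongr; exact Complex.abs_re_le_norm _
      _ ≤ ∑ b, ‖K a b‖ ^ 2 :=
          Finset.single_le_sum (f := fun b => ‖K a b‖ ^ 2) (fun b _ => by positivity)
            (Finset.mem_univ a)

end Positivity

/-! ### The differential inequality at a point -/

section Conj

variable {k A ι : Type*} [CommRing k] [CommRing A] [Algebra k A] [Fintype ι]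
variable [DecidableEq ι] {d db : ι → Derivation k A A} {M G : Matrix ι ι A} {v : A}

/-- A complex conjugation `σ` on `A` exchanging `d` and `db`, under which `M` and `G` are Hermitian
and `v` is real, together with a point evaluation at which `G` is positive. -/
structure IsRealPoint (d db : ι → Derivation k A A) (M G : Matrix ι ι A) (v : A)
    (σ : A →+* A) (ev : A →+* ℂ) : Prop where
  conj_d : ∀ j a, σ (d j a) = db j (σ a)
  conj_db : ∀ j a, σ (db j a) = d j (σ a)
  conj_M : ∀ p q, σ (M p q) = M q p
  conj_G : ∀ p q, σ (G p q) = G q p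
  conj_v : σ v = v
  ev_conj : ∀ a, ev (σ a) = star (ev a)
  pos : (G.map ev).PosSemidef

variable {σ : A →+* A} {ev : A →+* ℂ}

omit [DecidableEq ι] in
theorem IsRealPoint.conj_covHess (h : IsRealPoint d db M G v σ ev) (l j : ι) :
    σ (covHess d M G v l j) = covHessBar db M G v l j := by
  simp only [covHess, covHessBar, christoffel, christoffelBar, Pi.sub_apply, map_sub, h.conj_d,
    h.conj_v, vecMul, mulVec, dotProduct, map_sum, map_mul, Matrix.mul_apply, h.conj_G,
    Matrix.map_apply, h.conj_M]
  congr 1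
  refine Finset.sum_congr rfl fun a _ => ?_
  rw [mul_comm]
  congr 1
  exact Finset.sum_congr rfl fun b _ => mul_comm _ _

omit [Fintype ι] [DecidableEq ι] in
theorem IsRealPoint.hess_isHermitian (h : IsRealPoint d db M G v σ ev)
    (hc : ∀ i j a, d i (db j a) = db j (d i a)) :
    ((algHess d db v).map ev).IsHermitian := by
  ext p q
  simp only [conjTranspose_apply, Matrix.map_apply, algHess, Matrix.of_apply, ← h.ev_conj, h.conj_d,
    h.conj_db, h.conj_v, hc]

omit [DecidableEq ι] in
/-- `|∇v|²` is real and nonnegative, in the order of `ℂ`. -/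
theorem IsRealPoint.ev_gradSq (h : IsRealPoint d db M G v σ ev) :
    0 ≤ ev (algGradSq d db G v) := by
  have e : ev (algGradSq d db G v) =
      star (fun j => ev (db j v)) ⬝ᵥ ((G.map ev) *ᵥ fun j => ev (db j v)) := by
    have : (star fun j => ev (db j v)) = fun j => ev (d j v) := by
      ext j; simp only [Pi.star_apply, ← h.ev_conj, h.conj_db, h.conj_v]
    rw [this]
    simp only [algGradSq, dotProduct, mulVec, map_sum, map_mul, Matrix.map_apply]
  rw [e]
  exact h.pos.dotProduct_mulVec_nonneg _

theorem IsRealPoint.ev_covHessSq (h : IsRealPoint d db M G v σ ev) :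
    0 ≤ (ev (algCovHessSq d db M G v)).re := by
  have e : ev (algCovHessSq d db M G v) = ∑ l, ∑ m, (G.map ev) l m *
      ((fun j => ev (covHess d M G v l j)) ⬝ᵥ ((G.map ev) *ᵥ
        star fun j => ev (covHess d M G v m j))) := by
    have : ∀ m, (star fun j => ev (covHess d M G v m j)) =
        fun j => ev (covHessBar db M G v m j) := by
      intro m; ext j; simp only [Pi.star_apply, ← h.ev_conj, h.conj_covHess]
    simp only [this]
    simp only [algCovHessSq, dotProduct, mulVec, map_sum, map_mul, Matrix.map_apply]
  rw [e]
  exact sum_mul_dotProduct_star_re_nonneg h.pos _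

omit [DecidableEq ι] in
theorem ev_trace_mul (ev : A →+* ℂ) (P Q : Matrix ι ι A) :
    ev (P * Q).trace = (P.map ev * Q.map ev).trace := by
  simp only [trace_mul_eq_sum, map_sum, map_mul, Matrix.map_apply]

/-- `Δv` is real, `|∇∇̄v|²` is nonnegative and `(Δv)² ≤ n |∇∇̄v|²`. -/
theorem IsRealPoint.ev_lap (h : IsRealPoint d db M G v σ ev)
    (hc : ∀ i j a, d i (db j a) = db j (d i a)) :
    (ev (algLap d db G v)).im = 0 ∧
      0 ≤ (ev (G * algHess d db v * (G * algHess d db v)).trace).re ∧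
      (ev (algLap d db G v)).re ^ 2 ≤
        Fintype.card ι * (ev (G * algHess d db v * (G * algHess d db v)).trace).re := by
  rw [algLap, ev_trace_mul, ev_trace_mul, Matrix.map_mul]
  exact trace_sq_bounds h.pos (h.hess_isHermitian hc)

variable {dt : Derivation k A A} {ℓ : A}

/-- The differential inequality satisfied by the test function
`2 v² + s |∇v|² + c s² Δv`, for `0 ≤ s ≤ 2` and a constant `c = ± ε / 4`. -/
theorem AlgFlow.evolution_test_le (h : AlgFlow d db dt M G v ℓ)
    (hp : IsRealPoint d db M G v σ ev) {s c : A}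
    (hs : ∀ j, d j s = 0) (hs' : ∀ j, db j s = 0) (hs1 : dt s = 1)
    (hc : ∀ j, d j c = 0) (hc' : ∀ j, db j c = 0) (hc1 : dt c = 0)
    {s' c' ε : ℝ} (es : ev s = s') (ec : ev c = c') (h0 : 0 ≤ s') (h2 : s' ≤ 2)
    (hε : 0 ≤ ε) (hε1 : ε ≤ 1) (hcε : |c'| ≤ ε / 4) :
    (ev (dt (2 * (v * v) + s * algGradSq d db G v + c * (s * s) * algLap d db G v)
      - algLap d db G
        (2 * (v * v) + s * algGradSq d db G v + c * (s * s) * algLap d db G v))).re ≤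
    4 * (ev v).re ^ 2 + Fintype.card ι * ε ^ 2 := by
  rw [h.evolution_test hs hs' hs1 hc hc' hc1]
  obtain ⟨hL, hN, hLN⟩ := hp.ev_lap h.comm_db
  have hf := (Complex.nonneg_iff.mp hp.ev_gradSq).1
  have hW := hp.ev_covHessSq
  have hv : (ev v).im = 0 := by
    have := congrArg Complex.im (hp.ev_conj v)
    rw [hp.conj_v] at this
    simp only [Complex.star_def, Complex.conj_im] at this
    linarith
  simp only [map_sub, map_add, map_mul, map_ofNat, es, ec]
  set L := (ev (algLap d db G v)).re
  set f := (ev (algGradSq d db G v)).re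
  set W := (ev (algCovHessSq d db M G v)).re
  set N := (ev (G * algHess d db v * (G * algHess d db v)).trace).re
  set m : ℝ := (Fintype.card ι : ℝ) with hm
  have hm0 : 0 ≤ m := Nat.cast_nonneg _
  simp only [Complex.sub_re, Complex.add_re, Complex.mul_re, Complex.mul_im, Complex.ofReal_re,
    Complex.ofReal_im, Complex.re_ofNat, Complex.im_ofNat, Complex.add_im, Complex.sub_im, hv, hL,
    mul_zero, zero_mul, sub_zero, add_zero]
  -- `2 m ε |L| ≤ L² + m² ε²` and `L² ≤ m N`, divided by `2 m`; if `m = 0` then `L = 0`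
  have hA : ε * |L| - N / 2 ≤ m * ε ^ 2 / 2 := by
    rcases hm0.eq_or_lt with h00 | hpos
    · rw [← h00] at hLN ⊢
      have : L = 0 := by nlinarith [sq_nonneg L]
      rw [this]; simp; linarith
    · have h1 : 2 * m * ε * |L| ≤ m * N + m ^ 2 * ε ^ 2 := by
        nlinarith [sq_nonneg (|L| - m * ε), sq_abs L]
      nlinarith
  have hc2 : -(ε / 4) ≤ c' ∧ c' ≤ ε / 4 := abs_le.mp hcε
  have hB : (2 * c' + c' * s') * L ≤ ε * |L| := by
    refine (le_abs_self _).trans ?_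
    rw [abs_mul]
    gcongr
    rw [show 2 * c' + c' * s' = c' * (2 + s') by ring, abs_mul,
      abs_of_nonneg (by linarith : 0 ≤ 2 + s')]
    nlinarith [abs_nonneg c']
  have hC : 1 / 2 * N ≤ (1 + c' * s') * N := by
    gcongr
    nlinarith
  have hD : s' * ((2 * c' + c' * s') * L - (1 + c' * s') * N) ≤ s' * (m * ε ^ 2 / 2) := by
    gcongr
    linarith
  have hE : s' * (m * ε ^ 2 / 2) ≤ 2 * (m * ε ^ 2 / 2) := by gcongr
  have hF : (s' - 3) * f ≤ 0 := mul_nonpos_of_nonpos_of_nonneg (by linarith) hf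
  have hG : 0 ≤ s' * W := by positivity
  nlinarith

end Conj

/-! ### The algebra of smooth functions -/

section SmoothAlg

variable {E : Type*} [NormedAddCommGroup E] [NormedSpace ℝ E] {O : TopologicalSpace.Opens E}

/-- Extension by zero of a function on an open set. It turns functions on the subtype into functions
on the whole space, to which `fderiv` applies. -/
def extendZero (f : O → ℂ) : E → ℂ := Function.extend Subtype.val f 0

omit [NormedSpace ℝ E] in
theorem extendZero_apply (f : O → ℂ) (p : O) : extendZero f p = f p :=
  Subtype.val_injective.extend_apply f 0 p

omit [NormedSpace ℝ E] in
theorem extendZero_eqOn {f : O → ℂ} {F : E → ℂ} (h : ∀ p : O, F p = f p) :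
    EqOn (extendZero f) F O := fun p hp => (extendZero_apply f ⟨p, hp⟩).trans (h ⟨p, hp⟩).symm

omit [NormedSpace ℝ E] in
theorem extendZero_eventuallyEq {f : O → ℂ} {F : E → ℂ} (h : ∀ p : O, F p = f p) (p : O) :
    extendZero f =ᶠ[nhds (p : E)] F :=
  Filter.eventuallyEq_of_mem (O.isOpen.mem_nhds p.2) (extendZero_eqOn h)

theorem contDiffOn_extendZero {f : O → ℂ} {F : E → ℂ} (h : ∀ p : O, F p = f p)
    (hF : ContDiffOn ℝ ∞ F O) : ContDiffOn ℝ ∞ (extendZero f) O :=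
  hF.congr (extendZero_eqOn h)

/-- The smooth functions, as a subalgebra of all complex functions on an open set. -/
def smoothSubalgebra (O : TopologicalSpace.Opens E) : Subalgebra ℂ (O → ℂ) where
  carrier := {f | ContDiffOn ℝ ∞ (extendZero f) O}
  mul_mem' {f g} hf hg := contDiffOn_extendZero (F := fun p => extendZero f p * extendZero g p)
    (fun p => by simp [extendZero_apply]) (hf.mul hg)
  add_mem' {f g} hf hg := contDiffOn_extendZero (F := fun p => extendZero f p + extendZero g p)
    (fun p => by simp [extendZero_apply]) (hf.add hg)
  algebraMap_mem' c := contDiffOn_extendZero (F := fun _ => c) (fun p => rfl) contDiffOn_const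

/-- The algebra of smooth complex functions on an open subset of a real normed space. It is a type
of its own, so that its algebraic structure is never unfolded when derivations are compared. -/
def smoothAlg (O : TopologicalSpace.Opens E) : Type _ := smoothSubalgebra O

instance : CommRing (smoothAlg O) := inferInstanceAs (CommRing (smoothSubalgebra O))

instance : Algebra ℂ (smoothAlg O) :=
  inferInstanceAs (Algebra ℂ (smoothSubalgebra O))

/-- The restriction of a function that is smooth on `O`. -/
def smoothAlg.mk (F : E → ℂ) (hF : ContDiffOn ℝ ∞ F O) : smoothAlg O :=
  ⟨fun p => F p, contDiffOn_extendZero (fun _ => rfl) hF⟩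

/-- Evaluation at a point. -/
def smoothAlg.eval (p : O) : smoothAlg O →+* ℂ :=
  (Pi.evalRingHom (fun _ : O => ℂ) p).comp (smoothSubalgebra O).val.toRingHom

theorem smoothAlg.eval_mk (F : E → ℂ) (hF : ContDiffOn ℝ ∞ F O) (p : O) :
    smoothAlg.eval p (smoothAlg.mk F hF) = F p := rfl

theorem smoothAlg.ext_eval {f g : smoothAlg O}
    (h : ∀ p : O, smoothAlg.eval p f = smoothAlg.eval p g) : f = g :=
  Subtype.ext (funext h)

theorem smoothAlg.contDiffOn (f : smoothAlg O) : ContDiffOn ℝ ∞ (extendZero f.1) O := f.2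

theorem smoothAlg.differentiableAt (f : smoothAlg O) (p : O) :
    DifferentiableAt ℝ (extendZero f.1) p :=
  ((f.2.contDiffAt (O.isOpen.mem_nhds p.2)).differentiableAt (by simp))

theorem contDiffOn_fderiv_apply {F : E → ℂ} (hF : ContDiffOn ℝ ∞ F O) (h : E) :
    ContDiffOn ℝ ∞ (fun p => fderiv ℝ F p h) O :=
  (hF.fderiv_of_isOpen O.isOpen (by simp)).clm_apply contDiffOn_const

/-- The derivative in a fixed direction, as a derivation of the algebra of smooth functions. -/
def smoothAlg.dir (h : E) : Derivation ℂ (smoothAlg O) (smoothAlg O) :=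
  Derivation.mk'
    { toFun := fun f => smoothAlg.mk (fun p => fderiv ℝ (extendZero f.1) p h)
        (contDiffOn_fderiv_apply (smoothAlg.contDiffOn f) h)
      map_add' := fun f g => smoothAlg.ext_eval fun p => by
        rw [map_add, smoothAlg.eval_mk, smoothAlg.eval_mk, smoothAlg.eval_mk,
          (extendZero_eventuallyEq (F := extendZero f.1 + extendZero g.1)
            (fun p => by simp only [Pi.add_apply, extendZero_apply]; rfl) p).fderiv_eq,
          fderiv_add (smoothAlg.differentiableAt f p) (smoothAlg.differentiableAt g p)]
        rfl
      map_smul' := fun c f => smoothAlg.ext_eval fun p => by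
        have : smoothAlg.eval p ((RingHom.id ℂ) c • smoothAlg.mk
          (fun p => fderiv ℝ (extendZero f.1) p h)
          (contDiffOn_fderiv_apply (smoothAlg.contDiffOn f) h)) =
            c * fderiv ℝ (extendZero f.1) p h := rfl
        rw [this, smoothAlg.eval_mk,
          (extendZero_eventuallyEq (F := c • extendZero f.1)
            (fun p => by simp only [Pi.smul_apply, extendZero_apply]; rfl) p).fderiv_eq,
          fderiv_const_smul (smoothAlg.differentiableAt f p)]
        rfl }
    fun f g => smoothAlg.ext_eval fun p => by
      simp only [LinearMap.coe_mk, AddHom.coe_mk, smul_eq_mul, map_add, map_mul, smoothAlg.eval_mk]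
      rw [(extendZero_eventuallyEq (F := extendZero f.1 * extendZero g.1)
            (fun p => by simp only [Pi.mul_apply, extendZero_apply]; rfl) p).fderiv_eq,
          fderiv_mul (smoothAlg.differentiableAt f p) (smoothAlg.differentiableAt g p)]
      simp only [_root_.add_apply, _root_.smul_apply, extendZero_apply,
        smul_eq_mul]
      rfl

theorem smoothAlg.dir_mk (h : E) (F : E → ℂ) (hF : ContDiffOn ℝ ∞ F O) :
    smoothAlg.dir h (smoothAlg.mk F hF) =
      smoothAlg.mk (fun p => fderiv ℝ F p h) (contDiffOn_fderiv_apply hF h) :=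
  smoothAlg.ext_eval fun p => by
    rw [smoothAlg.eval_mk]
    exact congrArg (fun L : E →L[ℝ] ℂ => L h)
      (extendZero_eventuallyEq (f := (smoothAlg.mk F hF).1) (F := F) (fun _ => rfl) p).fderiv_eq

theorem smoothAlg.mk_extend (f : smoothAlg O) :
    smoothAlg.mk (extendZero f.1) (smoothAlg.contDiffOn f) = f :=
  smoothAlg.ext_eval fun p => extendZero_apply _ p

theorem smoothAlg.dir_comm (h h' : E) (f : smoothAlg O) :
    smoothAlg.dir h (smoothAlg.dir h' f) = smoothAlg.dir h' (smoothAlg.dir h f) := by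
  rw [← smoothAlg.mk_extend f]
  simp only [smoothAlg.dir_mk]
  refine smoothAlg.ext_eval fun p => ?_
  simp only [smoothAlg.eval_mk]
  have hc : ContDiffAt ℝ ∞ (extendZero f.1) p := f.2.contDiffAt (O.isOpen.mem_nhds p.2)
  have hs : IsSymmSndFDerivAt ℝ (extendZero f.1) p := hc.isSymmSndFDerivAt (by
    simp only [minSmoothness_of_isRCLikeNormedField]; exact WithTop.coe_le_coe.mpr le_top)
  have hd : DifferentiableAt ℝ (fderiv ℝ (extendZero f.1)) p :=
    (hc.fderiv_right (m := 1) (by norm_cast)).differentiableAt (by simp)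
  rw [fderiv_clm_apply hd (differentiableAt_const _),
    fderiv_clm_apply hd (differentiableAt_const _)]
  simpa using hs h h'

theorem contDiffOn_star {F : E → ℂ} {s : Set E} (hF : ContDiffOn ℝ ∞ F s) :
    ContDiffOn ℝ ∞ (fun p => star (F p)) s :=
  Complex.conjCLE.contDiff.comp_contDiffOn hF

/-- Complex conjugation on the algebra of smooth functions. -/
def smoothAlg.conj : smoothAlg O →+* smoothAlg O where
  toFun f := smoothAlg.mk (fun p => star (extendZero f.1 p)) (contDiffOn_star f.2)
  map_one' := smoothAlg.ext_eval fun p => by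
    rw [smoothAlg.eval_mk, extendZero_apply]; exact star_one ℂ
  map_zero' := smoothAlg.ext_eval fun p => by
    rw [smoothAlg.eval_mk, extendZero_apply]; exact star_zero ℂ
  map_mul' f g := smoothAlg.ext_eval fun p => by
    rw [map_mul, smoothAlg.eval_mk, smoothAlg.eval_mk, smoothAlg.eval_mk, extendZero_apply,
      extendZero_apply, extendZero_apply]
    exact star_mul' (f.1 p) (g.1 p)
  map_add' f g := smoothAlg.ext_eval fun p => by
    rw [map_add, smoothAlg.eval_mk, smoothAlg.eval_mk, smoothAlg.eval_mk, extendZero_apply,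
      extendZero_apply, extendZero_apply]
    exact star_add (f.1 p) (g.1 p)

theorem smoothAlg.eval_conj (f : smoothAlg O) (p : O) :
    smoothAlg.eval p (smoothAlg.conj f) = star (smoothAlg.eval p f) :=
  congrArg star (extendZero_apply f.1 p)

theorem smoothAlg.conj_dir (h : E) (f : smoothAlg O) :
    smoothAlg.conj (smoothAlg.dir h f) = smoothAlg.dir h (smoothAlg.conj f) := by
  refine smoothAlg.ext_eval fun p => ?_
  have e : smoothAlg.conj f = smoothAlg.mk (fun p => star (extendZero f.1 p))
    (contDiffOn_star f.2) := rfl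
  rw [smoothAlg.eval_conj, e, smoothAlg.dir_mk, smoothAlg.eval_mk]
  have := (Complex.conjCLE : ℂ ≃L[ℝ] ℂ).comp_fderiv (f := extendZero f.1) (x := (p : E))
  exact (congrArg (fun L : E →L[ℝ] ℂ => L h) this).symm

end SmoothAlg

/-! ### Wirtinger derivations on functions of time and space -/

section Wirtinger

variable {n : ℕ} {O : TopologicalSpace.Opens (ℝ × (Fin n → ℂ))}

/-- The derivation `∂/∂z^j` on functions of time and space. -/
def algDz (j : Fin n) : Derivation ℂ (smoothAlg O) (smoothAlg O) :=
  (1 / 2 : ℂ) • (smoothAlg.dir (0, Pi.single j 1) -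
    Complex.I • smoothAlg.dir (0, Pi.single j Complex.I))

/-- The derivation `∂/∂z̄^k` on functions of time and space. -/
def algDzbar (k : Fin n) : Derivation ℂ (smoothAlg O) (smoothAlg O) :=
  (1 / 2 : ℂ) • (smoothAlg.dir (0, Pi.single k 1) +
    Complex.I • smoothAlg.dir (0, Pi.single k Complex.I))

/-- The derivation `∂/∂t` on functions of time and space. -/
def algDt : Derivation ℂ (smoothAlg O) (smoothAlg O) := smoothAlg.dir (1, 0)

theorem fderiv_slice {F : ℝ × (Fin n → ℂ) → ℂ} {p : ℝ × (Fin n → ℂ)}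
    (hF : DifferentiableAt ℝ F p) (h : Fin n → ℂ) :
    fderiv ℝ (fun w => F (p.1, w)) p.2 h = fderiv ℝ F p (0, h) := by
  have h1 : HasFDerivAt (fun w : Fin n → ℂ => (p.1, w))
      (ContinuousLinearMap.inr ℝ ℝ (Fin n → ℂ)) p.2 := hasFDerivAt_prodMk_right p.1 p.2
  have h2 : HasFDerivAt F (fderiv ℝ F p) (p.1, p.2) := hF.hasFDerivAt
  have h3 : HasFDerivAt (fun w => F (p.1, w))
      ((fderiv ℝ F p).comp (ContinuousLinearMap.inr ℝ ℝ (Fin n → ℂ))) p.2 := h2.comp p.2 h1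
  rw [h3.fderiv]
  rfl

theorem deriv_slice {F : ℝ × (Fin n → ℂ) → ℂ} {p : ℝ × (Fin n → ℂ)}
    (hF : DifferentiableAt ℝ F p) :
    HasDerivAt (fun t => F (t, p.2)) (fderiv ℝ F p (1, 0)) p.1 := by
  have h1 : HasFDerivAt (fun t : ℝ => (t, p.2))
      (ContinuousLinearMap.inl ℝ ℝ (Fin n → ℂ)) p.1 := hasFDerivAt_prodMk_left p.1 p.2
  have h2 : HasFDerivAt F (fderiv ℝ F p) (p.1, p.2) := hF.hasFDerivAt
  have h3 : HasFDerivAt (fun t => F (t, p.2))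
      ((fderiv ℝ F p).comp (ContinuousLinearMap.inl ℝ ℝ (Fin n → ℂ))) p.1 := h2.comp p.1 h1
  exact h3.hasDerivAt

theorem differentiableAt_of_opens {F : ℝ × (Fin n → ℂ) → ℂ} (hF : ContDiffOn ℝ ∞ F O) (p : O) :
    DifferentiableAt ℝ F p :=
  (hF.contDiffAt (O.isOpen.mem_nhds p.2)).differentiableAt (by simp)

theorem eval_algDz (j : Fin n) (F : ℝ × (Fin n → ℂ) → ℂ) (hF : ContDiffOn ℝ ∞ F O) (p : O) :
    smoothAlg.eval p (algDz j (smoothAlg.mk F hF)) = dz j (fun w => F (p.1.1, w)) p.1.2 := by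
  rw [dz, fderiv_slice (differentiableAt_of_opens hF p),
    fderiv_slice (differentiableAt_of_opens hF p)]
  have : algDz j (smoothAlg.mk F hF) = (1 / 2 : ℂ) •
    (smoothAlg.dir (0, Pi.single j 1) (smoothAlg.mk F hF) -
      Complex.I • smoothAlg.dir (0, Pi.single j Complex.I) (smoothAlg.mk F hF)) := rfl
  rw [this, smoothAlg.dir_mk, smoothAlg.dir_mk]
  rfl

theorem eval_algDzbar (j : Fin n) (F : ℝ × (Fin n → ℂ) → ℂ) (hF : ContDiffOn ℝ ∞ F O) (p : O) :
    smoothAlg.eval p (algDzbar j (smoothAlg.mk F hF)) = dzbar j (fun w => F (p.1.1, w)) p.1.2 := by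
  rw [dzbar, fderiv_slice (differentiableAt_of_opens hF p),
    fderiv_slice (differentiableAt_of_opens hF p)]
  have : algDzbar j (smoothAlg.mk F hF) = (1 / 2 : ℂ) •
    (smoothAlg.dir (0, Pi.single j 1) (smoothAlg.mk F hF) +
      Complex.I • smoothAlg.dir (0, Pi.single j Complex.I) (smoothAlg.mk F hF)) := rfl
  rw [this, smoothAlg.dir_mk, smoothAlg.dir_mk]
  rfl

theorem eval_algDt (F : ℝ × (Fin n → ℂ) → ℂ) (hF : ContDiffOn ℝ ∞ F O) (p : O) :
    HasDerivAt (fun t => F (t, p.1.2)) (smoothAlg.eval p (algDt (smoothAlg.mk F hF))) p.1.1 := by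
  rw [algDt, smoothAlg.dir_mk]
  exact deriv_slice (differentiableAt_of_opens hF p)

theorem contDiffOn_dzbar {F : ℝ × (Fin n → ℂ) → ℂ} (hF : ContDiffOn ℝ ∞ F O) (j : Fin n) :
    ContDiffOn ℝ ∞ (fun p : ℝ × (Fin n → ℂ) => dzbar j (fun w => F (p.1, w)) p.2) O :=
  (smoothAlg.contDiffOn (algDzbar j (smoothAlg.mk F hF))).congr fun p hp => by
    rw [extendZero_apply _ ⟨p, hp⟩]; exact (eval_algDzbar j F hF ⟨p, hp⟩).symm

theorem algDzbar_mk (j : Fin n) (F : ℝ × (Fin n → ℂ) → ℂ) (hF : ContDiffOn ℝ ∞ F O) :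
    algDzbar j (smoothAlg.mk F hF) = smoothAlg.mk _ (contDiffOn_dzbar hF j) :=
  smoothAlg.ext_eval fun p => eval_algDzbar j F hF p

theorem eval_algHess (F : ℝ × (Fin n → ℂ) → ℂ) (hF : ContDiffOn ℝ ∞ F O) (p : O) (k j : Fin n) :
    smoothAlg.eval p (algHess algDz algDzbar (smoothAlg.mk F hF) k j) =
      dz j (dzbar k fun w => F (p.1.1, w)) p.1.2 := by
  rw [algHess, Matrix.of_apply, algDzbar_mk, eval_algDz]

theorem algDz_comm (i j : Fin n) (f : smoothAlg O) :
    algDz i (algDz j f) = algDz j (algDz i f) := by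
  simp only [algDz, Derivation.smul_apply, Derivation.sub_apply, map_sub, Derivation.map_smul,
    smoothAlg.dir_comm ((0, Pi.single i _) : ℝ × (Fin n → ℂ))]
  module

theorem algDzbar_comm (i j : Fin n) (f : smoothAlg O) :
    algDzbar i (algDzbar j f) = algDzbar j (algDzbar i f) := by
  simp only [algDzbar, Derivation.smul_apply, Derivation.add_apply, map_add, Derivation.map_smul,
    smoothAlg.dir_comm ((0, Pi.single i _) : ℝ × (Fin n → ℂ))]
  module

theorem algDz_algDzbar_comm (i j : Fin n) (f : smoothAlg O) :
    algDz i (algDzbar j f) = algDzbar j (algDz i f) := by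
  simp only [algDz, algDzbar, Derivation.smul_apply, Derivation.add_apply, Derivation.sub_apply,
    map_add, map_sub, Derivation.map_smul,
    smoothAlg.dir_comm ((0, Pi.single i _) : ℝ × (Fin n → ℂ))]
  module

theorem algDt_algDz_comm (i : Fin n) (f : smoothAlg O) :
    algDt (algDz i f) = algDz i (algDt f) := by
  simp only [algDz, algDt, Derivation.smul_apply, Derivation.sub_apply, map_sub,
    Derivation.map_smul, smoothAlg.dir_comm ((1, 0) : ℝ × (Fin n → ℂ))]

theorem algDt_algDzbar_comm (i : Fin n) (f : smoothAlg O) :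
    algDt (algDzbar i f) = algDzbar i (algDt f) := by
  simp only [algDzbar, algDt, Derivation.smul_apply, Derivation.add_apply, map_add,
    Derivation.map_smul, smoothAlg.dir_comm ((1, 0) : ℝ × (Fin n → ℂ))]

theorem smoothAlg.conj_smul (c : ℂ) (f : smoothAlg O) :
    smoothAlg.conj (c • f) = star c • smoothAlg.conj f :=
  smoothAlg.ext_eval fun p => by
    rw [smoothAlg.eval_conj]
    have h1 : ∀ (c : ℂ) (f : smoothAlg O), smoothAlg.eval p (c • f) = c * smoothAlg.eval p f :=
      fun _ _ => rfl
    rw [h1, h1, star_mul', smoothAlg.eval_conj]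

theorem smoothAlg.conj_algDz (j : Fin n) (f : smoothAlg O) :
    smoothAlg.conj (algDz j f) = algDzbar j (smoothAlg.conj f) := by
  simp only [algDz, algDzbar, Derivation.smul_apply, Derivation.sub_apply, Derivation.add_apply,
    smoothAlg.conj_smul, map_sub, smoothAlg.conj_dir]
  simp [sub_eq_add_neg]

theorem smoothAlg.conj_algDzbar (j : Fin n) (f : smoothAlg O) :
    smoothAlg.conj (algDzbar j f) = algDz j (smoothAlg.conj f) := by
  simp only [algDz, algDzbar, Derivation.smul_apply, Derivation.sub_apply, Derivation.add_apply,
    smoothAlg.conj_smul, map_add, smoothAlg.conj_dir]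
  simp [sub_eq_add_neg]

end Wirtinger

/-! ### Jacobi's formula -/

section Jacobi

variable {k A ι : Type*} [CommRing k] [CommRing A] [Algebra k A]

theorem derivation_prod [DecidableEq ι] (D : Derivation k A A) (s : Finset ι) (f : ι → A) :
    D (∏ i ∈ s, f i) = ∑ i ∈ s, (∏ j ∈ s.erase i, f j) * D (f i) := by
  induction s using Finset.induction_on with
  | empty => simp
  | insert a s ha ih =>
    rw [Finset.prod_insert ha, Derivation.leibniz, ih, Finset.sum_insert ha,
      Finset.erase_insert ha, smul_eq_mul, smul_eq_mul, Finset.mul_sum, add_comm]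
    congr 1
    refine Finset.sum_congr rfl fun i hi => ?_
    rw [Finset.erase_insert_of_ne (by rintro rfl; exact ha hi),
      Finset.prod_insert (fun h => ha (Finset.mem_of_mem_erase h)), mul_assoc]

/-- **Jacobi's formula** for the derivative of a determinant. -/
theorem derivation_det [Fintype ι] [DecidableEq ι] (D : Derivation k A A) {M G : Matrix ι ι A}
    (hGM : G * M = 1) : D M.det = M.det * (G * M.map D).trace := by
  have e1 : M.adjugate = M.det • G := by
    rw [← mul_one M.adjugate, ← mul_eq_one_comm.mp hGM, ← mul_assoc, adjugate_mul, smul_mul_assoc,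
      one_mul]
  have e2 : D M.det = ∑ i, (M.updateCol i fun p => D (M p i)).det := by
    simp only [Matrix.det_apply, map_sum]
    rw [Finset.sum_comm]
    refine Finset.sum_congr rfl fun σ _ => ?_
    rw [← Finset.smul_sum]
    have : D (Equiv.Perm.sign σ • ∏ i, M (σ i) i) = Equiv.Perm.sign σ • D (∏ i, M (σ i) i) := by
      rcases Int.units_eq_one_or (Equiv.Perm.sign σ) with h | h <;> simp [h]
    rw [this, derivation_prod]
    congr 1
    refine Finset.sum_congr rfl fun i _ => ?_
    rw [← Finset.prod_erase_mul _ _ (Finset.mem_univ i)]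
    congr 1
    · refine Finset.prod_congr rfl fun j hj => ?_
      rw [Matrix.updateCol_ne (Finset.ne_of_mem_erase hj)]
    · rw [Matrix.updateCol_self]
  rw [e2, ← smul_eq_mul, ← trace_smul, ← smul_mul_assoc, ← e1, Matrix.trace]
  refine Finset.sum_congr rfl fun i _ => ?_
  rw [← Matrix.cramer_apply, Matrix.cramer_eq_adjugate_mulVec]
  rfl

end Jacobi

/-! ### Wirtinger calculus -/

section Wirtinger

variable {n : ℕ}

theorem single_eq_re_add_im (j : Fin n) (c : ℂ) :
    (Pi.single j c : Fin n → ℂ) =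
      c.re • (Pi.single j (1 : ℂ) : Fin n → ℂ) + c.im • (Pi.single j Complex.I : Fin n → ℂ) := by
  rw [← Pi.single_smul, ← Pi.single_smul, ← Pi.single_add]
  congr 1
  simp

theorem clm_apply_eq_sum (L : (Fin n → ℂ) →L[ℝ] ℂ) (ξ : Fin n → ℂ) :
    L ξ = ∑ j, ((ξ j).re * L (Pi.single j 1) + (ξ j).im * L (Pi.single j Complex.I)) := by
  conv_lhs => rw [← Finset.univ_sum_single ξ, map_sum]
  refine Finset.sum_congr rfl fun j _ => ?_
  rw [single_eq_re_add_im, map_add, map_smul, map_smul, Complex.real_smul, Complex.real_smul]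

/-- The complex linear part of a real linear map on `ℂⁿ`, expanded in the standard basis. -/
theorem wirtinger_apply (L : (Fin n → ℂ) →L[ℝ] ℂ) (ξ : Fin n → ℂ) :
    (1 / 2 : ℂ) * (L ξ - Complex.I * L (Complex.I • ξ)) =
      ∑ j, ξ j * ((1 / 2 : ℂ) * (L (Pi.single j 1) - Complex.I * L (Pi.single j Complex.I))) := by
  rw [clm_apply_eq_sum L ξ, clm_apply_eq_sum L (Complex.I • ξ), Finset.mul_sum,
    ← Finset.sum_sub_distrib, Finset.mul_sum]
  refine Finset.sum_congr rfl fun j _ => ?_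
  have h := Complex.re_add_im (ξ j)
  simp only [Pi.smul_apply, smul_eq_mul, Complex.mul_re, Complex.mul_im, Complex.I_re,
    Complex.I_im, zero_mul, one_mul, zero_sub, zero_add]
  conv_rhs => rw [← h]
  push_cast
  linear_combination (1 / 2 * ((ξ j).im * (L (Pi.single j Complex.I)))) * Complex.I_sq

/-- The conjugate linear part of a real linear map on `ℂⁿ`, expanded in the standard basis. -/
theorem wirtinger_bar_apply (L : (Fin n → ℂ) →L[ℝ] ℂ) (ξ : Fin n → ℂ) :
    (1 / 2 : ℂ) * (L ξ + Complex.I * L (Complex.I • ξ)) =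
      ∑ j, star (ξ j) *
        ((1 / 2 : ℂ) * (L (Pi.single j 1) + Complex.I * L (Pi.single j Complex.I))) := by
  rw [clm_apply_eq_sum L ξ, clm_apply_eq_sum L (Complex.I • ξ), Finset.mul_sum,
    ← Finset.sum_add_distrib, Finset.mul_sum]
  refine Finset.sum_congr rfl fun j _ => ?_
  have h : star (ξ j) = (ξ j).re - (ξ j).im * Complex.I := by
    apply Complex.ext <;> simp
  rw [h]
  simp only [Pi.smul_apply, smul_eq_mul, Complex.mul_re, Complex.mul_im, Complex.I_re,
    Complex.I_im, zero_mul, one_mul, zero_sub, zero_add]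
  push_cast
  linear_combination (1 / 2 * ((ξ j).im * (L (Pi.single j Complex.I)))) * Complex.I_sq

theorem sum_mul_dz (f : (Fin n → ℂ) → ℂ) (z ξ : Fin n → ℂ) :
    ∑ j, ξ j * dz j f z =
      (1 / 2 : ℂ) * (fderiv ℝ f z ξ - Complex.I * fderiv ℝ f z (Complex.I • ξ)) :=
  (wirtinger_apply (fderiv ℝ f z) ξ).symm

theorem sum_star_mul_dzbar (f : (Fin n → ℂ) → ℂ) (z ξ : Fin n → ℂ) :
    ∑ j, star (ξ j) * dzbar j f z =
      (1 / 2 : ℂ) * (fderiv ℝ f z ξ + Complex.I * fderiv ℝ f z (Complex.I • ξ)) :=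
  (wirtinger_bar_apply (fderiv ℝ f z) ξ).symm

theorem dz_congr {f g : (Fin n → ℂ) → ℂ} {z : Fin n → ℂ} (h : f =ᶠ[nhds z] g) (j : Fin n) :
    dz j f z = dz j g z := by rw [dz, dz, h.fderiv_eq]

theorem dzbar_congr {f g : (Fin n → ℂ) → ℂ} {z : Fin n → ℂ} (h : f =ᶠ[nhds z] g) (j : Fin n) :
    dzbar j f z = dzbar j g z := by rw [dzbar, dzbar, h.fderiv_eq]

theorem dz_dzbar_congr {f g : (Fin n → ℂ) → ℂ} {z : Fin n → ℂ} (h : f =ᶠ[nhds z] g)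
    (j k : Fin n) : dz j (dzbar k f) z = dz j (dzbar k g) z :=
  dz_congr (h.eventuallyEq_nhds.mono fun _ hw => dzbar_congr hw k) j

theorem dz_mul {f g : (Fin n → ℂ) → ℂ} {z : Fin n → ℂ} (hf : DifferentiableAt ℝ f z)
    (hg : DifferentiableAt ℝ g z) (j : Fin n) :
    dz j (fun w => f w * g w) z = dz j f z * g z + f z * dz j g z := by
  simp only [dz, fderiv_fun_mul hf hg, _root_.add_apply, _root_.smul_apply, smul_eq_mul]
  ring

theorem dz_sum {ι : Type*} (s : Finset ι) {f : ι → (Fin n → ℂ) → ℂ} {z : Fin n → ℂ}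
    (hf : ∀ i ∈ s, DifferentiableAt ℝ (f i) z) (j : Fin n) :
    dz j (fun w => ∑ i ∈ s, f i w) z = ∑ i ∈ s, dz j (f i) z := by
  simp only [dz, fderiv_fun_sum hf, _root_.sum_apply, Finset.mul_sum,
    ← Finset.sum_sub_distrib]

theorem dz_star_of_holomorphic {f : (Fin n → ℂ) → ℂ} {z : Fin n → ℂ}
    (hf : DifferentiableAt ℂ f z) (j : Fin n) : dz j (fun w => star (f w)) z = 0 := by
  have h1 : HasFDerivAt (fun w => star (f w))
      ((Complex.conjCLE : ℂ →L[ℝ] ℂ).comp ((fderiv ℂ f z).restrictScalars ℝ)) z :=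
    (Complex.conjCLE : ℂ →L[ℝ] ℂ).hasFDerivAt.comp z (hf.hasFDerivAt.restrictScalars ℝ)
  have h2 : (Pi.single j Complex.I : Fin n → ℂ) = Complex.I • Pi.single j (1 : ℂ) := by
    rw [← Pi.single_smul, smul_eq_mul, mul_one]
  rw [dz, h1.fderiv, h2]
  simp only [ContinuousLinearMap.comp_apply, ContinuousLinearMap.coe_restrictScalars', map_smul,
    smul_eq_mul, ContinuousLinearEquiv.coe_coe, Complex.conjCLE_apply, map_mul, Complex.conj_I]
  linear_combination (1 / 2 * (starRingEnd ℂ) ((fderiv ℂ f z) (Pi.single j 1))) * Complex.I_sq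

section ChainRule

variable {f : (Fin n → ℂ) → ℂ} {τ : (Fin n → ℂ) → (Fin n → ℂ)} {z : Fin n → ℂ}

theorem fderiv_comp_holomorphic (hf : DifferentiableAt ℝ f (τ z)) (hτ : DifferentiableAt ℂ τ z)
    (h : Fin n → ℂ) :
    fderiv ℝ (fun w => f (τ w)) z h = fderiv ℝ f (τ z) (fderiv ℂ τ z h) := by
  have h1 : HasFDerivAt (fun w => f (τ w))
      ((fderiv ℝ f (τ z)).comp ((fderiv ℂ τ z).restrictScalars ℝ)) z :=
    hf.hasFDerivAt.comp z (hτ.hasFDerivAt.restrictScalars ℝ)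
  rw [h1.fderiv]
  rfl

theorem dz_comp (hf : DifferentiableAt ℝ f (τ z)) (hτ : DifferentiableAt ℂ τ z) (j : Fin n) :
    dz j (fun w => f (τ w)) z = ∑ p, jacobian τ z p j * dz p f (τ z) := by
  have h2 : (Pi.single j Complex.I : Fin n → ℂ) = Complex.I • Pi.single j (1 : ℂ) := by
    rw [← Pi.single_smul, smul_eq_mul, mul_one]
  rw [dz, fderiv_comp_holomorphic hf hτ, fderiv_comp_holomorphic hf hτ, h2, map_smul,
    ← sum_mul_dz]
  rfl

theorem dzbar_comp (hf : DifferentiableAt ℝ f (τ z)) (hτ : DifferentiableAt ℂ τ z) (k : Fin n) :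
    dzbar k (fun w => f (τ w)) z = ∑ q, star (jacobian τ z q k) * dzbar q f (τ z) := by
  have h2 : (Pi.single k Complex.I : Fin n → ℂ) = Complex.I • Pi.single k (1 : ℂ) := by
    rw [← Pi.single_smul, smul_eq_mul, mul_one]
  rw [dzbar, fderiv_comp_holomorphic hf hτ, fderiv_comp_holomorphic hf hτ, h2, map_smul,
    ← sum_star_mul_dzbar]
  rfl

theorem differentiableAt_dzbar (hf : ContDiffAt ℝ 2 f z) (k : Fin n) :
    DifferentiableAt ℝ (dzbar k f) z := by
  have h1 : DifferentiableAt ℝ (fderiv ℝ f) z :=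
    (hf.fderiv_right (m := 1) (by norm_num)).differentiableAt (by simp)
  have h2 : ∀ v, DifferentiableAt ℝ (fun w => fderiv ℝ f w v) z := fun v =>
    h1.clm_apply (differentiableAt_const v)
  exact ((h2 _).add ((h2 _).const_mul _)).const_mul _

/-- The complex Hessian transforms as a tensor under holomorphic maps. -/
theorem dz_dzbar_comp (hf : ContDiffAt ℝ 2 f (τ z)) (hτ : ContDiffAt ℂ 2 τ z) (k j : Fin n) :
    dz j (dzbar k fun w => f (τ w)) z =
      ((jacobian τ z)ᴴ * (Matrix.of fun q p => dz p (dzbar q f) (τ z)) * jacobian τ z) k j := by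
  have hτd : DifferentiableAt ℂ τ z := hτ.differentiableAt (by simp)
  have hJ : ∀ q, DifferentiableAt ℂ (fun w => jacobian τ w q k) z := fun q => by
    have h1 : DifferentiableAt ℂ (fderiv ℂ τ) z :=
      (hτ.fderiv_right (m := 1) (by norm_num)).differentiableAt (by simp)
    exact differentiableAt_pi.mp (h1.clm_apply (differentiableAt_const (Pi.single k 1))) q
  have hJ' : ∀ q, DifferentiableAt ℝ (fun w => star (jacobian τ w q k)) z := fun q =>
    Complex.conjCLE.differentiableAt.comp z ((hJ q).restrictScalars ℝ)
  have hτc : ContinuousAt τ z := hτd.continuousAt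
  have hev : dzbar k (fun w => f (τ w)) =ᶠ[nhds z]
      fun w => ∑ q, star (jacobian τ w q k) * dzbar q f (τ w) := by
    filter_upwards [hτc.eventually (hf.eventually (by simp)), hτ.eventually (by simp)] with w h1 h2
    exact dzbar_comp (h1.differentiableAt (by simp)) (h2.differentiableAt (by simp)) k
  have hg : ∀ q, DifferentiableAt ℝ (fun w => dzbar q f (τ w)) z := fun q =>
    (differentiableAt_dzbar hf q).comp z (hτd.restrictScalars ℝ)
  have hp : ∀ q ∈ Finset.univ, DifferentiableAt ℝ
      (fun w => star (jacobian τ w q k) * dzbar q f (τ w)) z := fun q _ => (hJ' q).mul (hg q)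
  rw [dz_congr hev, dz_sum _ hp]
  have e : ∀ q, dz j (fun w => star (jacobian τ w q k) * dzbar q f (τ w)) z =
      star (jacobian τ z q k) * ∑ p, jacobian τ z p j * dz p (dzbar q f) (τ z) := by
    intro q
    rw [dz_mul (hJ' q) (hg q), dz_star_of_holomorphic (hJ q), zero_mul, zero_add,
      dz_comp (differentiableAt_dzbar hf q) hτd]
  rw [mul_assoc, Matrix.mul_apply]
  refine Finset.sum_congr rfl fun q _ => ?_
  rw [e, conjTranspose_apply, Matrix.mul_apply]
  congr 1
  exact Finset.sum_congr rfl fun p _ => mul_comm _ _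

end ChainRule

/-! ### The second derivative test -/

section SecondDerivative

variable {φ : (Fin n → ℂ) → ℝ} {z : Fin n → ℂ}

theorem fderiv_ofReal_comp {φ : (Fin n → ℂ) → ℝ} {w : Fin n → ℂ} (hφ : DifferentiableAt ℝ φ w)
    (h : Fin n → ℂ) : fderiv ℝ (fun w => (φ w : ℂ)) w h = (fderiv ℝ φ w h : ℝ) := by
  have h1 : HasFDerivAt (fun w => (φ w : ℂ)) (Complex.ofRealCLM.comp (fderiv ℝ φ w)) w :=
    Complex.ofRealCLM.hasFDerivAt.comp w hφ.hasFDerivAt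
  rw [h1.fderiv]
  rfl

/-- The Levi form of a real function in the direction `ξ` is a quarter of its Laplacian along the
complex line spanned by `ξ`. -/
theorem re_sum_dz_dzbar (hφ : ContDiffAt ℝ 2 φ z) (ξ : Fin n → ℂ) :
    (∑ j, ∑ k, ξ j * star (ξ k) * dz j (dzbar k fun w => (φ w : ℂ)) z).re =
      (1 / 4) * (fderiv ℝ (fun w => fderiv ℝ φ w ξ) z ξ +
        fderiv ℝ (fun w => fderiv ℝ φ w (Complex.I • ξ)) z (Complex.I • ξ)) := by
  have hφ' : ContDiffAt ℝ 2 (fun w => (φ w : ℂ)) z :=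
    Complex.ofRealCLM.contDiff.contDiffAt.comp z hφ
  have h1 : DifferentiableAt ℝ (fderiv ℝ φ) z :=
    (hφ.fderiv_right (m := 1) (by norm_num)).differentiableAt (by simp)
  have h2 : ∀ v, DifferentiableAt ℝ (fun w => fderiv ℝ φ w v) z := fun v =>
    h1.clm_apply (differentiableAt_const v)
  have h2' : ∀ v, DifferentiableAt ℝ (fun w => ((fderiv ℝ φ w v : ℝ) : ℂ)) z := fun v =>
    Complex.ofRealCLM.differentiableAt.comp z (h2 v)
  have e0 : ∑ j, ∑ k, ξ j * star (ξ k) * dz j (dzbar k fun w => (φ w : ℂ)) z =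
      ∑ j, ξ j * dz j (fun w => ∑ k, star (ξ k) * dzbar k (fun w => (φ w : ℂ)) w) z := by
    refine Finset.sum_congr rfl fun j _ => ?_
    rw [dz_sum _ fun k _ => (differentiableAt_dzbar hφ' k).const_mul _, Finset.mul_sum]
    refine Finset.sum_congr rfl fun k _ => ?_
    rw [dz_mul (differentiableAt_const _) (differentiableAt_dzbar hφ' k)]
    simp [dz, mul_assoc]
  have e1 : (fun w => ∑ k, star (ξ k) * dzbar k (fun w => (φ w : ℂ)) w) =ᶠ[nhds z]
      fun w => (1 / 2 : ℂ) * (((fderiv ℝ φ w ξ : ℝ) : ℂ) +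
        Complex.I * ((fderiv ℝ φ w (Complex.I • ξ) : ℝ) : ℂ)) := by
    filter_upwards [hφ.eventually (by simp)] with w hw
    have hd := hw.differentiableAt (by simp)
    rw [sum_star_mul_dzbar, fderiv_ofReal_comp hd, fderiv_ofReal_comp hd]
  have h3 : DifferentiableAt ℝ (fun w => ((fderiv ℝ φ w ξ : ℝ) : ℂ) +
      Complex.I * ((fderiv ℝ φ w (Complex.I • ξ) : ℝ) : ℂ)) z :=
    (h2' ξ).add ((h2' _).const_mul _)
  rw [e0, sum_mul_dz, e1.fderiv_eq, fderiv_const_mul h3,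
    fderiv_fun_add (h2' ξ) ((h2' _).const_mul _), fderiv_const_mul (h2' _)]
  simp only [_root_.smul_apply, _root_.add_apply, smul_eq_mul, fderiv_ofReal_comp (h2 _)]
  simp
  ring

theorem second_deriv_line (hφ : ContDiffAt ℝ 2 φ z) (ξ : Fin n → ℂ) :
    deriv (deriv fun s : ℝ => φ (z + s • ξ)) 0 = fderiv ℝ (fun w => fderiv ℝ φ w ξ) z ξ := by
  have hl : ∀ s : ℝ, HasDerivAt (fun s : ℝ => z + s • ξ) ξ s := fun s => by
    simpa using ((hasDerivAt_id s).smul_const ξ).const_add z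
  have hc : ContinuousAt (fun s : ℝ => z + s • ξ) 0 := (hl 0).continuousAt
  have hz : z + (0 : ℝ) • ξ = z := by simp
  have e1 : deriv (fun s : ℝ => φ (z + s • ξ)) =ᶠ[nhds 0] fun s => fderiv ℝ φ (z + s • ξ) ξ := by
    have : ∀ᶠ w in nhds (z + (0 : ℝ) • ξ), ContDiffAt ℝ 2 φ w := by
      rw [hz]; exact hφ.eventually (by simp)
    filter_upwards [hc.eventually this] with s hs
    exact ((hs.differentiableAt (by simp)).hasFDerivAt.comp_hasDerivAt s (hl s)).deriv
  have h1 : DifferentiableAt ℝ (fderiv ℝ φ) z :=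
    (hφ.fderiv_right (m := 1) (by norm_num)).differentiableAt (by simp)
  have h2 : DifferentiableAt ℝ (fun w => fderiv ℝ φ w ξ) (z + (0 : ℝ) • ξ) := by
    rw [hz]; exact h1.clm_apply (differentiableAt_const ξ)
  rw [e1.deriv_eq]
  have := (h2.hasFDerivAt.comp_hasDerivAt (0 : ℝ) (hl 0)).deriv
  rw [hz] at this
  exact this

theorem second_deriv_nonpos_of_isLocalMax (hφ : ContDiffAt ℝ 2 φ z) (hm : IsLocalMax φ z)
    (ξ : Fin n → ℂ) : fderiv ℝ (fun w => fderiv ℝ φ w ξ) z ξ ≤ 0 := by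
  rw [← second_deriv_line hφ]
  by_contra! hpos
  set f : ℝ → ℝ := fun s => φ (z + s • ξ) with hf
  have hz : z + (0 : ℝ) • ξ = z := by simp
  have hc : Continuous fun s : ℝ => z + s • ξ := by fun_prop
  have hmax : IsLocalMax f 0 := by
    have := hc.continuousAt (x := 0)
    rw [ContinuousAt, hz] at this
    have h3 := this.eventually hm
    filter_upwards [h3] with s hs
    simpa [hf] using hs
  have hcont : ContinuousAt f 0 := by
    refine ContinuousAt.comp (g := φ) ?_ hc.continuousAt
    rw [hz]; exact hφ.continuousAt
  -- the point would be a local minimum as well, so that the function is locally constant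
  have hmin := isLocalMin_of_deriv_deriv_pos hpos hmax.deriv_eq_zero hcont
  have hconst : f =ᶠ[nhds 0] fun _ => f 0 := by
    filter_upwards [hmax, hmin] with s h1 h2 using le_antisymm h1 h2
  have : deriv f =ᶠ[nhds 0] fun _ => 0 := by
    filter_upwards [hconst.eventuallyEq_nhds] with s hs
    rw [hs.deriv_eq]; simp
  rw [this.deriv_eq] at hpos
  simp at hpos

/-- At a local maximum, the Laplacian with respect to a positive Hermitian matrix is not
positive. -/
theorem re_trace_hess_nonpos {g : Matrix (Fin n) (Fin n) ℂ} (hg : g.PosSemidef)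
    (hφ : ContDiffAt ℝ 2 φ z) (hm : IsLocalMax φ z) :
    (g * Matrix.of fun k j => dz j (dzbar k fun w => (φ w : ℂ)) z).trace.re ≤ 0 := by
  obtain ⟨B, hB⟩ := exists_eq_conjTranspose_mul_self hg
  have e : (g * Matrix.of fun k j => dz j (dzbar k fun w => (φ w : ℂ)) z).trace =
      ∑ a, ∑ j, ∑ k, star (B a j) * star (star (B a k)) *
        dz j (dzbar k fun w => (φ w : ℂ)) z := by
    rw [trace_mul_eq_sum, hB]
    simp only [Matrix.mul_apply, conjTranspose_apply, Matrix.of_apply, Finset.sum_mul, star_star]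
    exact (Finset.sum_congr rfl fun j _ => Finset.sum_comm).trans Finset.sum_comm
  rw [e, Complex.re_sum]
  refine Finset.sum_nonpos fun a _ => ?_
  rw [re_sum_dz_dzbar hφ fun j => star (B a j)]
  have h1 := second_deriv_nonpos_of_isLocalMax hφ hm fun j => star (B a j)
  have h2 := second_deriv_nonpos_of_isLocalMax hφ hm (Complex.I • fun j => star (B a j))
  linarith

end SecondDerivative

end Wirtinger

/-! ### The strong maximum principle for pluriharmonic functions -/

section Harmonic

open InnerProductSpace Metric

/-- A harmonic function `h` on a disc is the real part of a holomorphic `F`; the maximum principle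
for the modulus applies to `exp F`, whose modulus is `exp h`. -/
theorem harmonic_eq_of_isMaxOn {h : ℂ → ℝ} {R : ℝ} (hh : HarmonicOnNhd h (ball 0 R))
    (hm : ∀ z ∈ ball (0 : ℂ) R, h z ≤ h 0) {z : ℂ} (hz : z ∈ ball (0 : ℂ) R) : h z = h 0 := by
  have h0 : (0 : ℂ) ∈ ball (0 : ℂ) R := mem_ball_self (pos_of_mem_ball hz)
  obtain ⟨F, hF, hFh⟩ := hh.exists_analyticOnNhd_ball_re_eq
  have hnorm : ∀ w ∈ ball (0 : ℂ) R, ‖Complex.exp (F w)‖ = Real.exp (h w) := fun w hw => by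
    rw [Complex.norm_exp, ← hFh hw]
  have hd : DifferentiableOn ℂ (fun w => Complex.exp (F w)) (ball 0 R) :=
    hF.differentiableOn.cexp
  have := Complex.norm_eqOn_of_isPreconnected_of_isMaxOn (convex_ball (0 : ℂ) R).isPreconnected
    isOpen_ball hd h0 (fun w hw => by
      simp only [mem_ofPred_eq, Function.comp, hnorm w hw, hnorm 0 h0]
      exact Real.exp_le_exp.mpr (hm w hw)) hz
  simp only [Function.comp, Function.const_apply, hnorm z hz, hnorm 0 h0] at this
  exact Real.exp_injective this

variable {n : ℕ}

/-- A pluriharmonic function that has a maximum at the centre of a ball is constant there. -/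
theorem pluriharmonic_eq_of_isMaxOn {φ : (Fin n → ℂ) → ℝ} {z₀ : Fin n → ℂ} {r : ℝ}
    (hφ : ContDiffOn ℝ 2 φ (ball z₀ r))
    (hh : ∀ z ∈ ball z₀ r, ∀ j k, dz j (dzbar k fun w => (φ w : ℂ)) z = 0)
    (hm : ∀ z ∈ ball z₀ r, φ z ≤ φ z₀) {z : Fin n → ℂ} (hz : z ∈ ball z₀ r) : φ z = φ z₀ := by
  rcases eq_or_ne z z₀ with rfl | hne
  · rfl
  set ξ := z - z₀ with hξ
  have hξ0 : 0 < ‖ξ‖ := norm_pos_iff.mpr (sub_ne_zero.mpr hne)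
  have hξr : ‖ξ‖ < r := by rwa [hξ, ← dist_eq_norm, ← mem_ball]
  set A : ℂ →L[ℝ] (Fin n → ℂ) := (ContinuousLinearMap.toSpanSingleton ℂ ξ).restrictScalars ℝ
    with hA
  have hAa : ∀ ζ, A ζ = ζ • ξ := fun ζ => rfl
  have hmem : ∀ ζ ∈ ball (0 : ℂ) (r / ‖ξ‖), z₀ + A ζ ∈ ball z₀ r := by
    intro ζ hζ
    rw [mem_ball_zero_iff, lt_div_iff₀ hξ0] at hζ
    rw [mem_ball, dist_eq_norm, add_sub_cancel_left, hAa, norm_smul]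
    exact hζ
  have hharm : HarmonicOnNhd (fun ζ => φ (z₀ + A ζ)) (ball 0 (r / ‖ξ‖)) := by
    have hcd : ∀ ζ ∈ ball (0 : ℂ) (r / ‖ξ‖), ContDiffAt ℝ 2 φ (z₀ + A ζ) := fun ζ hζ =>
      hφ.contDiffAt (isOpen_ball.mem_nhds (hmem ζ hζ))
    intro ζ hζ
    refine ⟨(hcd ζ hζ).comp ζ (by fun_prop), ?_⟩
    filter_upwards [isOpen_ball.mem_nhds hζ] with ζ hζ
    have hl : ∀ a : ℂ, HasFDerivAt (fun ζ => z₀ + A ζ) A a := fun a => A.hasFDerivAt.const_add z₀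
    have hc := hcd ζ hζ
    have h1 : DifferentiableAt ℝ (fderiv ℝ φ) (z₀ + A ζ) :=
      (hc.fderiv_right (m := 1) (by norm_num)).differentiableAt (by simp)
    have hf1 : fderiv ℝ (fun ζ => φ (z₀ + A ζ)) =ᶠ[nhds ζ]
        fun a => (fderiv ℝ φ (z₀ + A a)).comp A := by
      filter_upwards [(hl ζ).continuousAt.eventually (hc.eventually (by simp))] with a ha
      exact ((ha.differentiableAt (by simp)).hasFDerivAt.comp a (hl a)).fderiv
    have hf2 : ∀ a : ℂ, fderiv ℝ (fderiv ℝ (fun ζ => φ (z₀ + A ζ))) ζ a a =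
        fderiv ℝ (fun w => fderiv ℝ φ w (A a)) (z₀ + A ζ) (A a) := by
      intro a
      have h2 : HasFDerivAt (fun a => fderiv ℝ φ (z₀ + A a))
          ((fderiv ℝ (fderiv ℝ φ) (z₀ + A ζ)).comp A) ζ := h1.hasFDerivAt.comp ζ (hl ζ)
      rw [hf1.fderiv_eq, (h2.clm_comp (hasFDerivAt_const A ζ)).fderiv,
        fderiv_clm_apply h1 (differentiableAt_const _)]
      simp
    rw [laplacian_eq_iteratedFDeriv_complexPlane]
    simp only [iteratedFDeriv_two_apply, Pi.zero_apply, Matrix.cons_val_zero, Matrix.cons_val_one]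
    rw [hf2, hf2]
    have := re_sum_dz_dzbar hc ξ
    simp only [hh _ (hmem ζ hζ), mul_zero, Finset.sum_const_zero, Complex.zero_re] at this
    simp only [hAa, one_smul] at this ⊢
    linarith
  have h1 : (1 : ℂ) ∈ ball (0 : ℂ) (r / ‖ξ‖) := by
    rw [mem_ball_zero_iff, lt_div_iff₀ hξ0]; simpa using hξr
  have := harmonic_eq_of_isMaxOn hharm (fun ζ hζ => by simpa using hm _ (hmem ζ hζ)) h1
  simpa [hAa, hξ] using this

end Harmonic

/-! ### Integrals with parameters -/

section Parametric

open intervalIntegral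

universe u

/-- The derivative of `(t, x) ↦ ∫ f(s, x) ds`, `s` from `t₀` to `t`, by differentiation under the
integral sign and the fundamental theorem of calculus, up to the boundary `t = t₀`. -/
theorem hasFDerivWithinAt_integral_prod {E F : Type u} [NormedAddCommGroup E] [NormedSpace ℝ E]
    [ProperSpace E] [NormedAddCommGroup F] [NormedSpace ℝ F] [CompleteSpace F] {U : Set E}
    (hU : IsOpen U) {t₀ : ℝ} {f : ℝ × E → F} {f' : ℝ × E → E →L[ℝ] F}
    (hf : ContinuousOn f (Ici t₀ ×ˢ U)) (hf' : ContinuousOn f' (Ici t₀ ×ˢ U))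
    (hd : ∀ p ∈ Ici t₀ ×ˢ U, HasFDerivAt (fun x => f (p.1, x)) (f' p) p.2)
    {p : ℝ × E} (hp : p ∈ Ici t₀ ×ˢ U) :
    HasFDerivWithinAt (fun p : ℝ × E => ∫ s in t₀..p.1, f (s, p.2))
      ((ContinuousLinearMap.fst ℝ ℝ E).smulRight (f p) +
        (∫ s in t₀..p.1, f' (s, p.2)).comp (ContinuousLinearMap.snd ℝ ℝ E)) (Ici t₀ ×ˢ U) p := by
  obtain ⟨t, x⟩ := p
  obtain ⟨ht, hx⟩ := hp
  simp only [mem_Ici] at ht hx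
  obtain ⟨r, hr, hrU⟩ := Metric.nhds_basis_closedBall.mem_iff.mp (hU.mem_nhds hx)
  have hslice : ∀ {H : Type u} [TopologicalSpace H] (q : ℝ × E → H), ContinuousOn q (Ici t₀ ×ˢ U) →
      ∀ y ∈ U, ContinuousOn (fun s => q (s, y)) (Ici t₀) := fun q hq y hy =>
    hq.comp (by fun_prop) fun s hs => ⟨hs, hy⟩
  have hint : ∀ {H : Type u} [NormedAddCommGroup H] [NormedSpace ℝ H] (q : ℝ × E → H),
      ContinuousOn q (Ici t₀ ×ˢ U) → ∀ y ∈ U, ∀ a ∈ Ici t₀, ∀ b ∈ Ici t₀,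
      IntervalIntegrable (fun s => q (s, y)) volume a b := fun q hq y hy a ha b hb =>
    ((hslice q hq y hy).mono fun s hs => (le_min ha hb).trans hs.1).intervalIntegrable
  -- the derivative in the space variable
  have hspace : HasFDerivAt (fun y => ∫ s in t₀..t, f (s, y)) (∫ s in t₀..t, f' (s, x)) x := by
    obtain ⟨C, hC⟩ := (isCompact_Icc.prod (isCompact_closedBall x r)).exists_bound_of_continuousOn
      (f := f') (s := Icc t₀ t ×ˢ Metric.closedBall x r)
      (hf'.mono (prod_mono (fun s hs => hs.1) hrU))
    refine (hasFDerivAt_integral_of_dominated_of_fderiv_le (F := fun y s => f (s, y))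
      (F' := fun y s => f' (s, y)) (bound := fun _ => C) (Metric.closedBall_mem_nhds x hr)
      ?_ (hint f hf x hx _ self_mem_Ici _ ht) ?_ ?_ ?_ ?_)
    · filter_upwards [hU.mem_nhds hx] with y hy
      exact (hint f hf y hy t₀ self_mem_Ici t ht).aestronglyMeasurable_restrict_uIoc
    · exact (hint f' hf' x hx t₀ self_mem_Ici t ht).aestronglyMeasurable_restrict_uIoc
    · refine Filter.Eventually.of_forall fun s hs y hy => hC (s, y) ⟨?_, hy⟩
      rw [uIoc_of_le ht] at hs; exact ⟨hs.1.le, hs.2⟩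
    · exact intervalIntegrable_const
    · refine Filter.Eventually.of_forall fun s hs y hy => hd (s, y) ⟨?_, hrU hy⟩
      rw [uIoc_of_le ht] at hs; exact hs.1.le
  have hsnd : HasFDerivAt (Prod.snd : ℝ × E → E) (ContinuousLinearMap.snd ℝ ℝ E) (t, x) :=
    hasFDerivAt_snd
  have hspace' : HasFDerivWithinAt (fun p : ℝ × E => ∫ s in t₀..t, f (s, p.2))
      ((∫ s in t₀..t, f' (s, x)).comp (ContinuousLinearMap.snd ℝ ℝ E)) (Ici t₀ ×ˢ U) (t, x) :=
    (hspace.comp (g := fun y => ∫ s in t₀..t, f (s, y)) (t, x) hsnd).hasFDerivWithinAt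
  -- the derivative in the time variable
  have htime : HasFDerivWithinAt (fun p : ℝ × E => ∫ s in t..p.1, f (s, p.2))
      ((ContinuousLinearMap.fst ℝ ℝ E).smulRight (f (t, x))) (Ici t₀ ×ˢ U) (t, x) := by
    rw [hasFDerivWithinAt_iff_isLittleO, Asymptotics.isLittleO_iff]
    intro c hc
    have hcont := hf (t, x) ⟨ht, hx⟩
    rw [Metric.continuousWithinAt_iff] at hcont
    obtain ⟨δ, hδ, hcont⟩ := hcont c hc
    filter_upwards [inter_mem_nhdsWithin _ (Metric.ball_mem_nhds (t, x) hδ)] with q hq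
    obtain ⟨⟨hq1, hq2⟩, hq3⟩ := hq
    have e : (∫ s in t..q.1, f (s, q.2)) - (∫ s in t..t, f (s, x)) -
        ((ContinuousLinearMap.fst ℝ ℝ E).smulRight (f (t, x))) (q - (t, x)) =
        ∫ s in t..q.1, (f (s, q.2) - f (t, x)) := by
      rw [integral_sub (hint f hf q.2 hq2 t ht q.1 hq1) intervalIntegrable_const]
      simp
    rw [e]
    refine (intervalIntegral.norm_integral_le_of_norm_le_const (C := c) fun s hs => ?_).trans ?_
    · have hs' : s ∈ uIcc t q.1 := uIoc_subset_uIcc hs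
      rw [← dist_eq_norm]
      refine (hcont (x := (s, q.2)) ⟨?_, hq2⟩ ?_).le
      · exact (le_min ht hq1).trans hs'.1
      · refine lt_of_le_of_lt ?_ hq3
        rw [Prod.dist_eq, Prod.dist_eq]
        refine max_le_max ?_ le_rfl
        rw [Real.dist_eq, Real.dist_eq]
        exact abs_sub_left_of_mem_uIcc hs'
    · gcongr
      exact norm_fst_le (q - (t, x))
  refine (htime.add hspace').congr (fun q hq => ?_) ?_
  · simp only [Pi.add_apply]
    rw [add_comm, integral_add_adjacent_intervals (hint f hf q.2 hq.2 t₀ self_mem_Ici t ht)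
      (hint f hf q.2 hq.2 t ht q.1 hq.1)]
  · simp

theorem uniqueDiffOn_Ici_prod {E : Type u} [NormedAddCommGroup E] [NormedSpace ℝ E] {U : Set E}
    (hU : IsOpen U) (t₀ : ℝ) : UniqueDiffOn ℝ (Ici t₀ ×ˢ U) :=
  (uniqueDiffOn_Ici t₀).prod hU.uniqueDiffOn

theorem hasFDerivAt_slice {E F : Type u} [NormedAddCommGroup E] [NormedSpace ℝ E]
    [NormedAddCommGroup F] [NormedSpace ℝ F] {U : Set E} (hU : IsOpen U) {t₀ : ℝ} {f : ℝ × E → F}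
    {p : ℝ × E} (hp : p ∈ Ici t₀ ×ˢ U) (hf : DifferentiableWithinAt ℝ f (Ici t₀ ×ˢ U) p) :
    HasFDerivAt (fun x => f (p.1, x))
      ((fderivWithin ℝ f (Ici t₀ ×ˢ U) p).comp (ContinuousLinearMap.inr ℝ ℝ E)) p.2 := by
  have h1 : HasFDerivWithinAt (fun x : E => (p.1, x)) (ContinuousLinearMap.inr ℝ ℝ E) U p.2 :=
    (hasFDerivAt_prodMk_right p.1 p.2).hasFDerivWithinAt
  have h2 : HasFDerivWithinAt f (fderivWithin ℝ f (Ici t₀ ×ˢ U) p) (Ici t₀ ×ˢ U) (p.1, p.2) :=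
    hf.hasFDerivWithinAt
  exact (h2.comp p.2 h1 fun y hy => ⟨hp.1, hy⟩).hasFDerivAt (hU.mem_nhds hp.2)

/-- Integration in time preserves smoothness up to the boundary. -/
theorem contDiffOn_integral_prod {E : Type u} [NormedAddCommGroup E] [NormedSpace ℝ E]
    [ProperSpace E] {U : Set E} (hU : IsOpen U) {t₀ : ℝ} {F : Type u} [NormedAddCommGroup F]
    [NormedSpace ℝ F] [CompleteSpace F] {f : ℝ × E → F}
    (hf : ContDiffOn ℝ ∞ f (Ici t₀ ×ˢ U)) :
    ContDiffOn ℝ ∞ (fun p : ℝ × E => ∫ s in t₀..p.1, f (s, p.2)) (Ici t₀ ×ˢ U) := by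
  have hS := uniqueDiffOn_Ici_prod hU t₀
  -- the derivative takes values in another space, so the induction runs over all targets
  have key : ∀ (m : ℕ) (F : Type u) [NormedAddCommGroup F] [NormedSpace ℝ F] [CompleteSpace F]
      (f : ℝ × E → F), ContDiffOn ℝ ∞ f (Ici t₀ ×ˢ U) →
      ContDiffOn ℝ m (fun p : ℝ × E => ∫ s in t₀..p.1, f (s, p.2)) (Ici t₀ ×ˢ U) := by
    intro m
    induction m with
    | zero =>
      intro F _ _ _ f hf
      rw [Nat.cast_zero, contDiffOn_zero]
      intro p hp
      exact (hasFDerivWithinAt_integral_prod hU hf.continuousOn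
        (((hf.fderivWithin hS (m := 0) (by simp)).continuousOn).clm_comp continuousOn_const)
        (fun p hp => hasFDerivAt_slice hU hp (hf.differentiableOn (by simp) p hp))
        hp).continuousWithinAt
    | succ m ih =>
      intro F _ _ _ f hf
      have hf' : ContDiffOn ℝ ∞ (fun p => (fderivWithin ℝ f (Ici t₀ ×ˢ U) p).comp
          (ContinuousLinearMap.inr ℝ ℝ E)) (Ici t₀ ×ˢ U) :=
        (hf.fderivWithin hS (m := ∞) (by simp)).clm_comp contDiffOn_const
      have hD : ∀ p ∈ Ici t₀ ×ˢ U, HasFDerivWithinAt _ _ _ p := fun p hp =>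
        hasFDerivWithinAt_integral_prod hU hf.continuousOn hf'.continuousOn
          (fun p hp => hasFDerivAt_slice hU hp (hf.differentiableOn (by simp) p hp)) hp
      rw [Nat.cast_succ, contDiffOn_succ_iff_fderivWithin hS]
      refine ⟨fun p hp => (hD p hp).differentiableWithinAt, by simp, ?_⟩
      refine ContDiffOn.congr ?_ fun p hp => (hD p hp).fderivWithin (hS p hp)
      refine ContDiffOn.add ?_ ?_
      · exact contDiffOn_const.smulRight (hf.of_le (by exact_mod_cast le_top))
      · exact (ih _ _ hf').clm_comp contDiffOn_const
  exact contDiffOn_infty.mpr fun m => key m F f hf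

end Parametric

/-! ### Smoothness up to the initial time -/

section Slab

variable {n : ℕ} {t₀ : ℝ} {U : Set (Fin n → ℂ)}

/-- Space derivatives preserve smoothness on `[t₀, ∞) × U`, the boundary `t = t₀` included. -/
theorem contDiffOn_dz_slab (hU : IsOpen U) {F : ℝ × (Fin n → ℂ) → ℂ}
    (hF : ContDiffOn ℝ ∞ F (Ici t₀ ×ˢ U)) (j : Fin n) :
    ContDiffOn ℝ ∞ (fun p : ℝ × (Fin n → ℂ) => dz j (fun w => F (p.1, w)) p.2) (Ici t₀ ×ˢ U) := by
  have h1 : ∀ v : ℝ × (Fin n → ℂ), ContDiffOn ℝ ∞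
      (fun p => fderivWithin ℝ F (Ici t₀ ×ˢ U) p v) (Ici t₀ ×ˢ U) := fun v =>
    (hF.fderivWithin (uniqueDiffOn_Ici_prod hU t₀) (m := ∞) (by simp)).clm_apply contDiffOn_const
  refine (contDiffOn_const (c := (1 / 2 : ℂ)).mul ((h1 (0, Pi.single j 1)).sub
    (contDiffOn_const (c := Complex.I).mul (h1 (0, Pi.single j Complex.I))))).congr fun p hp => ?_
  rw [dz, (hasFDerivAt_slice hU hp (hF.differentiableOn (by simp) p hp)).fderiv]
  rfl

theorem contDiffOn_dzbar_slab (hU : IsOpen U) {F : ℝ × (Fin n → ℂ) → ℂ}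
    (hF : ContDiffOn ℝ ∞ F (Ici t₀ ×ˢ U)) (j : Fin n) :
    ContDiffOn ℝ ∞ (fun p : ℝ × (Fin n → ℂ) => dzbar j (fun w => F (p.1, w)) p.2)
      (Ici t₀ ×ˢ U) := by
  have h1 : ∀ v : ℝ × (Fin n → ℂ), ContDiffOn ℝ ∞
      (fun p => fderivWithin ℝ F (Ici t₀ ×ˢ U) p v) (Ici t₀ ×ˢ U) := fun v =>
    (hF.fderivWithin (uniqueDiffOn_Ici_prod hU t₀) (m := ∞) (by simp)).clm_apply contDiffOn_const
  refine (contDiffOn_const (c := (1 / 2 : ℂ)).mul ((h1 (0, Pi.single j 1)).add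
    (contDiffOn_const (c := Complex.I).mul (h1 (0, Pi.single j Complex.I))))).congr fun p hp => ?_
  rw [dzbar, (hasFDerivAt_slice hU hp (hF.differentiableOn (by simp) p hp)).fderiv]
  rfl

end Slab

theorem contDiffOn_ofReal {E : Type*} [NormedAddCommGroup E] [NormedSpace ℝ E] {F : E → ℝ}
    {s : Set E} (hF : ContDiffOn ℝ ∞ F s) : ContDiffOn ℝ ∞ (fun p => (F p : ℂ)) s :=
  Complex.ofRealCLM.contDiff.comp_contDiffOn hF

section MatrixSmooth

variable {E ι : Type*} [NormedAddCommGroup E] [NormedSpace ℝ E] [Fintype ι] [DecidableEq ι]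
  {s : Set E} {A : E → Matrix ι ι ℂ}

theorem contDiffOn_det (hA : ∀ i j, ContDiffOn ℝ ∞ (fun p => A p i j) s) :
    ContDiffOn ℝ ∞ (fun p => (A p).det) s := by
  simp only [Matrix.det_apply']
  exact ContDiffOn.sum fun σ _ => contDiffOn_const.mul (contDiffOn_prod fun i _ => hA _ _)

theorem contDiffOn_inv (hA : ∀ i j, ContDiffOn ℝ ∞ (fun p => A p i j) s)
    (h0 : ∀ p ∈ s, (A p).det ≠ 0) (i j : ι) : ContDiffOn ℝ ∞ (fun p => (A p)⁻¹ i j) s := by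
  simp only [Matrix.inv_def, Ring.inverse_eq_inv', Matrix.smul_apply, smul_eq_mul,
    Matrix.adjugate_apply]
  refine ((contDiffOn_det hA).inv h0).mul (contDiffOn_det fun a b => ?_)
  by_cases h : a = j
  · subst h; simp only [Matrix.updateRow_self]; exact contDiffOn_const
  · simp only [Matrix.updateRow_ne h]; exact hA a b

end MatrixSmooth

variable {n : ℕ}

section Local

/-! ### The flow in a chart -/

/-- The function `log det M`, whose negative is a potential of the Ricci curvature. -/
def logDet (M : ℝ → (Fin n → ℂ) → Matrix (Fin n) (Fin n) ℂ) (p : ℝ × (Fin n → ℂ)) : ℂ :=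
  ((Real.log (M p.1 p.2).det.re : ℝ) : ℂ)

/-- The right hand side `g_{k̄j} - R_{k̄j}` of the flow, in a chart. -/
def flowSpeed (M : ℝ → (Fin n → ℂ) → Matrix (Fin n) (Fin n) ℂ) (t : ℝ) (z : Fin n → ℂ) :
    Matrix (Fin n) (Fin n) ℂ :=
  M t z + Matrix.of fun k j => dz j (dzbar k fun w => logDet M (t, w)) z

/-- The trace `n - R` of the right hand side of the flow, in a chart. -/
def traceSpeed (M : ℝ → (Fin n → ℂ) → Matrix (Fin n) (Fin n) ℂ) (p : ℝ × (Fin n → ℂ)) : ℝ :=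
  ((M p.1 p.2)⁻¹ * flowSpeed M p.1 p.2).trace.re

/-- The normalized Kähler-Ricci flow for `t ≥ t₀` on an open set `U` of `ℂⁿ`: the component
`g_{k̄j}` at time `t` and at the point `z` is `M t z k j`. The components are smooth up to `t = t₀`;
the equation itself is only demanded for `t > t₀`. -/
structure LocalFlow (t₀ : ℝ) (U : Set (Fin n → ℂ))
    (M : ℝ → (Fin n → ℂ) → Matrix (Fin n) (Fin n) ℂ) : Prop where
  isOpen : IsOpen U
  posDef : ∀ t, t₀ ≤ t → ∀ z ∈ U, (M t z).PosDef
  smooth : ∀ k j, ContDiffOn ℝ ∞ (fun p : ℝ × (Fin n → ℂ) => M p.1 p.2 k j) (Ici t₀ ×ˢ U)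
  closed : ∀ t, t₀ ≤ t → ∀ z ∈ U, ∀ j k l,
    dz l (fun w => M t w k j) z = dz j (fun w => M t w k l) z
  flow : ∀ t, t₀ < t → ∀ z ∈ U, ∀ k j,
    HasDerivAt (fun s => M s z k j) (flowSpeed M t z k j) t

/-- The solution `v` of `∂v/∂t = v + (n - R)` with initial value `u₀` at time `t₀`, in a chart. -/
def flowPotential (t₀ : ℝ) (u₀ : (Fin n → ℂ) → ℝ)
    (M : ℝ → (Fin n → ℂ) → Matrix (Fin n) (Fin n) ℂ) (p : ℝ × (Fin n → ℂ)) : ℝ :=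
  Real.exp (p.1 - t₀) *
    (u₀ p.2 + ∫ s in t₀..p.1, Real.exp (-(s - t₀)) * traceSpeed M (s, p.2))

variable {t₀ : ℝ} {U : Set (Fin n → ℂ)} {M : ℝ → (Fin n → ℂ) → Matrix (Fin n) (Fin n) ℂ}

namespace LocalFlow

theorem det_pos (h : LocalFlow t₀ U M) {p : ℝ × (Fin n → ℂ)} (hp : p ∈ Ici t₀ ×ˢ U) :
    0 < (M p.1 p.2).det.re ∧ (M p.1 p.2).det = ((M p.1 p.2).det.re : ℂ) := by
  have := (h.posDef p.1 hp.1 p.2 hp.2).det_pos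
  rw [Complex.pos_iff] at this
  exact ⟨this.1, Complex.ext (by simp) (by simp [← this.2])⟩

theorem det_ne_zero (h : LocalFlow t₀ U M) {p : ℝ × (Fin n → ℂ)} (hp : p ∈ Ici t₀ ×ˢ U) :
    (M p.1 p.2).det ≠ 0 := (h.posDef p.1 hp.1 p.2 hp.2).det_pos.ne'

theorem contDiffOn_logDet (h : LocalFlow t₀ U M) : ContDiffOn ℝ ∞ (logDet M) (Ici t₀ ×ˢ U) :=
  Complex.ofRealCLM.contDiff.comp_contDiffOn
    (ContDiffOn.log (Complex.reCLM.contDiff.comp_contDiffOn (contDiffOn_det h.smooth))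
      fun _ hp => (h.det_pos hp).1.ne')

theorem contDiffOn_flowSpeed (h : LocalFlow t₀ U M) (k j : Fin n) :
    ContDiffOn ℝ ∞ (fun p : ℝ × (Fin n → ℂ) => flowSpeed M p.1 p.2 k j) (Ici t₀ ×ˢ U) :=
  (h.smooth k j).add (contDiffOn_dz_slab h.isOpen
    (contDiffOn_dzbar_slab h.isOpen h.contDiffOn_logDet k) j)

theorem contDiffOn_traceSpeed (h : LocalFlow t₀ U M) :
    ContDiffOn ℝ ∞ (traceSpeed M) (Ici t₀ ×ˢ U) := by
  refine Complex.reCLM.contDiff.comp_contDiffOn ?_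
  simp only [trace_mul_eq_sum]
  exact ContDiffOn.sum fun l _ => ContDiffOn.sum fun m _ =>
    (contDiffOn_inv h.smooth (fun p hp => h.det_ne_zero hp) l m).mul (h.contDiffOn_flowSpeed m l)

theorem contDiffOn_flowPotential (h : LocalFlow t₀ U M) {u₀ : (Fin n → ℂ) → ℝ}
    (hu : ContDiffOn ℝ ∞ u₀ U) : ContDiffOn ℝ ∞ (flowPotential t₀ u₀ M) (Ici t₀ ×ˢ U) := by
  have h1 : ContDiff ℝ ∞ fun p : ℝ × (Fin n → ℂ) => Real.exp (p.1 - t₀) := by fun_prop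
  have h2 : ContDiff ℝ ∞ fun p : ℝ × (Fin n → ℂ) => Real.exp (-(p.1 - t₀)) := by fun_prop
  refine h1.contDiffOn.mul (ContDiffOn.add ?_ ?_)
  · exact hu.comp contDiff_snd.contDiffOn fun p hp => hp.2
  · exact contDiffOn_integral_prod h.isOpen (h2.contDiffOn.mul h.contDiffOn_traceSpeed)

/-- The interior `(t₀, ∞) × U` of the domain of the flow, where time derivatives are two-sided. -/
def domain (h : LocalFlow t₀ U M) : TopologicalSpace.Opens (ℝ × (Fin n → ℂ)) :=
  ⟨Ioi t₀ ×ˢ U, isOpen_Ioi.prod h.isOpen⟩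

theorem domain_subset (h : LocalFlow t₀ U M) :
    (h.domain : Set (ℝ × (Fin n → ℂ))) ⊆ Ici t₀ ×ˢ U :=
  prod_mono Ioi_subset_Ici_self subset_rfl

/-- The metric as a matrix of smooth functions. -/
def algM (h : LocalFlow t₀ U M) : Matrix (Fin n) (Fin n) (smoothAlg h.domain) :=
  Matrix.of fun k j => smoothAlg.mk (fun p => M p.1 p.2 k j) ((h.smooth k j).mono h.domain_subset)

/-- The inverse metric as a matrix of smooth functions. -/
def algG (h : LocalFlow t₀ U M) : Matrix (Fin n) (Fin n) (smoothAlg h.domain) :=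
  Matrix.of fun k j => smoothAlg.mk (fun p => (M p.1 p.2)⁻¹ k j)
    ((contDiffOn_inv h.smooth (fun _ hp => h.det_ne_zero hp) k j).mono h.domain_subset)

/-- `log det g` as a smooth function. -/
def algLogDet (h : LocalFlow t₀ U M) : smoothAlg h.domain :=
  smoothAlg.mk (logDet M) (h.contDiffOn_logDet.mono h.domain_subset)

/-- `n - R` as a smooth function. -/
def algTraceSpeed (h : LocalFlow t₀ U M) : smoothAlg h.domain :=
  smoothAlg.mk (fun p => (traceSpeed M p : ℂ))
    ((contDiffOn_ofReal h.contDiffOn_traceSpeed).mono h.domain_subset)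

/-- The potential `v` as a smooth function. -/
def algPotential (h : LocalFlow t₀ U M) {u₀ : (Fin n → ℂ) → ℝ} (hu : ContDiffOn ℝ ∞ u₀ U) :
    smoothAlg h.domain :=
  smoothAlg.mk (fun p => (flowPotential t₀ u₀ M p : ℂ))
    ((contDiffOn_ofReal (h.contDiffOn_flowPotential hu)).mono h.domain_subset)

theorem algM_map_eval (h : LocalFlow t₀ U M) (p : h.domain) :
    h.algM.map (smoothAlg.eval p) = M p.1.1 p.1.2 := rfl

theorem algG_map_eval (h : LocalFlow t₀ U M) (p : h.domain) :
    h.algG.map (smoothAlg.eval p) = (M p.1.1 p.1.2)⁻¹ := rfl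

theorem algG_mul_algM (h : LocalFlow t₀ U M) : h.algG * h.algM = 1 := by
  ext1 k j
  refine smoothAlg.ext_eval fun p => ?_
  have h1 := congrFun (congrFun (Matrix.map_mul (L := h.algG) (M := h.algM)
    (f := smoothAlg.eval p)) k) j
  rw [Matrix.map_apply, algM_map_eval, algG_map_eval,
    Matrix.nonsing_inv_mul _ (isUnit_iff_ne_zero.mpr (h.det_ne_zero (h.domain_subset p.2)))] at h1
  rw [h1, Matrix.one_apply, Matrix.one_apply]
  split_ifs <;> simp

theorem conj_algM (h : LocalFlow t₀ U M) (k j : Fin n) :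
    smoothAlg.conj (h.algM k j) = h.algM j k :=
  smoothAlg.ext_eval fun p => by
    rw [smoothAlg.eval_conj]
    exact (h.posDef _ (h.domain_subset p.2).1 _ p.2.2).1.apply j k

theorem conj_algG (h : LocalFlow t₀ U M) (k j : Fin n) :
    smoothAlg.conj (h.algG k j) = h.algG j k :=
  smoothAlg.ext_eval fun p => by
    rw [smoothAlg.eval_conj]
    exact (h.posDef _ (h.domain_subset p.2).1 _ p.2.2).1.inv.apply j k

theorem conj_mk_ofReal {O : TopologicalSpace.Opens (ℝ × (Fin n → ℂ))}
    (F : ℝ × (Fin n → ℂ) → ℝ) (hF : ContDiffOn ℝ ∞ (fun p => (F p : ℂ)) O) :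
    smoothAlg.conj (smoothAlg.mk _ hF) = smoothAlg.mk _ hF :=
  smoothAlg.ext_eval fun p => by
    rw [smoothAlg.eval_conj]
    exact Complex.conj_ofReal _

theorem algKahler (h : LocalFlow t₀ U M) :
    AlgKahler (algDz (O := h.domain)) algDzbar h.algM h.algG where
  comm_dd := algDz_comm
  comm_bb := algDzbar_comm
  comm_db := algDz_algDzbar_comm
  inv := h.algG_mul_algM
  closed l p j := smoothAlg.ext_eval fun q => by
    rw [algM, Matrix.of_apply, Matrix.of_apply, eval_algDz, eval_algDz]
    exact h.closed _ (h.domain_subset q.2).1 _ q.2.2 j p l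
  closed_bar l p j := by
    rw [← h.conj_algM j p, ← h.conj_algM j l, ← smoothAlg.conj_algDz, ← smoothAlg.conj_algDz]
    congr 1
    refine smoothAlg.ext_eval fun q => ?_
    rw [algM, Matrix.of_apply, Matrix.of_apply, eval_algDz, eval_algDz]
    exact h.closed _ (h.domain_subset q.2).1 _ q.2.2 p j l

end LocalFlow

/-- The derivative of an exponential. It is stated for a given `b = exp a`, so that it determines
the derivative of the logarithm `a` from that of `b`. -/
theorem smoothAlg.dir_exp {E : Type*} [NormedAddCommGroup E] [NormedSpace ℝ E]
    {O : TopologicalSpace.Opens E} {a b : smoothAlg O}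
    (hab : ∀ p : O, smoothAlg.eval p b = Complex.exp (smoothAlg.eval p a)) (v : E) :
    smoothAlg.dir v b = b * smoothAlg.dir v a := by
  rw [← smoothAlg.mk_extend a, ← smoothAlg.mk_extend b, smoothAlg.dir_mk, smoothAlg.dir_mk]
  refine smoothAlg.ext_eval fun p => ?_
  have e : extendZero b.1 =ᶠ[nhds (p : E)] fun q => Complex.exp (extendZero a.1 q) :=
    extendZero_eventuallyEq (fun q => by rw [extendZero_apply]; exact (hab q).symm) p
  rw [map_mul, smoothAlg.eval_mk, smoothAlg.eval_mk, smoothAlg.eval_mk, e.fderiv_eq,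
    ((smoothAlg.differentiableAt a p).hasFDerivAt.cexp).fderiv, e.eq_of_nhds]
  rfl

namespace LocalFlow

/-- Jacobi's formula for `log det g`. -/
theorem dir_logDet (h : LocalFlow t₀ U M) (v : ℝ × (Fin n → ℂ)) :
    smoothAlg.dir v h.algLogDet = (h.algG * h.algM.map (smoothAlg.dir v)).trace := by
  have h1 : ∀ p : h.domain, smoothAlg.eval p h.algM.det =
      Complex.exp (smoothAlg.eval p h.algLogDet) := fun p => by
    have hp := h.det_pos (h.domain_subset p.2)
    rw [RingHom.map_det]
    change (M p.1.1 p.1.2).det = Complex.exp ((Real.log (M p.1.1 p.1.2).det.re : ℝ) : ℂ)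
    rw [← Complex.ofReal_exp, Real.exp_log hp.1]
    exact hp.2
  have h2 := smoothAlg.dir_exp h1 v
  rw [derivation_det _ h.algG_mul_algM] at h2
  refine smoothAlg.ext_eval fun p => ?_
  have h3 := congrArg (smoothAlg.eval p) h2
  rw [map_mul, map_mul] at h3
  exact (mul_left_cancel₀ (by rw [h1]; exact Complex.exp_ne_zero _) h3).symm

theorem dz_logDet (h : LocalFlow t₀ U M) (j : Fin n) :
    algDz j h.algLogDet = (h.algG * h.algM.map (algDz j)).trace := by
  have e : ∀ x : smoothAlg h.domain, algDz j x = (1 / 2 : ℂ) • (smoothAlg.dir (0, Pi.single j 1) x -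
    Complex.I • smoothAlg.dir (0, Pi.single j Complex.I) x) := fun _ => rfl
  have e2 : h.algM.map (algDz j) = (1 / 2 : ℂ) • (h.algM.map (smoothAlg.dir (0, Pi.single j 1)) -
      Complex.I • h.algM.map (smoothAlg.dir (0, Pi.single j Complex.I))) := by
    ext1 a b; exact e _
  rw [e, e2, h.dir_logDet, h.dir_logDet, Matrix.mul_smul, Matrix.mul_sub, Matrix.mul_smul,
    trace_smul, trace_sub, trace_smul]

theorem algDt_algM (h : LocalFlow t₀ U M) :
    h.algM.map algDt = h.algM + algHess algDz algDzbar h.algLogDet := by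
  ext1 k j
  refine smoothAlg.ext_eval fun p => ?_
  rw [Matrix.map_apply, Matrix.add_apply, map_add]
  have h1 := eval_algDt _ ((h.smooth k j).mono h.domain_subset) p
  have h2 := h.flow _ p.2.1 _ p.2.2 k j
  rw [show h.algM k j = smoothAlg.mk _ ((h.smooth k j).mono h.domain_subset) from rfl,
    h1.unique h2, algLogDet, eval_algHess]
  rfl

theorem flowSpeed_isHermitian (h : LocalFlow t₀ U M) (p : h.domain) :
    (flowSpeed M p.1.1 p.1.2).IsHermitian := by
  have hconj : smoothAlg.conj h.algLogDet = h.algLogDet := conj_mk_ofReal _ _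
  refine (h.posDef _ (h.domain_subset p.2).1 _ p.2.2).1.add ?_
  ext k j
  rw [conjTranspose_apply, Matrix.of_apply, Matrix.of_apply,
    ← eval_algHess _ (h.contDiffOn_logDet.mono h.domain_subset) p,
    ← eval_algHess _ (h.contDiffOn_logDet.mono h.domain_subset) p, ← smoothAlg.eval_conj, algHess,
    Matrix.of_apply, Matrix.of_apply, smoothAlg.conj_algDz, smoothAlg.conj_algDzbar,
    algDz_algDzbar_comm, ← algLogDet, hconj]

theorem algTraceSpeed_eq (h : LocalFlow t₀ U M) :
    h.algTraceSpeed = (h.algG * (h.algM + algHess algDz algDzbar h.algLogDet)).trace := by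
  refine smoothAlg.ext_eval fun p => ?_
  have e : (h.algM + algHess algDz algDzbar h.algLogDet).map (smoothAlg.eval p) =
      flowSpeed M p.1.1 p.1.2 := by
    ext k j
    rw [Matrix.map_apply, Matrix.add_apply, map_add, algLogDet, eval_algHess]
    rfl
  rw [ev_trace_mul, e, algG_map_eval]
  have h1 := (trace_sq_bounds (h.posDef _ (h.domain_subset p.2).1 _ p.2.2).inv.posSemidef
    (h.flowSpeed_isHermitian p)).1
  exact Complex.ext (by simp [algTraceSpeed, smoothAlg.eval_mk, traceSpeed])
    (by rw [h1, algTraceSpeed, smoothAlg.eval_mk, Complex.ofReal_im])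

theorem algDt_potential (h : LocalFlow t₀ U M) {u₀ : (Fin n → ℂ) → ℝ}
    (hu : ContDiffOn ℝ ∞ u₀ U) :
    algDt (h.algPotential hu) = h.algPotential hu + h.algTraceSpeed := by
  refine smoothAlg.ext_eval fun p => ?_
  refine (eval_algDt _ _ p).unique ?_
  rw [map_add, algPotential, algTraceSpeed, smoothAlg.eval_mk, smoothAlg.eval_mk,
    ← Complex.ofReal_add]
  refine HasDerivAt.ofReal_comp ?_
  obtain ⟨⟨t, z⟩, ht, hz⟩ := p
  simp only [mem_Ioi] at ht hz
  have hc : ContinuousOn (fun s => Real.exp (-(s - t₀)) * traceSpeed M (s, z)) (Ici t₀) := by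
    refine ContinuousOn.mul (by fun_prop) ?_
    exact h.contDiffOn_traceSpeed.continuousOn.comp (by fun_prop) fun s hs => ⟨hs, hz⟩
  have h1 : HasDerivAt (fun t => ∫ s in t₀..t, Real.exp (-(s - t₀)) * traceSpeed M (s, z))
      (Real.exp (-(t - t₀)) * traceSpeed M (t, z)) t := by
    refine intervalIntegral.integral_hasDerivAt_right ?_ ?_ ?_
    · refine (hc.mono fun s hs => ?_).intervalIntegrable
      rw [uIcc_of_le ht.le] at hs; exact hs.1
    · exact ContinuousOn.stronglyMeasurableAtFilter isOpen_Ioi (hc.mono Ioi_subset_Ici_self) t ht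
    · exact hc.continuousAt (Ici_mem_nhds ht)
  have h2 : HasDerivAt (fun t => Real.exp (t - t₀)) (Real.exp (t - t₀)) t := by
    simpa using ((hasDerivAt_id t).sub_const t₀).exp
  have h3 := h2.mul (h1.const_add (u₀ z))
  refine h3.congr_deriv ?_
  change _ = flowPotential t₀ u₀ M (t, z) + traceSpeed M (t, z)
  rw [flowPotential]
  have : Real.exp (t - t₀) * Real.exp (-(t - t₀)) = 1 := by rw [← Real.exp_add]; simp
  linear_combination (traceSpeed M (t, z)) * this

/-- If `∂∂̄u₀ = g - Ric` at the initial time, then `∂∂̄v = g - Ric` at all later times: the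
difference of the two sides solves the linear equation `∂P/∂t = P`. -/
theorem hess_flowPotential (h : LocalFlow t₀ U M) {u₀ : (Fin n → ℂ) → ℝ}
    (hu : ContDiffOn ℝ ∞ u₀ U)
    (hu₀ : ∀ z ∈ U, ∀ k j, dz j (dzbar k fun w => (u₀ w : ℂ)) z = flowSpeed M t₀ z k j)
    {t : ℝ} (ht : t₀ ≤ t) {z : Fin n → ℂ} (hz : z ∈ U) (k j : Fin n) :
    dz j (dzbar k fun w => (flowPotential t₀ u₀ M (t, w) : ℂ)) z = flowSpeed M t z k j := by
  have hv := contDiffOn_ofReal (h.contDiffOn_flowPotential hu)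
  set P : ℝ × (Fin n → ℂ) → ℂ := fun p =>
    dz j (dzbar k fun w => (flowPotential t₀ u₀ M (p.1, w) : ℂ)) p.2 - flowSpeed M p.1 p.2 k j
    with hP
  have hPs : ContDiffOn ℝ ∞ P (Ici t₀ ×ˢ U) :=
    (contDiffOn_dz_slab h.isOpen (contDiffOn_dzbar_slab h.isOpen hv k) j).sub
      (h.contDiffOn_flowSpeed k j)
  have e1 : smoothAlg.mk P (hPs.mono h.domain_subset) =
      algHess algDz algDzbar (h.algPotential hu) k j -
        (h.algM k j + algHess algDz algDzbar h.algLogDet k j) := by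
    refine smoothAlg.ext_eval fun p => ?_
    rw [map_sub, map_add, algPotential, algLogDet, eval_algHess, eval_algHess]
    rfl
  have e2 : algDt (smoothAlg.mk P (hPs.mono h.domain_subset)) =
      smoothAlg.mk P (hPs.mono h.domain_subset) := by
    have e3 : algDt (h.algM k j) = h.algM k j + algHess algDz algDzbar h.algLogDet k j :=
      congrFun (congrFun h.algDt_algM k) j
    have e4 : algDt h.algLogDet = h.algTraceSpeed := by
      rw [algDt, h.dir_logDet, h.algTraceSpeed_eq, ← h.algDt_algM, algDt]
    have e5 : ∀ φ : smoothAlg h.domain, algDt (algHess algDz algDzbar φ k j) =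
        algHess algDz algDzbar (algDt φ) k j := fun φ => by
      simp only [algHess, Matrix.of_apply, algDt_algDz_comm, algDt_algDzbar_comm]
    have e6 : ∀ φ ψ : smoothAlg h.domain, algHess algDz algDzbar (φ + ψ) k j =
        algHess algDz algDzbar φ k j + algHess algDz algDzbar ψ k j := fun φ ψ => by
      simp only [algHess, Matrix.of_apply, map_add]
    rw [e1, map_sub, map_add, e3, e5, e5, e4, h.algDt_potential, e6]
    ring
  have hd : ∀ s ∈ Ioi t₀, HasDerivAt (fun s => P (s, z)) (P (s, z)) s := fun s hs => by
    have := eval_algDt P (hPs.mono h.domain_subset) ⟨(s, z), hs, hz⟩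
    rw [e2] at this
    exact this
  -- `e^{-s} P` is constant for `s > t₀`, and tends to `0` as `s` decreases to `t₀`
  have hd2 : ∀ s ∈ Ioi t₀, HasDerivAt (fun s : ℝ => Complex.exp (-(s : ℂ)) * P (s, z)) 0 s :=
    fun s hs => by
    have h1 : HasDerivAt (fun s : ℝ => Complex.exp (-(s : ℂ))) (-Complex.exp (-(s : ℂ))) s := by
      simpa using (((hasDerivAt_id s).ofReal_comp).neg).cexp
    exact (h1.mul (hd s hs)).congr_deriv (by ring)
  have hcont : ContinuousOn (fun s : ℝ => Complex.exp (-(s : ℂ)) * P (s, z)) (Ici t₀) :=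
    ContinuousOn.mul (by fun_prop)
      (hPs.continuousOn.comp (by fun_prop) fun s hs => ⟨hs, hz⟩)
  have hP0 : P (t₀, z) = 0 := by
    have : ∀ w, flowPotential t₀ u₀ M (t₀, w) = u₀ w := fun w => by simp [flowPotential]
    simp only [hP, this, hu₀ z hz, sub_self]
  have hPt : P (t, z) = 0 := by
    rcases ht.eq_or_lt with rfl | hlt
    · exact hP0
    have hconst : ∀ s ∈ Ioi t₀, Complex.exp (-(s : ℂ)) * P (s, z) =
        Complex.exp (-(t : ℂ)) * P (t, z) := fun s hs =>
      isOpen_Ioi.is_const_of_deriv_eq_zero isPreconnected_Ioi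
        (fun s hs => (hd2 s hs).differentiableAt.differentiableWithinAt)
        (fun s hs => (hd2 s hs).deriv) hs hlt
    have hl : Filter.Tendsto (fun s : ℝ => Complex.exp (-(s : ℂ)) * P (s, z))
        (nhdsWithin t₀ (Ioi t₀)) (nhds 0) := by
      have : Filter.Tendsto (fun s : ℝ => Complex.exp (-(s : ℂ)) * P (s, z))
          (nhdsWithin t₀ (Ioi t₀)) (nhds (Complex.exp (-(t₀ : ℂ)) * P (t₀, z))) :=
        (hcont t₀ self_mem_Ici).mono_left (nhdsWithin_mono t₀ Ioi_subset_Ici_self)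
      rwa [hP0, mul_zero] at this
    have hl2 : Filter.Tendsto (fun s : ℝ => Complex.exp (-(s : ℂ)) * P (s, z))
        (nhdsWithin t₀ (Ioi t₀)) (nhds (Complex.exp (-(t : ℂ)) * P (t, z))) :=
      tendsto_const_nhds.congr' (by
        filter_upwards [self_mem_nhdsWithin] with s hs using (hconst s hs).symm)
    have := tendsto_nhds_unique hl2 hl
    exact (mul_eq_zero.mp this).resolve_left (Complex.exp_ne_zero _)
  exact sub_eq_zero.mp hPt

theorem algFlow (h : LocalFlow t₀ U M) {u₀ : (Fin n → ℂ) → ℝ} (hu : ContDiffOn ℝ ∞ u₀ U)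
    (hu₀ : ∀ z ∈ U, ∀ k j, dz j (dzbar k fun w => (u₀ w : ℂ)) z = flowSpeed M t₀ z k j) :
    AlgFlow algDz algDzbar algDt h.algM h.algG (h.algPotential hu) h.algLogDet := by
  have e : algHess algDz algDzbar (h.algPotential hu) =
      h.algM + algHess algDz algDzbar h.algLogDet := by
    ext1 k j
    refine smoothAlg.ext_eval fun p => ?_
    rw [Matrix.add_apply, map_add, algPotential, algLogDet, eval_algHess, eval_algHess,
      h.hess_flowPotential hu hu₀ (h.domain_subset p.2).1 p.2.2]
    rfl
  exact
  { h.algKahler with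
    comm_td := algDt_algDz_comm
    comm_tb := algDt_algDzbar_comm
    d_logDet := h.dz_logDet
    hess_potential := e
    dt_metric := by rw [e, h.algDt_algM]
    dt_potential := by rw [h.algDt_potential, h.algTraceSpeed_eq, ← e, algLap] }

theorem isRealPoint (h : LocalFlow t₀ U M) {u₀ : (Fin n → ℂ) → ℝ} (hu : ContDiffOn ℝ ∞ u₀ U)
    (p : h.domain) :
    IsRealPoint algDz algDzbar h.algM h.algG (h.algPotential hu) smoothAlg.conj
      (smoothAlg.eval p) where
  conj_d := smoothAlg.conj_algDz
  conj_db := smoothAlg.conj_algDzbar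
  conj_M := h.conj_algM
  conj_G := h.conj_algG
  conj_v := conj_mk_ofReal _ _
  ev_conj a := smoothAlg.eval_conj a p
  pos := (h.posDef _ (h.domain_subset p.2).1 _ p.2.2).inv.posSemidef

end LocalFlow

/-! ### The heat operator and the test function -/

/-- The squared gradient `g^{jk̄} ∂_j φ ∂_{k̄} φ` of a real function, in a chart. -/
def gradSq (A : Matrix (Fin n) (Fin n) ℂ) (φ : (Fin n → ℂ) → ℝ) (z : Fin n → ℂ) : ℝ :=
  (∑ j, ∑ k, A⁻¹ j k * dz j (fun w => (φ w : ℂ)) z * dzbar k (fun w => (φ w : ℂ)) z).re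

/-- The differential inequality `(∂_t - Δ) F ≤ c` at a point `p` of a chart, for the metric `A`. The
regularity that gives both derivatives their meaning is part of it. -/
def HeatLE (A : Matrix (Fin n) (Fin n) ℂ) (F : ℝ × (Fin n → ℂ) → ℝ) (p : ℝ × (Fin n → ℂ))
    (c : ℝ) : Prop :=
  ∃ D, HasDerivAt (fun t => F (t, p.2)) D p.1 ∧ ContDiffAt ℝ 2 (fun w => F (p.1, w)) p.2 ∧
    D - (A⁻¹ * Matrix.of fun k j => dz j (dzbar k fun w => (F (p.1, w) : ℂ)) p.2).trace.re ≤ c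

namespace LocalFlow

/-- `HeatLE` follows from an inequality in the algebra of smooth functions. -/
theorem heatLE (h : LocalFlow t₀ U M) {F : ℝ × (Fin n → ℂ) → ℝ}
    (hF : ContDiffOn ℝ ∞ F h.domain) (p : h.domain) {φ : smoothAlg h.domain}
    (hφ : ∀ q : h.domain, smoothAlg.eval q φ = F q) {c : ℝ}
    (hc : (smoothAlg.eval p (algDt φ - algLap algDz algDzbar h.algG φ)).re ≤ c) :
    HeatLE (M p.1.1 p.1.2) F p c := by
  obtain rfl : φ = smoothAlg.mk _ (contDiffOn_ofReal hF) := smoothAlg.ext_eval hφ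
  refine ⟨(smoothAlg.eval p (algDt (smoothAlg.mk _ (contDiffOn_ofReal hF)))).re, ?_, ?_, ?_⟩
  · have := eval_algDt _ (contDiffOn_ofReal hF) p
    exact Complex.reCLM.hasFDerivAt.comp_hasDerivAt p.1.1 this
  · refine ((hF.contDiffAt (h.domain.isOpen.mem_nhds p.2)).of_le
      (WithTop.coe_le_coe.mpr le_top)).comp p.1.2 (f := fun w => (p.1.1, w)) (by fun_prop)
  · rw [map_sub, Complex.sub_re, algLap, ev_trace_mul, algG_map_eval] at hc
    convert hc using 6
    ext k j
    rw [Matrix.of_apply, Matrix.map_apply, eval_algHess]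

/-- The test function `2 v² + s |∇v|² + c s² (n - R)` with `s = t - t₀`, in a chart. -/
def testFunction (t₀ : ℝ) (u₀ : (Fin n → ℂ) → ℝ)
    (M : ℝ → (Fin n → ℂ) → Matrix (Fin n) (Fin n) ℂ) (c : ℝ) (p : ℝ × (Fin n → ℂ)) : ℝ :=
  2 * flowPotential t₀ u₀ M p ^ 2 +
    (p.1 - t₀) * gradSq (M p.1 p.2) (fun w => flowPotential t₀ u₀ M (p.1, w)) p.2 +
    c * (p.1 - t₀) ^ 2 * traceSpeed M p

variable {u₀ : (Fin n → ℂ) → ℝ}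

theorem contDiffOn_testFunction (h : LocalFlow t₀ U M) (hu : ContDiffOn ℝ ∞ u₀ U) (c : ℝ) :
    ContDiffOn ℝ ∞ (testFunction t₀ u₀ M c) (Ici t₀ ×ˢ U) := by
  have hv := contDiffOn_ofReal (h.contDiffOn_flowPotential hu)
  have hs : ContDiffOn ℝ ∞ (fun p : ℝ × (Fin n → ℂ) => p.1 - t₀) (Ici t₀ ×ˢ U) :=
    (contDiff_fst.sub contDiff_const).contDiffOn
  refine ((contDiffOn_const.mul ((h.contDiffOn_flowPotential hu).pow 2)).add (hs.mul ?_)).add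
    ((contDiffOn_const.mul (hs.pow 2)).mul h.contDiffOn_traceSpeed)
  refine Complex.reCLM.contDiff.comp_contDiffOn ?_
  exact ContDiffOn.sum fun j _ => ContDiffOn.sum fun k _ =>
    ((contDiffOn_inv h.smooth (fun p hp => h.det_ne_zero hp) j k).mul
      (contDiffOn_dz_slab h.isOpen hv j)).mul (contDiffOn_dzbar_slab h.isOpen hv k)

theorem algDz_timeFunction {O : TopologicalSpace.Opens (ℝ × (Fin n → ℂ))} {F : ℝ → ℂ}
    (hF : ContDiffOn ℝ ∞ (fun p : ℝ × (Fin n → ℂ) => F p.1) O) (j : Fin n) :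
    algDz j (smoothAlg.mk (fun p => F p.1) hF) = 0 ∧
      algDzbar j (smoothAlg.mk (fun p => F p.1) hF) = 0 := by
  constructor <;> refine smoothAlg.ext_eval fun p => ?_
  · rw [eval_algDz, map_zero, dz]; simp
  · rw [eval_algDzbar, map_zero, dzbar]; simp

theorem eval_gradSq (h : LocalFlow t₀ U M) (hu : ContDiffOn ℝ ∞ u₀ U) (q : h.domain) :
    smoothAlg.eval q (algGradSq algDz algDzbar h.algG (h.algPotential hu)) =
      (gradSq (M q.1.1 q.1.2) (fun w => flowPotential t₀ u₀ M (q.1.1, w)) q.1.2 : ℂ) := by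
  have h1 := Complex.nonneg_iff.mp (h.isRealPoint hu q).ev_gradSq
  have e : smoothAlg.eval q (algGradSq algDz algDzbar h.algG (h.algPotential hu)) =
      ∑ j, ∑ k, (M q.1.1 q.1.2)⁻¹ j k *
        dz j (fun w => (flowPotential t₀ u₀ M (q.1.1, w) : ℂ)) q.1.2 *
        dzbar k (fun w => (flowPotential t₀ u₀ M (q.1.1, w) : ℂ)) q.1.2 := by
    simp only [algGradSq, dotProduct, mulVec, map_sum, map_mul, algPotential, eval_algDz,
      eval_algDzbar, Finset.mul_sum]
    refine Finset.sum_congr rfl fun j _ => Finset.sum_congr rfl fun k _ => ?_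
    change _ * ((M q.1.1 q.1.2)⁻¹ j k * _) = _
    ring
  rw [e] at h1 ⊢
  exact Complex.ext rfl (by rw [← h1.2, Complex.ofReal_im])

/-- `Δv = n - R`. -/
theorem lap_potential (h : LocalFlow t₀ U M) (hu : ContDiffOn ℝ ∞ u₀ U)
    (hu₀ : ∀ z ∈ U, ∀ k j, dz j (dzbar k fun w => (u₀ w : ℂ)) z = flowSpeed M t₀ z k j) :
    algLap algDz algDzbar h.algG (h.algPotential hu) = h.algTraceSpeed := by
  have h1 := (h.algFlow hu hu₀).dt_potential
  rw [h.algDt_potential] at h1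
  exact (add_left_cancel h1).symm

/-- The decisive differential inequality: `(∂_t - Δ) F ≤ 4 v² + n ε²` for the test function. -/
theorem heatLE_testFunction (h : LocalFlow t₀ U M) (hu : ContDiffOn ℝ ∞ u₀ U)
    (hu₀ : ∀ z ∈ U, ∀ k j, dz j (dzbar k fun w => (u₀ w : ℂ)) z = flowSpeed M t₀ z k j)
    {c ε : ℝ} (hε : 0 ≤ ε) (hε1 : ε ≤ 1) (hc : |c| ≤ ε / 4) {t : ℝ} (ht : t₀ < t)
    (ht2 : t ≤ t₀ + 2) {z : Fin n → ℂ} (hz : z ∈ U) :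
    HeatLE (M t z) (testFunction t₀ u₀ M c) (t, z)
      (4 * flowPotential t₀ u₀ M (t, z) ^ 2 + n * ε ^ 2) := by
  have hs : ContDiffOn ℝ ∞ (fun p : ℝ × (Fin n → ℂ) => ((p.1 - t₀ : ℝ) : ℂ)) h.domain :=
    contDiffOn_ofReal (contDiff_fst.sub contDiff_const).contDiffOn
  have hcs : ContDiffOn ℝ ∞ (fun _ : ℝ × (Fin n → ℂ) => (c : ℂ)) h.domain := contDiffOn_const
  set s : smoothAlg h.domain := smoothAlg.mk _ hs
  set c' : smoothAlg h.domain := smoothAlg.mk _ hcs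
  have hs1 := fun j => algDz_timeFunction (F := fun t => ((t - t₀ : ℝ) : ℂ)) hs j
  have hc1 := fun j => algDz_timeFunction (F := fun _ => (c : ℂ)) hcs j
  have hdts : algDt s = 1 := smoothAlg.ext_eval fun p => by
    refine (eval_algDt _ hs p).unique ?_
    rw [map_one, ← Complex.ofReal_one]
    exact ((hasDerivAt_id p.1.1).sub_const t₀).ofReal_comp
  have hdtc : algDt c' = 0 := smoothAlg.ext_eval fun p => by
    refine (eval_algDt _ hcs p).unique ?_
    rw [map_zero]
    exact hasDerivAt_const _ _
  set v := h.algPotential hu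
  refine h.heatLE ((h.contDiffOn_testFunction hu c).mono h.domain_subset) ⟨(t, z), ht, hz⟩
    (φ := 2 * (v * v) + s * algGradSq algDz algDzbar h.algG v +
      c' * (s * s) * algLap algDz algDzbar h.algG v) ?_ ?_
  · intro q
    rw [h.lap_potential hu hu₀]
    simp only [map_add, map_mul, map_ofNat, testFunction]
    rw [show smoothAlg.eval q (algGradSq algDz algDzbar h.algG v) = _ from h.eval_gradSq hu q,
      show smoothAlg.eval q v = (flowPotential t₀ u₀ M q : ℂ) from rfl,
      show smoothAlg.eval q s = ((q.1.1 - t₀ : ℝ) : ℂ) from rfl,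
      show smoothAlg.eval q c' = (c : ℂ) from rfl,
      show smoothAlg.eval q h.algTraceSpeed = (traceSpeed M q : ℂ) from rfl]
    push_cast
    ring
  · have := (h.algFlow hu hu₀).evolution_test_le (h.isRealPoint hu ⟨(t, z), ht, hz⟩) (s := s)
      (c := c') (fun j => (hs1 j).1) (fun j => (hs1 j).2) hdts (fun j => (hc1 j).1)
      (fun j => (hc1 j).2) hdtc (s' := t - t₀) (c' := c) rfl rfl (by linarith) (by linarith) hε
      hε1 hc
    rw [Fintype.card_fin] at this
    exact this

/-- The function `± e^{-(t - t₀)} v` solves the heat equation. -/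
theorem heatLE_damped (h : LocalFlow t₀ U M) (hu : ContDiffOn ℝ ∞ u₀ U)
    (hu₀ : ∀ z ∈ U, ∀ k j, dz j (dzbar k fun w => (u₀ w : ℂ)) z = flowSpeed M t₀ z k j)
    (c : ℝ) {t : ℝ} (ht : t₀ < t) {z : Fin n → ℂ} (hz : z ∈ U) :
    HeatLE (M t z) (fun p => c * Real.exp (-(p.1 - t₀)) * flowPotential t₀ u₀ M p) (t, z) 0 := by
  have hs' : ContDiff ℝ ∞ (fun p : ℝ × (Fin n → ℂ) => c * Real.exp (-(p.1 - t₀))) := by fun_prop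
  have hs : ContDiffOn ℝ ∞ (fun p : ℝ × (Fin n → ℂ) => ((c * Real.exp (-(p.1 - t₀)) : ℝ) : ℂ))
      h.domain := contDiffOn_ofReal hs'.contDiffOn
  set s : smoothAlg h.domain := smoothAlg.mk _ hs
  have hs1 := fun j => algDz_timeFunction
    (F := fun t => ((c * Real.exp (-(t - t₀)) : ℝ) : ℂ)) hs j
  have hdts : algDt s = -s := smoothAlg.ext_eval fun p => by
    refine (eval_algDt _ hs p).unique ?_
    rw [map_neg, show smoothAlg.eval p s = ((c * Real.exp (-(p.1.1 - t₀)) : ℝ) : ℂ) from rfl,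
      ← Complex.ofReal_neg]
    refine HasDerivAt.ofReal_comp ?_
    have := ((((hasDerivAt_id p.1.1).sub_const t₀).neg).exp).const_mul c
    simpa using this
  refine h.heatLE (hs'.contDiffOn.mul ((h.contDiffOn_flowPotential hu).mono h.domain_subset))
    ⟨(t, z), ht, hz⟩ (φ := s * h.algPotential hu) (fun q => ?_) ?_
  · rw [map_mul, Complex.ofReal_mul]; rfl
  · rw [evolution_time_mul (fun j => (hs1 j).1) (fun j => (hs1 j).2), hdts,
      (h.algFlow hu hu₀).dt_potential, neg_mul, add_sub_cancel_right, neg_add_cancel, map_zero,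
      Complex.zero_re]

end LocalFlow

end Local

/-! ### Changes of coordinates -/

/-- The transformation law of the inverse metric. -/
theorem inv_conj_transform {A B J : Matrix (Fin n) (Fin n) ℂ} (hA : A = Jᴴ * B * J)
    (hd : A.det ≠ 0) : J * A⁻¹ * Jᴴ = B⁻¹ ∧ IsUnit J.det := by
  have hJ : J.det ≠ 0 := by
    intro h0; apply hd; rw [hA, Matrix.det_mul, h0, mul_zero]
  have hJ' : Jᴴ.det ≠ 0 := by rw [det_conjTranspose]; simpa using hJ
  refine ⟨?_, isUnit_iff_ne_zero.mpr hJ⟩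
  rw [hA, Matrix.mul_inv_rev, Matrix.mul_inv_rev, ← mul_assoc, ← mul_assoc,
    Matrix.mul_nonsing_inv _ (isUnit_iff_ne_zero.mpr hJ), one_mul, mul_assoc,
    Matrix.nonsing_inv_mul _ (isUnit_iff_ne_zero.mpr hJ'), mul_one]

theorem trace_inv_mul_transform {A B H K J : Matrix (Fin n) (Fin n) ℂ} (hA : A = Jᴴ * B * J)
    (hH : H = Jᴴ * K * J) (hd : A.det ≠ 0) : (A⁻¹ * H).trace = (B⁻¹ * K).trace := by
  rw [← (inv_conj_transform hA hd).1, hH, ← mul_assoc, trace_mul_comm]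
  simp only [mul_assoc]

theorem gradSq_comp {A B : Matrix (Fin n) (Fin n) ℂ} {φ : (Fin n → ℂ) → ℝ}
    {τ : (Fin n → ℂ) → (Fin n → ℂ)} {z : Fin n → ℂ} (hφ : DifferentiableAt ℝ φ (τ z))
    (hτ : DifferentiableAt ℂ τ z) (hA : A = (jacobian τ z)ᴴ * B * jacobian τ z)
    (hd : A.det ≠ 0) : gradSq A (fun w => φ (τ w)) z = gradSq B φ (τ z) := by
  have hφ' : DifferentiableAt ℝ (fun w => (φ w : ℂ)) (τ z) :=
    Complex.ofRealCLM.differentiableAt.comp _ hφ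
  have e : ∀ (A : Matrix (Fin n) (Fin n) ℂ) (a b : Fin n → ℂ),
      ∑ j, ∑ k, A j k * a j * b k = a ⬝ᵥ (A *ᵥ b) := fun A a b => by
    simp only [dotProduct, mulVec, Finset.mul_sum]
    exact Finset.sum_congr rfl fun _ _ => Finset.sum_congr rfl fun _ _ => by ring
  have ha : (fun j => dz j (fun w => (φ (τ w) : ℂ)) z) =
      (fun p => dz p (fun w => (φ w : ℂ)) (τ z)) ᵥ* jacobian τ z := by
    ext j; rw [dz_comp hφ' hτ]
    simp only [vecMul, dotProduct, mul_comm]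
  have hb : (fun j => dzbar j (fun w => (φ (τ w) : ℂ)) z) =
      (jacobian τ z)ᴴ *ᵥ (fun p => dzbar p (fun w => (φ w : ℂ)) (τ z)) := by
    ext j; rw [dzbar_comp hφ' hτ]; rfl
  rw [gradSq, gradSq, e A⁻¹ (fun j => dz j (fun w => (φ (τ w) : ℂ)) z), ha, hb,
    e B⁻¹ (fun j => dz j (fun w => (φ w : ℂ)) (τ z)), ← (inv_conj_transform hA hd).1,
    mulVec_mulVec, ← dotProduct_mulVec, mulVec_mulVec, mul_assoc]

theorem gradSq_congr {A : Matrix (Fin n) (Fin n) ℂ} {φ ψ : (Fin n → ℂ) → ℝ} {z : Fin n → ℂ}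
    (h : φ =ᶠ[nhds z] ψ) : gradSq A φ z = gradSq A ψ z := by
  have h' : (fun w => (φ w : ℂ)) =ᶠ[nhds z] fun w => (ψ w : ℂ) := h.mono fun w hw => by simp [hw]
  simp only [gradSq, dz_congr h', dzbar_congr h']

section Manifold

variable {X : Type*} [TopologicalSpace X] [ChartedSpace (Fin n → ℂ) X]

theorem contDiffAt_transition [IsManifold 𝓘(ℂ, Fin n → ℂ) ω X]
    {e e' : OpenPartialHomeomorph X (Fin n → ℂ)} (he : e ∈ atlas (Fin n → ℂ) X)
    (he' : e' ∈ atlas (Fin n → ℂ) X) {x : X} (hx : x ∈ e.source ∩ e'.source) :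
    ContDiffAt ℂ ω (e' ∘ e.symm) (e x) := by
  have h1 := (contDiffGroupoid ω 𝓘(ℂ, Fin n → ℂ)).compatible he he'
  have h2 := (contMDiffOn_of_mem_contDiffGroupoid h1)
  rw [contMDiffOn_iff_contDiffOn] at h2
  refine h2.contDiffAt ((e.symm ≫ₕ e').open_source.mem_nhds ?_)
  simp [e.map_source hx.1, e.left_inv hx.1, hx.2]

omit [ChartedSpace (Fin n → ℂ) X] in
theorem symm_eventually_mem {e e' : OpenPartialHomeomorph X (Fin n → ℂ)} {x : X}
    (hx : x ∈ e.source ∩ e'.source) : ∀ᶠ w in nhds (e x), e.symm w ∈ e'.source := by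
  have h1 : ContinuousAt e.symm (e x) := e.symm.continuousAt (e.map_source hx.1)
  refine h1.eventually (e'.open_source.mem_nhds ?_)
  rw [e.left_inv hx.1]; exact hx.2

omit [ChartedSpace (Fin n → ℂ) X] in
theorem comp_symm_eventuallyEq {Y : Type*} (φ : X → Y)
    {e e' : OpenPartialHomeomorph X (Fin n → ℂ)} {x : X} (hx : x ∈ e.source ∩ e'.source) :
    (fun w => φ (e.symm w)) =ᶠ[nhds (e x)] fun w => φ (e'.symm ((e' ∘ e.symm) w)) := by
  filter_upwards [symm_eventually_mem hx] with w hw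
  rw [Function.comp_apply, e'.left_inv hw]

omit [ChartedSpace (Fin n → ℂ) X] in
theorem transition_apply {e e' : OpenPartialHomeomorph X (Fin n → ℂ)} {x : X}
    (hx : x ∈ e.source ∩ e'.source) : (e' ∘ e.symm) (e x) = e' x := by
  rw [Function.comp_apply, e.left_inv hx.1]

theorem contDiffOn_comp_symm [IsManifold 𝓘(ℂ, Fin n → ℂ) ω X] {u : X → ℝ}
    (hu : ContMDiff 𝓘(ℝ, Fin n → ℂ) 𝓘(ℝ, ℝ) ∞ u) {e : OpenPartialHomeomorph X (Fin n → ℂ)}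
    (he : e ∈ atlas (Fin n → ℂ) X) : ContDiffOn ℝ ∞ (fun w => u (e.symm w)) e.target := by
  intro z hz
  refine ContDiffAt.contDiffWithinAt ?_
  set x := e.symm z with hxz
  have hx : x ∈ e.source ∩ (chartAt (Fin n → ℂ) x).source :=
    ⟨e.map_target hz, mem_chart_source _ x⟩
  have hez : e x = z := e.right_inv hz
  have h1 := (contMDiffAt_iff.mp (hu x)).2
  simp only [modelWithCornersSelf_coe, range_id, contDiffWithinAt_univ, mfld_simps] at h1
  have h2 : ContDiffAt ℝ ∞ (chartAt (Fin n → ℂ) x ∘ e.symm) (e x) :=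
    ((contDiffAt_transition he (chart_mem_atlas _ x) hx).restrict_scalars ℝ).of_le le_top
  rw [← hez]
  refine ContDiffAt.congr_of_eventuallyEq ?_ (comp_symm_eventuallyEq u hx)
  refine ContDiffAt.comp (g := fun w => u ((chartAt (Fin n → ℂ) x).symm w)) (e x) ?_ h2
  rw [transition_apply hx]
  exact h1

theorem complexHessian_transform [IsManifold 𝓘(ℂ, Fin n → ℂ) ω X] {u : X → ℝ}
    (hu : ContMDiff 𝓘(ℝ, Fin n → ℂ) 𝓘(ℝ, ℝ) ∞ u) {e e' : OpenPartialHomeomorph X (Fin n → ℂ)}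
    (he : e ∈ atlas (Fin n → ℂ) X) (he' : e' ∈ atlas (Fin n → ℂ) X) {x : X}
    (hx : x ∈ e.source ∩ e'.source) :
    complexHessian u e (e x) = (jacobian (e' ∘ e.symm) (e x))ᴴ * complexHessian u e' (e' x) *
      jacobian (e' ∘ e.symm) (e x) := by
  have h1 : ContDiffAt ℝ 2 (fun w => (u (e'.symm w) : ℂ)) ((e' ∘ e.symm) (e x)) := by
    rw [transition_apply hx]
    exact ((contDiffOn_ofReal (contDiffOn_comp_symm hu he')).contDiffAt
      (e'.open_target.mem_nhds (e'.map_source hx.2))).of_le (WithTop.coe_le_coe.mpr le_top)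
  have h2 : ContDiffAt ℂ 2 (e' ∘ e.symm) (e x) := (contDiffAt_transition he he' hx).of_le le_top
  ext k j
  rw [complexHessian, Matrix.of_apply,
    dz_dzbar_congr (comp_symm_eventuallyEq (fun y => (u y : ℂ)) hx), dz_dzbar_comp h1 h2,
    transition_apply hx]
  rfl

end Manifold

variable {X : Type*} [TopologicalSpace X] [ChartedSpace (Fin n → ℂ) X]

/-! ### The maximum principle -/

/-- The weak maximum principle for the heat operator of a time-dependent metric on a compact
manifold. `A e` and `Fe e` are the metric and the function `F` in the chart `e`. -/
theorem le_of_heatLE [CompactSpace X] {F : ℝ → X → ℝ} {t₀ T B c : ℝ}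
    (A : OpenPartialHomeomorph X (Fin n → ℂ) → ℝ → (Fin n → ℂ) → Matrix (Fin n) (Fin n) ℂ)
    (Fe : OpenPartialHomeomorph X (Fin n → ℂ) → ℝ × (Fin n → ℂ) → ℝ)
    (hFe : ∀ e ∈ atlas (Fin n → ℂ) X, ∀ t, t₀ ≤ t → ∀ z ∈ e.target, F t (e.symm z) = Fe e (t, z))
    (hcont : ∀ e ∈ atlas (Fin n → ℂ) X, ContinuousOn (Fe e) (Ici t₀ ×ˢ e.target))
    (hA : ∀ e ∈ atlas (Fin n → ℂ) X, ∀ t, t₀ ≤ t → ∀ z ∈ e.target, (A e t z).PosDef)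
    (hheat : ∀ e ∈ atlas (Fin n → ℂ) X, ∀ t, t₀ < t → t ≤ T → ∀ z ∈ e.target,
      HeatLE (A e t z) (Fe e) (t, z) c)
    (hB : ∀ x, F t₀ x ≤ B) {t : ℝ} (ht : t ∈ Icc t₀ T) (x : X) : F t x ≤ B + c * (t - t₀) := by
  have hFc : ContinuousOn (fun p : ℝ × X => F p.1 p.2) (Icc t₀ T ×ˢ univ) := by
    rintro ⟨s, y⟩ ⟨hs, -⟩
    set e := chartAt (Fin n → ℂ) y with he
    have hea : e ∈ atlas (Fin n → ℂ) X := chart_mem_atlas _ y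
    have hy : y ∈ e.source := mem_chart_source _ y
    have h1 : ContinuousWithinAt (fun p : ℝ × X => Fe e (p.1, e p.2))
        (Icc t₀ T ×ˢ e.source) (s, y) := by
      refine (hcont e hea (s, e y) ⟨hs.1, e.map_source hy⟩).comp (t := Ici t₀ ×ˢ e.target)
        (f := fun p : ℝ × X => (p.1, e p.2)) ?_ fun p hp => ⟨hp.1.1, e.map_source hp.2⟩
      exact (continuousAt_fst.prodMk
        ((e.continuousAt hy).comp (f := Prod.snd) continuousAt_snd)).continuousWithinAt
    have h2 : ContinuousWithinAt (fun p : ℝ × X => F p.1 p.2) (Icc t₀ T ×ˢ e.source) (s, y) :=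
      h1.congr (fun p hp => by
        rw [← hFe e hea p.1 hp.1.1 (e p.2) (e.map_source hp.2), e.left_inv hp.2])
        (by rw [← hFe e hea s hs.1 (e y) (e.map_source hy), e.left_inv hy])
    refine h2.mono_of_mem_nhdsWithin ?_
    rw [nhdsWithin_prod_eq, nhdsWithin_univ]
    exact Filter.prod_mem_prod self_mem_nhdsWithin (e.open_source.mem_nhds hy)
  -- a strictly larger constant makes the inequality at an interior maximum contradictory
  refine le_of_forall_pos_le_add fun η hη => ?_
  have hT : t₀ ≤ T := ht.1.trans ht.2
  set η' := η / (T - t₀ + 1) with hη'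
  have hη'0 : 0 < η' := by have : 0 < T - t₀ + 1 := by linarith
                           positivity
  obtain ⟨⟨s, y⟩, ⟨hs, -⟩, hmax⟩ := (isCompact_Icc.prod isCompact_univ).exists_isMaxOn
    ⟨(t, x), ht, mem_univ x⟩
    (hFc.sub (f := fun p : ℝ × X => F p.1 p.2) (g := fun p => (c + η') * (p.1 - t₀)) (by fun_prop))
  have hmax' : ∀ s' ∈ Icc t₀ T, ∀ y', F s' y' - (c + η') * (s' - t₀) ≤
      F s y - (c + η') * (s - t₀) := fun s' hs' y' => hmax (a := (s', y')) ⟨hs', mem_univ _⟩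
  have hs0 : s = t₀ := by
    by_contra hne
    have hlt : t₀ < s := lt_of_le_of_ne hs.1 (Ne.symm hne)
    set e := chartAt (Fin n → ℂ) y with he
    have hea : e ∈ atlas (Fin n → ℂ) X := chart_mem_atlas _ y
    have hy : y ∈ e.source := mem_chart_source _ y
    have hz := e.map_source hy
    obtain ⟨D, hD, hC2, hle⟩ := hheat e hea s hlt hs.2 (e y) hz
    have hFy : ∀ s', t₀ ≤ s' → Fe e (s', e y) = F s' y := fun s' h => by
      rw [← hFe e hea s' h _ hz, e.left_inv hy]
    -- a maximum over `[t₀, s]` at its right end: only a one-sided condition on the time derivative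
    have hDge : 0 ≤ D - (c + η') := by
      have hd : HasDerivAt (fun s' => Fe e (s', e y) - (c + η') * (s' - t₀))
          (D - (c + η')) s := by
        exact (hD.sub (((hasDerivAt_id s).sub_const t₀).const_mul (c + η'))).congr_deriv (by ring)
      have hloc : IsLocalMaxOn (fun s' => Fe e (s', e y) - (c + η') * (s' - t₀)) (Icc t₀ s) s := by
        refine Filter.eventually_of_mem self_mem_nhdsWithin fun s' hs' => ?_
        have := hmax' s' ⟨hs'.1, hs'.2.trans hs.2⟩ y
        simpa only [hFy s' hs'.1, hFy s hs.1] using this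
      have h3 := hloc.hasFDerivWithinAt_nonpos hd.hasFDerivAt.hasFDerivWithinAt
        (y := t₀ - s) (sub_mem_posTangentConeAt_of_segment_subset (by
          rw [segment_symm, segment_eq_Icc hs.1]))
      have h4 : (t₀ - s) * (D - (c + η')) ≤ 0 := by simpa using h3
      nlinarith
    have hspace : IsLocalMax (fun w => Fe e (s, w)) (e y) := by
      filter_upwards [e.open_target.mem_nhds hz] with w hw
      have := hmax' s hs (e.symm w)
      rw [hFe e hea s hs.1 w hw] at this
      have h5 := hFy s hs.1
      linarith
    have := re_trace_hess_nonpos (hA e hea s hs.1 _ hz).inv.posSemidef hC2 hspace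
    linarith
  have h6 := hmax' t ht x
  have h7 := hB y
  rw [hs0, sub_self, mul_zero, sub_zero] at h6
  have h8 : η' * (t - t₀) ≤ η := by
    rw [hη', div_mul_eq_mul_div, div_le_iff₀ (by linarith)]
    have := ht.2
    nlinarith
  nlinarith

/-! ### Pluriharmonic functions -/

/-- On a compact connected complex manifold, every pluriharmonic function is constant. -/
theorem eq_of_pluriharmonic [CompactSpace X] [ConnectedSpace X] {w : X → ℝ}
    (hw : ∀ e ∈ atlas (Fin n → ℂ) X, ContDiffOn ℝ 2 (fun z => w (e.symm z)) e.target)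
    (hh : ∀ e ∈ atlas (Fin n → ℂ) X, ∀ z ∈ e.target, ∀ j k,
      dz j (dzbar k fun z => (w (e.symm z) : ℂ)) z = 0) (x y : X) : w x = w y := by
  have hcont : Continuous w := by
    refine continuous_iff_continuousAt.mpr fun x => ?_
    set e := chartAt (Fin n → ℂ) x
    have hx : x ∈ e.source := mem_chart_source _ x
    have h1 : ContinuousAt (fun y => w (e.symm (e y))) x :=
      ((hw e (chart_mem_atlas _ x)).continuousOn.continuousAt
        (e.open_target.mem_nhds (e.map_source hx))).comp (f := e) (e.continuousAt hx)
    refine h1.congr ?_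
    filter_upwards [e.open_source.mem_nhds hx] with y hy
    rw [e.left_inv hy]
  obtain ⟨x₀, -, hmax⟩ := isCompact_univ.exists_isMaxOn univ_nonempty hcont.continuousOn
  have hclopen : IsClopen {x | w x = w x₀} := by
    refine ⟨isClosed_eq hcont continuous_const, isOpen_iff_mem_nhds.mpr fun x hx => ?_⟩
    set e := chartAt (Fin n → ℂ) x
    have hea : e ∈ atlas (Fin n → ℂ) X := chart_mem_atlas _ x
    have hxs : x ∈ e.source := mem_chart_source _ x
    obtain ⟨r, hr, hrt⟩ := Metric.isOpen_iff.mp e.open_target (e x) (e.map_source hxs)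
    filter_upwards [e.open_source.mem_nhds hxs,
      (e.continuousAt hxs).preimage_mem_nhds (Metric.ball_mem_nhds (e x) hr)] with y hy hyr
    have hx' : w (e.symm (e x)) = w x₀ := by rw [e.left_inv hxs]; exact hx
    have := pluriharmonic_eq_of_isMaxOn ((hw e hea).mono hrt)
      (fun z hz => hh e hea z (hrt hz)) (fun z _ => by rw [hx']; exact hmax (mem_univ _)) hyr
    rw [hx', e.left_inv hy] at this
    exact this
  have huniv := hclopen.eq_univ ⟨x₀, rfl⟩
  have h1 : ∀ x, w x = w x₀ := fun x => (huniv ▸ mem_univ x : x ∈ {x | w x = w x₀})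
  rw [h1 x, h1 y]

/-! ### The flow on a compact manifold -/

/-- The metric of the flow in the chart `e`. -/
def chartMetric (g : ℝ → KahlerMetric n X) (e : OpenPartialHomeomorph X (Fin n → ℂ)) (t : ℝ)
    (z : Fin n → ℂ) : Matrix (Fin n) (Fin n) ℂ :=
  (g t).coeff e z

/-- The function `n - R`, computed in the preferred chart at each point. -/
def globalSpeed (g : ℝ → KahlerMetric n X) (t : ℝ) (x : X) : ℝ :=
  traceSpeed (chartMetric g (chartAt (Fin n → ℂ) x)) (t, chartAt (Fin n → ℂ) x x)

/-- The potential `v` with `∂v/∂t = v + (n - R)` and initial value `u₀` at time `t₀`. -/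
def globalPotential (g : ℝ → KahlerMetric n X) (u₀ : X → ℝ) (t₀ t : ℝ) (x : X) : ℝ :=
  Real.exp (t - t₀) * (u₀ x + ∫ s in t₀..t, Real.exp (-(s - t₀)) * globalSpeed g s x)

/-- The function `|∇φ|²`, computed in the preferred chart at each point. -/
def globalGradSq (g : KahlerMetric n X) (φ : X → ℝ) (x : X) : ℝ :=
  gradSq (g.coeff (chartAt (Fin n → ℂ) x) (chartAt (Fin n → ℂ) x x))
    (fun w => φ ((chartAt (Fin n → ℂ) x).symm w)) (chartAt (Fin n → ℂ) x x)

theorem gradNorm_eq (g : KahlerMetric n X) (φ : X → ℝ) (x : X) :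
    g.gradNorm φ x = Real.sqrt (globalGradSq g φ x) := rfl

/-- The test function `2 v² + (t - t₀) |∇v|² + c (t - t₀)² (n - R)`. -/
def globalTest (g : ℝ → KahlerMetric n X) (u₀ : X → ℝ) (t₀ c t : ℝ) (x : X) : ℝ :=
  2 * globalPotential g u₀ t₀ t x ^ 2 +
    (t - t₀) * globalGradSq (g t) (globalPotential g u₀ t₀ t) x +
    c * (t - t₀) ^ 2 * globalSpeed g t x

section Flow

variable {g : ℝ → KahlerMetric n X} {u : ℝ → X → ℝ} {t₀ : ℝ}
  {e : OpenPartialHomeomorph X (Fin n → ℂ)}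

theorem flowSpeed_eq (g : ℝ → KahlerMetric n X) (e : OpenPartialHomeomorph X (Fin n → ℂ)) (t : ℝ)
    (z : Fin n → ℂ) : flowSpeed (chartMetric g e) t z = (g t).coeff e z - (g t).ricci e z := by
  ext k j
  simp only [flowSpeed, chartMetric, logDet, KahlerMetric.ricci, Matrix.add_apply,
    Matrix.sub_apply, Matrix.of_apply, sub_neg_eq_add]

theorem IsKahlerRicciFlow.localFlow (hg : IsKahlerRicciFlow g) (ht₀ : 0 ≤ t₀)
    (he : e ∈ atlas (Fin n → ℂ) X) : LocalFlow t₀ e.target (chartMetric g e) where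
  isOpen := e.open_target
  posDef t _ z hz := (g t).posDef e he z hz
  smooth k j := (hg.smooth e he k j).mono (prod_mono (Ici_subset_Ici.mpr ht₀) subset_rfl)
  closed t _ z hz j k l := (g t).closed e he z hz j k l
  flow t ht z hz k j := by
    have h := (hg.flow e he z hz t (ht₀.trans ht.le) k j).hasDerivAt
      (Ici_mem_nhds (ht₀.trans_lt ht))
    rw [flowSpeed_eq, Matrix.sub_apply, ← neg_sub]
    exact h

theorem scalarCurvature_sub (t : ℝ) (x : X) :
    (g t).scalarCurvature x - n = -globalSpeed g t x := by
  have hd := ((g t).posDef _ (chart_mem_atlas (Fin n → ℂ) x) _ (mem_chart_target _ x)).det_pos.ne'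
  rw [globalSpeed, traceSpeed]
  simp only
  rw [flowSpeed_eq, chartMetric, mul_sub, Matrix.nonsing_inv_mul _ (isUnit_iff_ne_zero.mpr hd),
    trace_sub, trace_one, Fintype.card_fin, Complex.sub_re, Complex.natCast_re,
    KahlerMetric.scalarCurvature]
  ring

variable [MeasurableSpace X]

theorem IsRicciPotential.complexHessian_eq {t : ℝ} {φ : X → ℝ} (hu : IsRicciPotential (g t) φ)
    (he : e ∈ atlas (Fin n → ℂ) X) {z : Fin n → ℂ} (hz : z ∈ e.target) :
    complexHessian φ e z = flowSpeed (chartMetric g e) t z := by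
  rw [flowSpeed_eq, ← neg_sub, hu.ricci_sub e he z hz, neg_neg]

theorem hess_initial (hu : ∀ t, 0 ≤ t → IsRicciPotential (g t) (u t)) (ht₀ : 0 ≤ t₀)
    (he : e ∈ atlas (Fin n → ℂ) X) :
    ∀ z ∈ e.target, ∀ k j, dz j (dzbar k fun w => (u t₀ (e.symm w) : ℂ)) z =
      flowSpeed (chartMetric g e) t₀ z k j := fun z hz k j => by
  rw [← (hu t₀ ht₀).complexHessian_eq he hz]; rfl

variable [IsManifold 𝓘(ℂ, Fin n → ℂ) ω X]

/-- `n - R` does not depend on the chart. Since `g - Ric = ∂∂̄u`, its transformation law is that of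
the complex Hessian of `u`. -/
theorem traceSpeed_chart (hu : ∀ t, 0 ≤ t → IsRicciPotential (g t) (u t))
    (he : e ∈ atlas (Fin n → ℂ) X) {t : ℝ} (ht : 0 ≤ t) {z : Fin n → ℂ} (hz : z ∈ e.target) :
    traceSpeed (chartMetric g e) (t, z) = globalSpeed g t (e.symm z) := by
  set x := e.symm z with hx
  have hxe : x ∈ e.source := e.map_target hz
  have hez : e x = z := e.right_inv hz
  have hx2 : x ∈ e.source ∩ (chartAt (Fin n → ℂ) x).source := ⟨hxe, mem_chart_source _ x⟩
  have he' := chart_mem_atlas (Fin n → ℂ) x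
  rw [globalSpeed, traceSpeed, traceSpeed, ← hez]
  simp only
  rw [← (hu t ht).complexHessian_eq he (e.map_source hxe),
    ← (hu t ht).complexHessian_eq he' (mem_chart_target _ x)]
  exact congrArg Complex.re (trace_inv_mul_transform ((g t).transform e he _ he' x hx2)
    (complexHessian_transform (hu t ht).smooth he he' hx2)
    ((g t).posDef e he _ (e.map_source hxe)).det_pos.ne')

theorem flowPotential_chart (hu : ∀ t, 0 ≤ t → IsRicciPotential (g t) (u t)) (ht₀ : 0 ≤ t₀)
    (he : e ∈ atlas (Fin n → ℂ) X) {t : ℝ} (ht : t₀ ≤ t) {z : Fin n → ℂ} (hz : z ∈ e.target) :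
    globalPotential g (u t₀) t₀ t (e.symm z) =
      flowPotential t₀ (fun w => u t₀ (e.symm w)) (chartMetric g e) (t, z) := by
  rw [globalPotential, flowPotential]
  congr 2
  refine intervalIntegral.integral_congr fun s hs => ?_
  rw [uIcc_of_le ht] at hs
  simp only [traceSpeed_chart hu he (ht₀.trans hs.1) hz]

variable (hg : IsKahlerRicciFlow g) (hu : ∀ t, 0 ≤ t → IsRicciPotential (g t) (u t))
  (ht₀ : 0 ≤ t₀)

include hg hu ht₀

theorem contDiffOn_globalPotential (he : e ∈ atlas (Fin n → ℂ) X) {t : ℝ} (ht : t₀ ≤ t) :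
    ContDiffOn ℝ ∞ (fun w => globalPotential g (u t₀) t₀ t (e.symm w)) e.target := by
  have h1 := (hg.localFlow ht₀ he).contDiffOn_flowPotential
    (contDiffOn_comp_symm (hu t₀ ht₀).smooth he)
  refine (h1.comp (f := fun w => (t, w)) (by fun_prop) fun w hw => ⟨ht, hw⟩).congr fun w hw => ?_
  exact flowPotential_chart hu ht₀ he ht hw

/-- At each time the potential `v` and the Ricci potential `u` differ by a constant. -/
theorem sub_globalPotential_const [CompactSpace X] [ConnectedSpace X] {t : ℝ} (ht : t₀ ≤ t)
    (x y : X) : u t x - globalPotential g (u t₀) t₀ t x =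
      u t y - globalPotential g (u t₀) t₀ t y := by
  have hsm : ∀ e ∈ atlas (Fin n → ℂ) X, ContDiffOn ℝ ∞ (fun z => u t (e.symm z)) e.target :=
    fun e he => contDiffOn_comp_symm (hu t (ht₀.trans ht)).smooth he
  refine eq_of_pluriharmonic (w := fun x => u t x - globalPotential g (u t₀) t₀ t x)
    (fun e he => ((hsm e he).sub (contDiffOn_globalPotential hg hu ht₀ he ht)).of_le
      (WithTop.coe_le_coe.mpr le_top)) (fun e he z hz j k => ?_) x y
  have h1 : dz j (dzbar k fun w => (u t (e.symm w) : ℂ)) z =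
      flowSpeed (chartMetric g e) t z k j := by
    rw [← (hu t (ht₀.trans ht)).complexHessian_eq he hz]; rfl
  have h2 := (hg.localFlow ht₀ he).hess_flowPotential
    (contDiffOn_comp_symm (hu t₀ ht₀).smooth he) (hess_initial hu ht₀ he) ht hz k j
  have hc1 : ContDiffOn ℝ ∞ (fun p : ℝ × (Fin n → ℂ) => (u t (e.symm p.2) : ℂ))
      (Ioi 0 ×ˢ e.target) :=
    (contDiffOn_ofReal (hsm e he)).comp contDiff_snd.contDiffOn fun p hp => hp.2
  have hc2 : ContDiffOn ℝ ∞ (fun p : ℝ × (Fin n → ℂ) => (flowPotential t₀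
      (fun w => u t₀ (e.symm w)) (chartMetric g e) (t, p.2) : ℂ)) (Ioi 0 ×ˢ e.target) :=
    (contDiffOn_ofReal ((contDiffOn_globalPotential hg hu ht₀ he ht).congr fun w hw =>
      (flowPotential_chart hu ht₀ he ht hw).symm)).comp contDiff_snd.contDiffOn fun p hp => hp.2
  set O : TopologicalSpace.Opens (ℝ × (Fin n → ℂ)) :=
    ⟨Ioi 0 ×ˢ e.target, isOpen_Ioi.prod e.open_target⟩
  have h3 := congrArg (smoothAlg.eval (⟨(1, z), (show (0 : ℝ) < 1 from one_pos), hz⟩ : O))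
    (show algHess algDz algDzbar (smoothAlg.mk (O := O) _ (hc1.sub hc2)) k j =
      algHess algDz algDzbar (smoothAlg.mk (O := O) _ hc1) k j -
        algHess algDz algDzbar (smoothAlg.mk (O := O) _ hc2) k j by
      have : smoothAlg.mk (O := O) _ (hc1.sub hc2) = smoothAlg.mk (O := O) _ hc1 -
        smoothAlg.mk (O := O) _ hc2 := rfl
      simp only [this, algHess, Matrix.of_apply, map_sub])
  rw [map_sub, eval_algHess, eval_algHess, eval_algHess] at h3
  have h4 : (fun w => ((u t (e.symm w) - globalPotential g (u t₀) t₀ t (e.symm w) : ℝ) : ℂ))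
      =ᶠ[nhds z] fun w => (u t (e.symm w) : ℂ) - (flowPotential t₀
        (fun w => u t₀ (e.symm w)) (chartMetric g e) (t, w) : ℂ) := by
    filter_upwards [e.open_target.mem_nhds hz] with w hw
    rw [flowPotential_chart hu ht₀ he ht hw, Complex.ofReal_sub]
  rw [dz_dzbar_congr h4]
  refine h3.trans ?_
  simp only
  rw [h1, h2, sub_self]

/-- The test function on the manifold has the expected expression in every chart, not only in the
preferred one by which it is defined. -/
theorem globalTest_chart (c : ℝ) (he : e ∈ atlas (Fin n → ℂ) X) {t : ℝ} (ht : t₀ ≤ t)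
    {z : Fin n → ℂ} (hz : z ∈ e.target) :
    globalTest g (u t₀) t₀ c t (e.symm z) =
      LocalFlow.testFunction t₀ (fun w => u t₀ (e.symm w)) (chartMetric g e) c (t, z) := by
  rw [globalTest, LocalFlow.testFunction, flowPotential_chart hu ht₀ he ht hz,
    traceSpeed_chart hu he (ht₀.trans ht) hz]
  congr 3
  set x := e.symm z with hx
  have hxe : x ∈ e.source := e.map_target hz
  have hez : e x = z := e.right_inv hz
  have hx2 : x ∈ e.source ∩ (chartAt (Fin n → ℂ) x).source := ⟨hxe, mem_chart_source _ x⟩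
  have he' := chart_mem_atlas (Fin n → ℂ) x
  have h1 : (fun w => flowPotential t₀ (fun w => u t₀ (e.symm w)) (chartMetric g e) (t, w))
      =ᶠ[nhds (e x)] fun w => globalPotential g (u t₀) t₀ t
        ((chartAt (Fin n → ℂ) x).symm ((chartAt (Fin n → ℂ) x ∘ e.symm) w)) := by
    refine Filter.EventuallyEq.trans ?_
      (comp_symm_eventuallyEq (globalPotential g (u t₀) t₀ t) hx2)
    filter_upwards [e.open_target.mem_nhds (e.map_source hxe)] with w hw
    exact (flowPotential_chart hu ht₀ he ht hw).symm
  simp only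
  rw [← hez, gradSq_congr h1, globalGradSq]
  have h2 := gradSq_comp (A := chartMetric g e t (e x))
    (φ := fun w => globalPotential g (u t₀) t₀ t ((chartAt (Fin n → ℂ) x).symm w))
    (τ := chartAt (Fin n → ℂ) x ∘ e.symm) (z := e x) ?_
    ((contDiffAt_transition he he' hx2).differentiableAt (by simp))
    ((g t).transform e he _ he' x hx2) ((g t).posDef e he _ (e.map_source hxe)).det_pos.ne'
  · rw [h2, transition_apply hx2]
  · rw [transition_apply hx2]
    exact ((contDiffOn_globalPotential hg hu ht₀ he' ht).contDiffAt
      ((chartAt (Fin n → ℂ) x).open_target.mem_nhds (mem_chart_target _ x))).differentiableAt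
        (by simp)

/-- The bound `|v| ≤ e^{t - t₀} sup |u(t₀)|`, by the maximum principle for `± e^{-(t - t₀)} v`. -/
theorem abs_globalPotential_le [CompactSpace X] {ε : ℝ} (hε : ∀ x, |u t₀ x| ≤ ε) {t : ℝ}
    (ht : t₀ ≤ t) (x : X) : |globalPotential g (u t₀) t₀ t x| ≤ Real.exp (t - t₀) * ε := by
  have key : ∀ c : ℝ, (∀ x, c * u t₀ x ≤ ε) →
      c * Real.exp (-(t - t₀)) * globalPotential g (u t₀) t₀ t x ≤ ε := fun c hc => by
    have := le_of_heatLE (T := t) (B := ε) (c := 0) (t := t) (t₀ := t₀)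
      (F := fun t x => c * Real.exp (-(t - t₀)) * globalPotential g (u t₀) t₀ t x)
      (chartMetric g) (fun e p => c * Real.exp (-(p.1 - t₀)) *
        flowPotential t₀ (fun w => u t₀ (e.symm w)) (chartMetric g e) p)
      (fun e he t ht z hz => by simp only [flowPotential_chart hu ht₀ he ht hz])
      (fun e he => ContinuousOn.mul (by fun_prop)
        ((hg.localFlow ht₀ he).contDiffOn_flowPotential
          (contDiffOn_comp_symm (hu t₀ ht₀).smooth he)).continuousOn)
      (fun e he t ht z hz => (g t).posDef e he z hz)
      (fun e he t ht _ z hz => (hg.localFlow ht₀ he).heatLE_damped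
        (contDiffOn_comp_symm (hu t₀ ht₀).smooth he) (hess_initial hu ht₀ he) c ht hz)
      (fun x => by simpa [globalPotential] using hc x) ⟨ht, le_rfl⟩ x
    simpa using this
  have h1 := key 1 fun x => by simpa using (abs_le.mp (hε x)).2
  have h2 := key (-1) fun x => by have := (abs_le.mp (hε x)).1; linarith
  have h3 : Real.exp (t - t₀) * Real.exp (-(t - t₀)) = 1 := by rw [← Real.exp_add]; simp
  have h4 := Real.exp_pos (t - t₀)
  rw [abs_le]
  constructor
  · have := mul_le_mul_of_nonneg_left h2 h4.le
    have e : Real.exp (t - t₀) * (-1 * Real.exp (-(t - t₀)) * globalPotential g (u t₀) t₀ t x) =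
        -globalPotential g (u t₀) t₀ t x := by
      linear_combination -(globalPotential g (u t₀) t₀ t x) * h3
    linarith
  · have := mul_le_mul_of_nonneg_left h1 h4.le
    have e : Real.exp (t - t₀) * (1 * Real.exp (-(t - t₀)) * globalPotential g (u t₀) t₀ t x) =
        globalPotential g (u t₀) t₀ t x := by
      linear_combination (globalPotential g (u t₀) t₀ t x) * h3
    linarith

/-- The bound of the test function at time `t₀ + 2`. -/
theorem globalTest_le [CompactSpace X] {ε c : ℝ} (hε0 : 0 ≤ ε) (hε1 : ε ≤ 1)
    (hε : ∀ x, |u t₀ x| ≤ ε) (hc : |c| ≤ ε / 4) (x : X) :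
    globalTest g (u t₀) t₀ c (t₀ + 2) x ≤ (2 + 8 * Real.exp 2 ^ 2 + 2 * n) * ε ^ 2 := by
  have := le_of_heatLE (T := t₀ + 2) (B := 2 * ε ^ 2) (t := t₀ + 2)
    (c := 4 * (Real.exp 2 * ε) ^ 2 + n * ε ^ 2) (F := globalTest g (u t₀) t₀ c)
    (chartMetric g)
    (fun e => LocalFlow.testFunction t₀ (fun w => u t₀ (e.symm w)) (chartMetric g e) c)
    (fun e he t ht z hz => globalTest_chart hg hu ht₀ c he ht hz)
    (fun e he => ((hg.localFlow ht₀ he).contDiffOn_testFunction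
          (contDiffOn_comp_symm (hu t₀ ht₀).smooth he) c).continuousOn)
    (fun e he t ht z hz => (g t).posDef e he z hz)
    (fun e he t ht ht2 z hz => by
      obtain ⟨D, h1, h2, h3⟩ := (hg.localFlow ht₀ he).heatLE_testFunction
        (contDiffOn_comp_symm (hu t₀ ht₀).smooth he) (hess_initial hu ht₀ he) hε0 hε1 hc ht
        ht2 hz
      refine ⟨D, h1, h2, h3.trans ?_⟩
      have h4 := abs_globalPotential_le hg hu ht₀ hε ht.le (e.symm z)
      rw [flowPotential_chart hu ht₀ he ht.le hz] at h4
      have h5 : Real.exp (t - t₀) * ε ≤ Real.exp 2 * ε := by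
        gcongr; linarith
      have h6 := sq_le_sq' (by linarith [neg_abs_le (flowPotential t₀
        (fun w => u t₀ (e.symm w)) (chartMetric g e) (t, z))])
        ((le_abs_self _).trans (h4.trans h5))
      linarith)
    (fun x => by
      have h1 : globalTest g (u t₀) t₀ c t₀ x = 2 * u t₀ x ^ 2 := by
        simp [globalTest, globalPotential]
      rw [h1]
      have := sq_le_sq' (abs_le.mp (hε x)).1 (abs_le.mp (hε x)).2
      linarith) ⟨by linarith, le_rfl⟩ x
  refine this.trans (le_of_eq ?_)
  ring

theorem globalGradSq_nonneg {t : ℝ} (ht : t₀ < t) (x : X) :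
    0 ≤ globalGradSq (g t) (globalPotential g (u t₀) t₀ t) x := by
  set e := chartAt (Fin n → ℂ) x with he
  have hea := chart_mem_atlas (Fin n → ℂ) x
  have h := hg.localFlow ht₀ hea
  have hz := mem_chart_target (Fin n → ℂ) x
  have hus := contDiffOn_comp_symm (hu t₀ ht₀).smooth hea
  have h1 := (h.isRealPoint hus ⟨(t, e x), ht, hz⟩).ev_gradSq
  rw [h.eval_gradSq hus] at h1
  have h2 : globalGradSq (g t) (globalPotential g (u t₀) t₀ t) x =
      gradSq (chartMetric g e t (e x)) (fun w => flowPotential t₀ (fun w => u t₀ (e.symm w))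
        (chartMetric g e) (t, w)) (e x) := by
    refine gradSq_congr ?_
    filter_upwards [e.open_target.mem_nhds hz] with w hw
    exact flowPotential_chart hu ht₀ hea ht.le hw
  rw [h2]
  exact_mod_cast h1

/-- `|∇u| = |∇v|`, because `u - v` is constant on `X`. -/
theorem globalGradSq_eq [CompactSpace X] [ConnectedSpace X] {t : ℝ} (ht : t₀ ≤ t) (x : X) :
    globalGradSq (g t) (u t) x = globalGradSq (g t) (globalPotential g (u t₀) t₀ t) x := by
  set C := u t x - globalPotential g (u t₀) t₀ t x
  have h1 : ∀ y, u t y = globalPotential g (u t₀) t₀ t y + C := fun y => by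
    have := sub_globalPotential_const hg hu ht₀ ht y x
    linarith
  simp only [globalGradSq, gradSq, h1, Complex.ofReal_add, dz, dzbar, fderiv_add_const]

end Flow

end KRF

end

/-! ### The smoothing estimate -/

theorem lemma1 (n : ℕ) :
    ∃ δ K : ℝ, 0 < δ ∧ 0 < K ∧
      ∀ (X : Type*) [TopologicalSpace X] [T2Space X] [CompactSpace X] [ConnectedSpace X]
        [ChartedSpace (Fin n → ℂ) X] [IsManifold 𝓘(ℂ, Fin n → ℂ) ω X]
        [MeasurableSpace X] [BorelSpace X]
        (g : ℝ → KRF.KahlerMetric n X) (u : ℝ → X → ℝ),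
        KRF.IsKahlerRicciFlow g →
        (∀ t : ℝ, 0 ≤ t → KRF.IsRicciPotential (g t) (u t)) →
        ∀ ε : ℝ, 0 < ε → ε ≤ δ → ∀ t₀ : ℝ, 0 ≤ t₀ →
          KRF.normC0 (u t₀) ≤ ENNReal.ofReal ε →
          KRF.normC0 ((g (t₀ + 2)).gradNorm (u (t₀ + 2))) +
            KRF.normC0 (fun x => (g (t₀ + 2)).scalarCurvature x - n) ≤
              ENNReal.ofReal (K * ε) := by
  set C : ℝ := 2 + 8 * Real.exp 2 ^ 2 + 2 * n with hC
  have hC0 : 0 < C := by positivity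
  refine ⟨1, Real.sqrt C + C, one_pos, by positivity, ?_⟩
  intro X _ _ _ _ _ _ _ _ g u hg hu ε hε hε1 t₀ ht₀ hnorm
  have hsup : ∀ x, |u t₀ x| ≤ ε := fun x =>
    (ENNReal.ofReal_le_ofReal_iff hε.le).mp ((le_iSup (fun x => ENNReal.ofReal |u t₀ x|) x).trans
      hnorm)
  -- at `s = 2` the coefficient `c s²` is `± ε`; the sum of the two bounds controls the gradient and
  -- each of them one side of the curvature
  have hbounds : ∀ x, KRF.globalGradSq (g (t₀ + 2)) (u (t₀ + 2)) x ≤ C * ε ^ 2 ∧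
      |KRF.globalSpeed g (t₀ + 2) x| ≤ C * ε := fun x => by
    rw [KRF.globalGradSq_eq hg hu ht₀ (by linarith)]
    have h1 := KRF.globalTest_le hg hu ht₀ hε.le hε1 hsup (c := ε / 4)
      (by rw [abs_of_pos (by positivity)]) x
    have h2 := KRF.globalTest_le hg hu ht₀ hε.le hε1 hsup (c := -(ε / 4))
      (by rw [abs_neg, abs_of_pos (by positivity)]) x
    have h3 := KRF.globalGradSq_nonneg hg hu ht₀ (t := t₀ + 2) (by linarith) x
    rw [KRF.globalTest, ← hC] at h1 h2
    simp only [add_sub_cancel_left] at h1 h2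
    have h4 := sq_nonneg (KRF.globalPotential g (u t₀) t₀ (t₀ + 2) x)
    refine ⟨by nlinarith, ?_⟩
    refine le_of_mul_le_mul_left ?_ hε
    rw [← abs_of_pos hε, ← abs_mul, abs_of_pos hε, abs_le]
    constructor <;> nlinarith
  have hgrad : KRF.normC0 ((g (t₀ + 2)).gradNorm (u (t₀ + 2))) ≤
      ENNReal.ofReal (Real.sqrt C * ε) := by
    refine iSup_le fun x => ENNReal.ofReal_le_ofReal ?_
    rw [KRF.gradNorm_eq, abs_of_nonneg (Real.sqrt_nonneg _)]
    refine (Real.sqrt_le_sqrt (hbounds x).1).trans (le_of_eq ?_)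
    rw [Real.sqrt_mul hC0.le, Real.sqrt_sq hε.le]
  have hcurv : KRF.normC0 (fun x => (g (t₀ + 2)).scalarCurvature x - n) ≤
      ENNReal.ofReal (C * ε) := by
    refine iSup_le fun x => ENNReal.ofReal_le_ofReal ?_
    change |(g (t₀ + 2)).scalarCurvature x - n| ≤ C * ε
    rw [KRF.scalarCurvature_sub, abs_neg]
    exact (hbounds x).2
  rw [add_mul, ENNReal.ofReal_add (by positivity) (by positivity)]
  exact add_le_add hgrad hcurv
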